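/- Let $\mathbb{T}^d=(\mathbb{R}/\mathbb{Z})^d$, let $J:\mathbb{R}^d\to[0,\infty)$ be integrable with finite first moment $\int_{\mathbb{R}^d}|h|J(h)\,dh<\infty$, put $\hat J:=\int_{\mathbb{R}^d}J$, and let $\beta\hat J>1$. Put $\mathfrak{s}:=\sqrt{1-\beta^{-2}\hat J^{-2}}$, $\boldsymbol\Lambda:=-\frac{\hat J}{2}-\frac{1}{2\beta^2\hat J}$, $$L(S,A_\pm):=\beta^{-1}A_+(\log A_+-1)\tfrac{1+S}{2}+\beta^{-1}A_-(\log A_--1)\tfrac{1-S}{2},$$ $$\mathcal{W}_\beta(S):=\inf\Big\{L(S,A_\pm)-\tfrac12\hat J S^2-\boldsymbol\Lambda\;:\;A_\pm\ge 0,\ A_-\tfrac{1-S}{2}-A_+\tfrac{1+S}{2}=0\Big\},\qquad \Psi(S,V):=\frac12\int_0^V\frac{V-Z}{\sqrt{Z^2+(1-S)(1+S)}}\,dZ .$$ For $\lambda>0$ let $J^\lambda(z):=\lambda^{-d}J(\lambda^{-1}z)$, acting on the torus through its periodization $\sum_{k\in\mathbb{Z}^d}J^\lambda(\cdot+k)$.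 For $\Omega\subset\mathbb{R}\times\mathbb{T}^d$ with time slices $\Omega_\tau$ put $$\mathcal{G}^\lambda(s;\Omega):=\int_{\mathbb{R}}\frac1\lambda\int_{\Omega_\tau}\Big[\mathcal{W}_\beta(s)+\frac1{2\beta}\Psi(s,\lambda\,\partial_\tau s)+\frac14\int_{\Omega_\tau}J^\lambda(z-w)\big(s(\tau,z)-s(\tau,w)\big)^2dw\Big]dz\,d\tau,$$ where $\partial_\tau s\in L^1_{loc}$ is the weak time derivative of $s$ in the interior of $\Omega$, and $\mathcal{G}^\lambda(s;\Omega):=+\infty$ if there is none. A polyhedral set in $\mathbb{R}\times\mathbb{T}^d$ is an open or closed set whose boundary, lifted to $\mathbb{R}^{d+1}$, is a Lipschitz surface and is contained, over the unit cell $[0,1]^d$, in finitely many affine hyperplanes; a polyhedral region $\Omega\subset(0,T)\times\mathbb{T}^d$ is the intersection of such a set with $(0,T)\times\mathbb{T}^d$. **Proposition.** Let $T>0$, let $\Omega\subset(0,T)\times\mathbb{T}^d$ be a polyhedral region, let $\lambda_n>0$ with $\lambda_n\to0$, and let $\hat s^{\lambda_n}:\Omega\to[-\mathfrak{s},\mathfrak{s}]$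 be measurable with $\sup_n\mathcal{G}^{\lambda_n}(\hat s^{\lambda_n};\Omega)<\infty$. Then the sequence $(\hat s^{\lambda_n})_n$ is relatively compact in $L^1(\Omega)$, and each of its cluster points belongs to $BV(\Omega;\{-\mathfrak{s},\mathfrak{s}\})$: it has bounded variation in the interior of $\Omega$ and takes values in $\{-\mathfrak{s},\mathfrak{s}\}$ almost everywhere in $\Omega$. -/

import Mathlib

open MeasureTheory Set Filter Topology
open scoped ENNReal NNReal

noncomputable section

namespace IsingGame

/-- Macroscopic space-time `ℝ × 𝕋ᵈ`, a point being `(τ, z)`. The torus `𝕋ᵈ = (ℝ/ℤ)ᵈ` has total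
mass one. -/
abbrev SpaceTime (d : ℕ) : Type := ℝ × UnitAddTorus (Fin d)

/-- The projection `ℝᵈ → 𝕋ᵈ`. -/
def toTorus {d : ℕ} (x : EuclideanSpace ℝ (Fin d)) : UnitAddTorus (Fin d) :=
  fun i => (x i : UnitAddCircle)

/-- The covering map `ℝᵈ⁺¹ → ℝ × 𝕋ᵈ`; coordinate `0` is time. -/
def cover {d : ℕ} (y : EuclideanSpace ℝ (Fin (d + 1))) : SpaceTime d :=
  (y 0, fun i => (y i.succ : UnitAddCircle))

/-! ### Polyhedral regions -/

/-- `S` is a Lipschitz surface: near each of its points it is the graph, over the hyperplane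
orthogonal to some unit vector `ν`, of a Lipschitz function. -/
def IsLipschitzSurface {E : Type*} [NormedAddCommGroup E] [InnerProductSpace ℝ E]
    (S : Set E) : Prop :=
  ∀ x ∈ S, ∃ (ν : E) (K : ℝ≥0) (g : E → ℝ), ‖ν‖ = 1 ∧ LipschitzWith K g ∧
    ∀ᶠ y in 𝓝 x, (y ∈ S ↔ inner ℝ ν y = g (y - (inner ℝ ν y : ℝ) • ν))

/-- A polyhedral set in `ℝ × 𝕋ᵈ`: an open or closed set whose boundary, seen in the covering space
`ℝᵈ⁺¹`, is a Lipschitz surface, and is contained over the unit cell `[0,1]ᵈ` of the torus in the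
union of finitely many affine hyperplanes `{y | ⟪ν, y⟫ = c}`. -/
structure IsPolyhedral {d : ℕ} (E : Set (SpaceTime d)) : Prop where
  isOpen_or_isClosed : IsOpen E ∨ IsClosed E
  lipschitz : IsLipschitzSurface (cover ⁻¹' frontier E)
  hyperplanes : ∃ H : Finset (EuclideanSpace ℝ (Fin (d + 1)) × ℝ), (∀ h ∈ H, h.1 ≠ 0) ∧
    ∀ y : EuclideanSpace ℝ (Fin (d + 1)), cover y ∈ frontier E →
      (∀ i : Fin d, y i.succ ∈ Icc (0 : ℝ) 1) → ∃ h ∈ H, inner ℝ h.1 y = h.2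

/-- A polyhedral set in the domain `D` is the intersection with `D` of a polyhedral set. -/
def IsPolyhedralIn {d : ℕ} (D Ω : Set (SpaceTime d)) : Prop :=
  ∃ E : Set (SpaceTime d), IsPolyhedral E ∧ Ω = E ∩ D

/-! ### Derivatives and functions of bounded variation on `ℝ × 𝕋ᵈ` -/

/-- `φ` is a `C¹` function on `ℝ × 𝕋ᵈ` with compact support in `U`. -/
structure IsTestFunction {d : ℕ} {F : Type*} [NormedAddCommGroup F] [NormedSpace ℝ F]
    (U : Set (SpaceTime d)) (φ : SpaceTime d → F) : Prop where
  contDiff : ContDiff ℝ 1 (fun y => φ (cover y))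
  hasCompactSupport : HasCompactSupport φ
  tsupport_subset : tsupport φ ⊆ U

/-- The classical time derivative `∂_τ φ`. -/
def timeDeriv {d : ℕ} (φ : SpaceTime d → ℝ) (p : SpaceTime d) : ℝ :=
  deriv (fun h : ℝ => φ (p.1 + h, p.2)) 0

/-- The classical spatial partial derivative `∂_{z_i} φ`. -/
def spaceDeriv {d : ℕ} (i : Fin d) (φ : SpaceTime d → ℝ) (p : SpaceTime d) : ℝ :=
  deriv (fun h : ℝ => φ (p.1, p.2 + Pi.single i (h : UnitAddCircle))) 0

/-- The space-time divergence of a vector field; component `0` is the time component. -/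
def divergence {d : ℕ} (X : SpaceTime d → EuclideanSpace ℝ (Fin (d + 1)))
    (p : SpaceTime d) : ℝ :=
  timeDeriv (fun q => X q 0) p + ∑ i : Fin d, spaceDeriv i (fun q => X q i.succ) p

/-- `v ∈ L¹_loc(U)` is the weak time derivative in the open set `U` of `s ∈ L¹_loc(U)`. -/
structure IsWeakTimeDeriv {d : ℕ} (U : Set (SpaceTime d)) (s v : SpaceTime d → ℝ) : Prop where
  locallyIntegrableOn : LocallyIntegrableOn s U volume
  locallyIntegrableOn_deriv : LocallyIntegrableOn v U volume
  integral_eq : ∀ φ : SpaceTime d → ℝ, IsTestFunction U φ →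
    ∫ p in U, s p * timeDeriv φ p = - ∫ p in U, v p * φ p

/-- `f ∈ BV(U)` for an open set `U`: `f` is integrable on `U` and the integrals `∫_U f div X` over
the `C¹` vector fields `X` with compact support in `U` and `|X| ≤ 1` are bounded above. -/
structure MemBV {d : ℕ} (U : Set (SpaceTime d)) (f : SpaceTime d → ℝ) : Prop where
  integrableOn : IntegrableOn f U volume
  bounded_variation : ∃ C : ℝ, ∀ X : SpaceTime d → EuclideanSpace ℝ (Fin (d + 1)),
    IsTestFunction U X → (∀ p, ‖X p‖ ≤ 1) → ∫ p in U, f p * divergence X p ≤ C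

/-! ### The energy -/

/-- The Lagrangian `L(S, a_±)` of the control problem (with `0 log 0 = 0`). -/
def lagrangian (β S ap am : ℝ) : ℝ :=
  β⁻¹ * ap * (Real.log ap - 1) * ((1 + S) / 2) + β⁻¹ * am * (Real.log am - 1) * ((1 - S) / 2)

/-- The cost `Λ` of the stationary equilibria. -/
def stationaryCost (β Jhat : ℝ) : ℝ := -(Jhat / 2) - 1 / (2 * β ^ 2 * Jhat)

/-- The local energy `W(S, V)`: the infimum of `L(S, A_±) - Ĵ S² / 2 - Λ` over the controls
`A_± ≥ 0` that produce the velocity `V`. It is used for `|S| < 1`, where the infimum is over a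
nonempty set bounded below. -/
def localCost (β Jhat S V : ℝ) : ℝ :=
  sInf {c : ℝ | ∃ ap am : ℝ, 0 ≤ ap ∧ 0 ≤ am ∧
    V = am * ((1 - S) / 2) - ap * ((1 + S) / 2) ∧
    c = lagrangian β S ap am - 1 / 2 * Jhat * S ^ 2 - stationaryCost β Jhat}

/-- The potential `𝒲_β(S) = W(S, 0)`, a double well when `β Ĵ > 1`. -/
def doubleWell (β Jhat S : ℝ) : ℝ := localCost β Jhat S 0

/-- The minimizer `𝔰 = √(1 - β⁻² Ĵ⁻²)` of the double well. -/
def equilibrium (β Jhat : ℝ) : ℝ := Real.sqrt (1 - (β ^ 2)⁻¹ * (Jhat ^ 2)⁻¹)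

/-- The kinetic energy `Ψ(S, V)`, for `|S| < 1`. -/
def kinetic (S V : ℝ) : ℝ :=
  1 / 2 * ∫ Z in (0 : ℝ)..V, (V - Z) / Real.sqrt (Z ^ 2 + (1 - S) * (1 + S))

/-- The rescaled interaction kernel `J^λ(x) = λ⁻ᵈ J(λ⁻¹ x)` on `ℝᵈ`. -/
def scaledKernel {d : ℕ} (J : EuclideanSpace ℝ (Fin d) → ℝ) (lam : ℝ)
    (x : EuclideanSpace ℝ (Fin d)) : ℝ :=
  (lam ^ d)⁻¹ * J (lam⁻¹ • x)

/-- The (nonnegative) kernel `J^λ` acting on the torus, i.e. its periodization: the sum of `J^λ`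
over all the points of `ℝᵈ` that represent `z`. Integrating against it over `𝕋ᵈ` is integrating the
periodic extension against `J^λ` over `ℝᵈ`. -/
def torusKernel {d : ℕ} (J : EuclideanSpace ℝ (Fin d) → ℝ) (lam : ℝ)
    (z : UnitAddTorus (Fin d)) : ℝ≥0∞ :=
  ∑' y : {y : EuclideanSpace ℝ (Fin d) // toTorus y = z}, ENNReal.ofReal (scaledKernel J lam y)

/-- The localized energy `G^λ(s, v; A)` of a spin field `s` with velocity `v` on `A ⊆ 𝕋ᵈ`, for
nonnegative `J` and `|s| < 1`; all the terms are then nonnegative. -/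
def sliceEnergy {d : ℕ} (J : EuclideanSpace ℝ (Fin d) → ℝ) (β lam : ℝ)
    (s v : UnitAddTorus (Fin d) → ℝ) (A : Set (UnitAddTorus (Fin d))) : ℝ≥0∞ :=
  ENNReal.ofReal lam⁻¹ * ∫⁻ z in A,
    (ENNReal.ofReal (doubleWell β (∫ x, J x) (s z) + 1 / (2 * β) * kinetic (s z) (lam * v z)) +
      ENNReal.ofReal (1 / 4) *
        ∫⁻ w in A, torusKernel J lam (z - w) * ENNReal.ofReal ((s z - s w) ^ 2))

/-- The space-time energy `𝒢^λ(s; Ω) = ∫ G^λ(s(τ,·), ∂_τ s(τ,·); Ω_τ) dτ`, where `∂_τ s` is the weak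
time derivative in the interior of `Ω`. It is unique up to null sets, so that the infimum is over
one value; the energy is `∞` if `s` has no weak time derivative in `L¹_loc`. -/
def energy {d : ℕ} (J : EuclideanSpace ℝ (Fin d) → ℝ) (β lam : ℝ)
    (s : SpaceTime d → ℝ) (Ω : Set (SpaceTime d)) : ℝ≥0∞ :=
  ⨅ (v : SpaceTime d → ℝ) (_ : IsWeakTimeDeriv (interior Ω) s v),
    ∫⁻ τ : ℝ, sliceEnergy J β lam (fun z => s (τ, z)) (fun z => v (τ, z)) {z | (τ, z) ∈ Ω}

end IsingGame

end

noncomputable section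

namespace IsingGame

/-! ### Pointwise estimates -/

/-! This is a Modica–Mortola argument in which a nonlocal quadratic term replaces the spatial
gradient. Let r be the equilibrium and φ(s) = r² s - s³/3, so that φ' = r² - s². Every estimate is
made for φ(s) and transferred back to s at the end.

Time. The potential dominates (r² - s²)², and the kinetic cost grows quadratically for small and
linearly for large velocities, so Young's inequality bounds (r² - s²)|V| by the local density
(`mul_abs_le_density`). For V = λ ∂_τ s the prefactor 1/λ cancels. The chain rule, justified by
mollification, then gives O(|t|) in L¹ for a time translation of φ(s) by t
(`time_translation_bound`).

Space. By `abs_wellPrimitive_sub_le`, an increment of φ is controlled by the potential at one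
endpoint plus the squared increment of s. Since Ĵ > 0, the kernel exceeds some j > 0 on a compact
set A of positive measure. The L¹ errors of φ(s) under the shifts λy therefore sum to O(λ) over y ∈
A. By the Steinhaus theorem every small y₀ is a difference of two elements of A in many ways, so the
single shift λy₀ also costs O(λ). Chaining about |x|/λ such shifts costs O(|x| + λ) for a
translation by x (`exists_space_translation_bound`).

Conclusion. The bound C(‖h‖ + λₙ) on compact subsets (`exists_translation_bound`) gives total
boundedness in the manner of Fréchet and Kolmogorov, since φ has a continuous inverse on [-r, r].
The potential has integral O(λₙ), so by Fatou's lemma limits take the values ±r. There φ is a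
multiple of the identity, so the limiting bound C‖h‖ on φ(f) is one on f, and this is bounded
variation (`MemBV.of_translationError_le`). -/

/-- At zero velocity the two fluxes share a value x = ap (1 + S) = am (1 - S). With q = √(1 - S²)
the cost becomes β⁻¹ x (log (x/q) - 1), a convex function of x with minimum at x = q; the inequality
log y ≥ 1 - 1/y gives its value -β⁻¹ q there. -/
theorem entropy_lower_bound {β S ap am : ℝ} (hβ : 0 < β) (hS : S ^ 2 < 1) (hap : 0 ≤ ap)
    (ham : 0 ≤ am) (h : 0 = am * ((1 - S) / 2) - ap * ((1 + S) / 2)) :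
    -(β⁻¹ * Real.sqrt (1 - S ^ 2)) ≤ lagrangian β S ap am := by
  have hS1 : 0 < 1 - S := by nlinarith
  have hS2 : 0 < 1 + S := by nlinarith
  set q := Real.sqrt (1 - S ^ 2) with hq
  have hq0 : 0 < q := Real.sqrt_pos.2 (by linarith)
  have hqq : q ^ 2 = (1 - S) * (1 + S) := by rw [hq, Real.sq_sqrt (by linarith)]; ring
  have hβ' : 0 < β⁻¹ := inv_pos.2 hβ
  have heq : am * (1 - S) = ap * (1 + S) := by linarith
  rcases hap.eq_or_lt with rfl | hap
  · have : am = 0 := by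
      rcases mul_eq_zero.1 (heq.trans (zero_mul _)) with h | h
      · exact h
      · linarith
    subst this
    simp only [lagrangian]
    have : 0 < β⁻¹ * q := by positivity
    simp; positivity
  have ham : 0 < am := by
    have : 0 < am * (1 - S) := heq ▸ by positivity
    exact pos_of_mul_pos_left this hS1.le
  set x := ap * (1 + S) with hx
  have hx0 : 0 < x := by positivity
  have hprod : ap * am = (x / q) ^ 2 := by
    rw [div_pow, hqq, eq_div_iff (by positivity)]
    calc ap * am * ((1 - S) * (1 + S)) = (am * (1 - S)) * (ap * (1 + S)) := by ring
      _ = x ^ 2 := by rw [heq, hx]; ring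
  have hlog : Real.log ap + Real.log am = 2 * Real.log (x / q) := by
    rw [← Real.log_mul hap.ne' ham.ne', hprod, Real.log_pow]; norm_num
  have h1 := Real.one_sub_inv_le_log_of_pos (div_pos hx0 hq0)
  have hL : lagrangian β S ap am = β⁻¹ * (x * (Real.log (x / q) - 1)) := by
    have e1 : am * ((1 - S) / 2) = x / 2 := by linarith
    have e2 : ap * ((1 + S) / 2) = x / 2 := by linarith
    calc lagrangian β S ap am
        = β⁻¹ * ((Real.log ap - 1) * (ap * ((1 + S) / 2))
            + (Real.log am - 1) * (am * ((1 - S) / 2))) := by simp only [lagrangian]; ring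
      _ = β⁻¹ * (x / 2 * (Real.log ap + Real.log am - 2)) := by rw [e1, e2]; ring
      _ = _ := by rw [hlog]; ring
  rw [hL, ← mul_neg]
  refine mul_le_mul_of_nonneg_left ?_ hβ'.le
  have h2 : x * (1 - (x / q)⁻¹) ≤ x * Real.log (x / q) := by gcongr
  have h3 : x * (1 - (x / q)⁻¹) = x - q := by field_simp
  linarith

theorem equilibrium_sq {β j : ℝ} (hβ : 1 < β * j) :
    equilibrium β j ^ 2 = 1 - (β * j)⁻¹ ^ 2 := by
  rw [equilibrium, Real.sq_sqrt]
  · rw [inv_pow, mul_pow, mul_inv]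
  · rw [← mul_inv, ← mul_pow, sub_nonneg]
    exact inv_le_one_of_one_le₀ (one_le_pow₀ hβ.le)

theorem equilibrium_pos {β j : ℝ} (hβ : 1 < β * j) : 0 < equilibrium β j := by
  refine Real.sqrt_pos.2 ?_
  rw [← mul_inv, ← mul_pow, sub_pos]
  exact inv_lt_one_of_one_lt₀ (one_lt_pow₀ hβ two_ne_zero)

theorem equilibrium_lt_one {β j : ℝ} (hβ : 1 < β * j) : equilibrium β j < 1 := by
  have h := equilibrium_sq hβ
  have : 0 < (β * j)⁻¹ ^ 2 := by have : 0 < β * j := by linarith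
                                 positivity
  nlinarith [equilibrium_pos hβ]

/-- With q = √(1 - S²), the entropy bound completes to the square (j/2)(q - (βj)⁻¹)². The difference
of squares of the equilibrium and S factors as (q - (βj)⁻¹)(q + (βj)⁻¹), whose second factor is at
most 2; hence the constant j/8. -/
theorem doubleWell_lower_bound {β j S : ℝ} (hβ0 : 0 < β) (hj : 0 < j) (hβ : 1 < β * j)
    (hS : S ^ 2 ≤ equilibrium β j ^ 2) :
    j / 8 * (equilibrium β j ^ 2 - S ^ 2) ^ 2 ≤ doubleWell β j S := by
  have hlt := equilibrium_lt_one hβ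
  have hpos := equilibrium_pos hβ
  have hS1 : S ^ 2 < 1 := by nlinarith
  -- The zero controls are admissible, so the infimum is over a nonempty set.
  refine le_csInf ⟨_, 0, 0, le_rfl, le_rfl, by simp, rfl⟩ ?_
  rintro c ⟨ap, am, hap, ham, h, rfl⟩
  have hL := entropy_lower_bound hβ0 hS1 hap ham h
  set q := Real.sqrt (1 - S ^ 2) with hq
  have hqq : q ^ 2 = 1 - S ^ 2 := Real.sq_sqrt (by linarith)
  have hq0 : 0 ≤ q := Real.sqrt_nonneg _
  have hq1 : q ≤ 1 := by nlinarith [sq_nonneg S]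
  set r := (β * j)⁻¹ with hr
  have hr0 : 0 < r := by positivity
  have hr1 : r < 1 := inv_lt_one_of_one_lt₀ hβ
  have he : equilibrium β j ^ 2 - S ^ 2 = (q - r) * (q + r) := by
    rw [equilibrium_sq hβ]; nlinarith
  have hid : -(β⁻¹ * q) - 1 / 2 * j * S ^ 2 - stationaryCost β j = j / 2 * (q - r) ^ 2 := by
    have : S ^ 2 = 1 - q ^ 2 := by linarith
    rw [this, stationaryCost, hr]; field_simp; ring
  have : j / 8 * (equilibrium β j ^ 2 - S ^ 2) ^ 2 ≤ j / 2 * (q - r) ^ 2 := by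
    rw [he, mul_pow]
    have h4 : (q + r) ^ 2 ≤ 4 := by nlinarith
    have : (q - r) ^ 2 * (q + r) ^ 2 ≤ (q - r) ^ 2 * 4 := by gcongr
    nlinarith
  linarith

/-- On [0, V] the denominator is at most √(1 + V²), and V - Z integrates to V²/2. The resulting
bound is quadratic near zero and linear at infinity. -/
theorem kinetic_lower_bound_of_nonneg {S V : ℝ} (hS : S ^ 2 < 1) (hV : 0 ≤ V) :
    V ^ 2 / (4 * Real.sqrt (1 + V ^ 2)) ≤
      1 / 2 * ∫ Z in (0 : ℝ)..V, (V - Z) / Real.sqrt (Z ^ 2 + (1 - S) * (1 + S)) := by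
  have hpos : ∀ Z : ℝ, 0 < Real.sqrt (Z ^ 2 + (1 - S) * (1 + S)) := fun Z =>
    Real.sqrt_pos.2 (by nlinarith [sq_nonneg Z])
  have h : ∫ Z in (0 : ℝ)..V, (V - Z) / Real.sqrt (1 + V ^ 2) ≤
      ∫ Z in (0 : ℝ)..V, (V - Z) / Real.sqrt (Z ^ 2 + (1 - S) * (1 + S)) := by
    refine intervalIntegral.integral_mono_on hV ?_ ?_ fun Z hZ => ?_
    · exact Continuous.intervalIntegrable (by fun_prop) _ _
    · exact Continuous.intervalIntegrable
        (Continuous.div (by fun_prop) (by fun_prop) fun Z => (hpos Z).ne') _ _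
    · refine div_le_div_of_nonneg_left (by linarith [hZ.2]) (hpos Z) (Real.sqrt_le_sqrt ?_)
      nlinarith [hZ.1, hZ.2, sq_nonneg S]
  have h2 : ∫ Z in (0 : ℝ)..V, (V - Z) / Real.sqrt (1 + V ^ 2) =
      (V ^ 2 / 2) / Real.sqrt (1 + V ^ 2) := by
    rw [intervalIntegral.integral_div, intervalIntegral.integral_sub (by simp) (by simp)]
    simp; ring
  have h3 : V ^ 2 / (4 * Real.sqrt (1 + V ^ 2)) = 1 / 2 * ((V ^ 2 / 2) / Real.sqrt (1 + V ^ 2)) := by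
    field_simp; norm_num
  rw [h3, ← h2]
  linarith

theorem kinetic_lower_bound {S : ℝ} (hS : S ^ 2 < 1) (V : ℝ) :
    V ^ 2 / (4 * Real.sqrt (1 + V ^ 2)) ≤ kinetic S V := by
  rcases le_total 0 V with hV | hV
  · exact kinetic_lower_bound_of_nonneg hS hV
  · have h := kinetic_lower_bound_of_nonneg hS (neg_nonneg.2 hV)
    rw [neg_sq] at h
    refine h.trans (le_of_eq ?_)
    rw [kinetic]
    congr 1
    have := intervalIntegral.integral_comp_neg (a := 0) (b := V)
      (fun Z => (-V - Z) / Real.sqrt (Z ^ 2 + (1 - S) * (1 + S)))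
    rw [neg_zero] at this
    rw [intervalIntegral.integral_symm, ← this, ← intervalIntegral.integral_neg]
    refine intervalIntegral.integral_congr fun Z _ => ?_
    simp only [neg_sq]
    rw [← neg_div]; congr 1; ring

theorem kinetic_nonneg {S : ℝ} (hS : S ^ 2 < 1) (V : ℝ) : 0 ≤ kinetic S V :=
  le_trans (by positivity) (kinetic_lower_bound hS V)

/-- The Modica–Mortola type inequality for the local energy density. -/
theorem mul_abs_le_density {β j S : ℝ} (hβ0 : 0 < β) (hj : 0 < j) (hβ : 1 < β * j)
    (hS : S ^ 2 ≤ equilibrium β j ^ 2) (V : ℝ) :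
    min (j / 8) (1 / (12 * β)) * ((equilibrium β j ^ 2 - S ^ 2) * |V|) ≤
      doubleWell β j S + 1 / (2 * β) * kinetic S V := by
  have hlt := equilibrium_lt_one hβ
  have hpos := equilibrium_pos hβ
  have hS1 : S ^ 2 < 1 := by nlinarith
  have hW := doubleWell_lower_bound hβ0 hj hβ hS
  have hK := kinetic_lower_bound hS1 V
  set a := equilibrium β j ^ 2 - S ^ 2 with ha
  have ha0 : 0 ≤ a := by linarith
  have ha1 : a ≤ 1 := by nlinarith [sq_nonneg S]
  set c := min (j / 8) (1 / (12 * β)) with hc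
  have hc0 : 0 < c := by positivity
  have hc1 : c ≤ j / 8 := min_le_left _ _
  have hc2 : c ≤ 1 / (12 * β) := min_le_right _ _
  have hsq := Real.sq_sqrt (show 0 ≤ 1 + V ^ 2 by positivity)
  have hsq0 : 0 < Real.sqrt (1 + V ^ 2) := Real.sqrt_pos.2 (by positivity)
  have hβ2 : 1 / (2 * β) * kinetic S V = 1 / (12 * β) * (6 * kinetic S V) := by
    field_simp; ring
  have hW' : c * a ^ 2 ≤ doubleWell β j S := le_trans (by gcongr) hW
  have hK' : c * (6 * kinetic S V) ≤ 1 / (2 * β) * kinetic S V := by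
    rw [hβ2]; have := kinetic_nonneg hS1 V; gcongr
  -- For |V| ≤ 1 the root is at most 3/2, so the kinetic term is at least V²/6 and Young's
  -- inequality applies. For |V| ≥ 1 it is at least |V|/6, and a ≤ 1 suffices.
  have key : a * |V| ≤ a ^ 2 + 6 * kinetic S V := by
    rcases le_total |V| 1 with hV | hV
    · have h1 : Real.sqrt (1 + V ^ 2) ≤ 3 / 2 := by
        refine Real.sqrt_le_iff.2 ⟨by norm_num, ?_⟩
        have : V ^ 2 ≤ 1 := by rw [← sq_abs]; nlinarith [abs_nonneg V]
        linarith
      have h2 : V ^ 2 / 6 ≤ V ^ 2 / (4 * Real.sqrt (1 + V ^ 2)) := by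
        gcongr; linarith
      nlinarith [sq_nonneg (a - |V|), sq_abs V, abs_nonneg V]
    · have h1 : Real.sqrt (1 + V ^ 2) ≤ 3 / 2 * |V| := by
        refine Real.sqrt_le_iff.2 ⟨by positivity, ?_⟩
        rw [mul_pow, sq_abs]
        have : 1 ≤ V ^ 2 := by rw [← sq_abs]; nlinarith
        linarith
      have h2 : |V| / 6 ≤ V ^ 2 / (4 * Real.sqrt (1 + V ^ 2)) := by
        rw [div_le_div_iff₀ (by norm_num) (by positivity)]
        have := mul_le_mul_of_nonneg_left h1 (abs_nonneg V)
        nlinarith [sq_abs V]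
      nlinarith [abs_nonneg V, sq_nonneg a]
  calc c * (a * |V|) ≤ c * (a ^ 2 + 6 * kinetic S V) := by gcongr
    _ = c * a ^ 2 + c * (6 * kinetic S V) := by ring
    _ ≤ _ := add_le_add hW' hK'

/-- The antiderivative of `r² - s²`. -/
def wellPrimitive (r s : ℝ) : ℝ := r ^ 2 * s - s ^ 3 / 3

theorem hasDerivAt_wellPrimitive (r s : ℝ) :
    HasDerivAt (wellPrimitive r) (r ^ 2 - s ^ 2) s := by
  have h := ((hasDerivAt_id s).const_mul (r ^ 2)).sub (((hasDerivAt_id s).pow 3).div_const 3)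
  refine h.congr_deriv ?_
  simp only [id, Nat.cast_ofNat]; ring

theorem continuous_wellPrimitive (r : ℝ) : Continuous (wellPrimitive r) := by
  unfold wellPrimitive; fun_prop

/-- The exact expansion at s has linear part (s - t)(r² - s²), treated by Young's inequality, and
quadratic part (s - t)²(2s + t)/3 with |2s + t| ≤ 3. Only the potential at s appears, so no
potential term has to be shifted when t is a translated value. -/
theorem abs_wellPrimitive_sub_le {r s t : ℝ} (hr : r ≤ 1) (hs : s ∈ Icc (-r) r)
    (ht : t ∈ Icc (-r) r) :
    |wellPrimitive r s - wellPrimitive r t| ≤ (r ^ 2 - s ^ 2) ^ 2 + 2 * (s - t) ^ 2 := by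
  obtain ⟨hs1, hs2⟩ := hs
  obtain ⟨ht1, ht2⟩ := ht
  have e : wellPrimitive r s - wellPrimitive r t =
      (s - t) * (r ^ 2 - s ^ 2) + (s - t) ^ 2 * ((2 * s + t) / 3) := by
    simp only [wellPrimitive]; ring
  rw [e]
  have h1 : |(s - t) * (r ^ 2 - s ^ 2)| ≤ (r ^ 2 - s ^ 2) ^ 2 + (s - t) ^ 2 := by
    rw [abs_le]; constructor <;>
      nlinarith [sq_nonneg ((s - t) + (r ^ 2 - s ^ 2)), sq_nonneg ((s - t) - (r ^ 2 - s ^ 2)),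
        sq_nonneg (s - t), sq_nonneg (r ^ 2 - s ^ 2)]
  have h2 : |(s - t) ^ 2 * ((2 * s + t) / 3)| ≤ (s - t) ^ 2 := by
    rw [abs_mul, abs_of_nonneg (sq_nonneg _)]
    refine mul_le_of_le_one_right (sq_nonneg _) ?_
    rw [abs_le]; constructor <;> linarith
  linarith [abs_add_le ((s - t) * (r ^ 2 - s ^ 2)) ((s - t) ^ 2 * ((2 * s + t) / 3))]

theorem abs_wellPrimitive_sub_le_abs_sub {r s t : ℝ} (hr : r ≤ 1) (hs : s ∈ Icc (-r) r)
    (ht : t ∈ Icc (-r) r) : |wellPrimitive r s - wellPrimitive r t| ≤ |s - t| := by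
  obtain ⟨hs1, hs2⟩ := hs
  obtain ⟨ht1, ht2⟩ := ht
  have e : wellPrimitive r s - wellPrimitive r t =
      (s - t) * (r ^ 2 - (s ^ 2 + s * t + t ^ 2) / 3) := by
    simp only [wellPrimitive]; ring
  rw [e, abs_mul]
  refine mul_le_of_le_one_right (abs_nonneg _) ?_
  rw [abs_le]; constructor <;>
    nlinarith [sq_nonneg (s + t), sq_nonneg (s - t), mul_nonneg (sub_nonneg.2 hs2) (sub_nonneg.2 ht2)]

/-- The slope r² - s² vanishes only at ±r, and only to first order there, so the increments of the
primitive are at least quadratic. -/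
theorem sq_le_wellPrimitive_sub {r s t : ℝ} (hs : s ∈ Icc (-r) r)
    (ht : t ∈ Icc (-r) r) : r * (s - t) ^ 2 ≤ 3 * |wellPrimitive r s - wellPrimitive r t| := by
  wlog hst : t ≤ s generalizing s t
  · rw [abs_sub_comm, show (s - t) ^ 2 = (t - s) ^ 2 by ring]
    exact this ht hs (le_of_not_ge hst)
  obtain ⟨hs1, hs2⟩ := hs
  obtain ⟨ht1, ht2⟩ := ht
  refine le_trans ?_ (mul_le_mul_of_nonneg_left (le_abs_self _) (by norm_num))
  have e : 3 * (wellPrimitive r s - wellPrimitive r t) =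
      (s - t) * (3 * r ^ 2 - (s ^ 2 + s * t + t ^ 2)) := by
    simp only [wellPrimitive]; ring
  rw [e, show r * (s - t) ^ 2 = (s - t) * (r * (s - t)) by ring]
  refine mul_le_mul_of_nonneg_left ?_ (sub_nonneg.2 hst)
  nlinarith [mul_nonneg (sub_nonneg.2 hs2) (sub_nonneg.2 ht1), mul_nonneg (sub_nonneg.2 hs2) (sub_nonneg.2 ht2), mul_nonneg (sub_nonneg.2 hs1) (sub_nonneg.2 ht1), mul_nonneg (sub_nonneg.2 hs1) (sub_nonneg.2 hs2), mul_nonneg (sub_nonneg.2 ht1) (sub_nonneg.2 ht2)]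

/-- Inverse estimate: the primitive controls its argument up to an arbitrarily small error. -/
theorem abs_sub_le_add_wellPrimitive {r s t ε : ℝ} (hr : 0 < r) (hε : 0 < ε)
    (hs : s ∈ Icc (-r) r) (ht : t ∈ Icc (-r) r) :
    |s - t| ≤ ε + 3 / (r * ε) * |wellPrimitive r s - wellPrimitive r t| := by
  have h := sq_le_wellPrimitive_sub hs ht
  have h1 : (s - t) ^ 2 / ε ≤ 3 / (r * ε) * |wellPrimitive r s - wellPrimitive r t| := by
    rw [div_mul_eq_mul_div, div_le_div_iff₀ hε (by positivity)]
    nlinarith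
  have h2 : |s - t| ≤ ε + (s - t) ^ 2 / ε := by
    rw [← sub_le_iff_le_add', le_div_iff₀ hε, ← sq_abs (s - t)]
    nlinarith [sq_nonneg (|s - t| - ε), abs_nonneg (s - t), sq_nonneg (|s - t| + ε)]
  linarith

/-! ### Measure theory on `ℝ × 𝕋ᵈ` -/

variable {d : ℕ}

instance isAddHaarMeasure_volume_spaceTime :
    Measure.IsAddHaarMeasure (volume : Measure (SpaceTime d)) := by
  have := @Measure.prod.instIsAddHaarMeasure ℝ _ _ _ (UnitAddTorus (Fin d)) _ _ _ volume volume
  apply this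

instance isNegInvariant_volume_torus :
    Measure.IsNegInvariant (volume : Measure (UnitAddTorus (Fin d))) := by
  have : Measure.IsAddHaarMeasure (volume : Measure (UnitAddTorus (Fin d))) := inferInstance
  exact Measure.IsAddHaarMeasure.isNegInvariant_of_regular
    (μ := (volume : Measure (UnitAddTorus (Fin d))))

instance regular_volume_spaceTime : Measure.Regular (volume : Measure (SpaceTime d)) :=
  Measure.Regular.of_sigmaCompactSpace_of_isLocallyFiniteMeasure _

instance isNegInvariant_volume_spaceTime :
    Measure.IsNegInvariant (volume : Measure (SpaceTime d)) :=
  Measure.IsAddHaarMeasure.isNegInvariant_of_regular (μ := (volume : Measure (SpaceTime d)))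

theorem continuous_toTorus : Continuous (toTorus (d := d)) :=
  continuous_pi fun i => (AddCircle.continuous_mk' 1).comp (by fun_prop)

theorem toTorus_add (x y : EuclideanSpace ℝ (Fin d)) :
    toTorus (x + y) = toTorus x + toTorus y := by
  ext i; simp [toTorus]

theorem toTorus_zero : toTorus (0 : EuclideanSpace ℝ (Fin d)) = 0 := by
  ext i; simp [toTorus]

theorem measurePreserving_torusMk (t : ℝ) :
    MeasurePreserving (fun (x : Fin d → ℝ) (i : Fin d) => (x i : UnitAddCircle))
      (volume.restrict (univ.pi fun _ => Ioc t (t + 1))) volume := by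
  have h := measurePreserving_pi (fun _ : Fin d => volume.restrict (Ioc t (t + 1)))
    (fun _ : Fin d => (volume : Measure UnitAddCircle))
    (fun _ => UnitAddCircle.measurePreserving_mk t)
  rwa [← Measure.restrict_pi_pi] at h

/-- A fundamental domain of the torus in `ℝᵈ`. -/
def centeredCube (d : ℕ) : Set (EuclideanSpace ℝ (Fin d)) :=
  {x | ∀ i, x i ∈ Ioc (-(1 / 2) : ℝ) (1 / 2)}

theorem lintegral_torus {F : UnitAddTorus (Fin d) → ℝ≥0∞} (hF : Measurable F) :
    ∫⁻ z, F z = ∫⁻ x in centeredCube d, F (toTorus x) := by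
  have h1 := (measurePreserving_torusMk (d := d) (-(1 / 2))).lintegral_comp hF
  have hm : MeasurableSet (univ.pi fun _ : Fin d => Ioc (-(1 / 2) : ℝ) (-(1 / 2) + 1)) :=
    MeasurableSet.univ_pi fun _ => measurableSet_Ioc
  have h2 := ((PiLp.volume_preserving_ofLp (Fin d)).restrict_preimage hm).lintegral_comp
    (f := fun x => F (fun i => (x i : UnitAddCircle)))
    (hF.comp (measurable_pi_lambda _ fun i => AddCircle.measurable_mk'.comp (measurable_pi_apply i)))
  rw [← h1, ← h2]
  have : (fun x : EuclideanSpace ℝ (Fin d) => x.ofLp) ⁻¹'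
      (univ.pi fun _ : Fin d => Ioc (-(1 / 2) : ℝ) (-(1 / 2) + 1)) = centeredCube d := by
    ext x; simp only [centeredCube, mem_preimage, mem_univ_pi, mem_ofPred_eq]; norm_num
  rw [this]
  rfl

theorem lintegral_slices {Ω : Set (SpaceTime d)} (hΩ : MeasurableSet Ω)
    {F : SpaceTime d → ℝ≥0∞} (hF : AEMeasurable F (volume.restrict Ω)) :
    ∫⁻ τ, ∫⁻ z in {z | (τ, z) ∈ Ω}, F (τ, z) = ∫⁻ p in Ω, F p := by
  rw [← lintegral_indicator hΩ, Measure.volume_eq_prod,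
    lintegral_prod _ ((aemeasurable_indicator_iff hΩ).2 hF)]
  refine lintegral_congr fun τ => ?_
  have hm : MeasurableSet {z | (τ, z) ∈ Ω} := measurable_prodMk_left hΩ
  rw [← lintegral_indicator hm]
  rfl

theorem cover_surjective : Function.Surjective (cover (d := d)) := by
  rintro ⟨τ, z⟩
  choose x hx using fun i => QuotientAddGroup.mk_surjective (z i)
  refine ⟨WithLp.toLp 2 (Fin.cons τ x), ?_⟩
  ext
  · rfl
  · exact hx _

theorem continuous_cover : Continuous (cover (d := d)) :=
  (by fun_prop : Continuous fun y : EuclideanSpace ℝ (Fin (d + 1)) => y 0).prodMk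
    (continuous_pi fun i => (AddCircle.continuous_mk' 1).comp (by fun_prop))

theorem cover_add (x y : EuclideanSpace ℝ (Fin (d + 1))) : cover (x + y) = cover x + cover y := by
  ext <;> simp [cover]

/-- The splitting of `ℝᵈ⁺¹` into time and space preserves the volume. -/
theorem measurePreserving_split :
    MeasurePreserving (fun y : EuclideanSpace ℝ (Fin (d + 1)) => (y 0, fun i : Fin d => y i.succ))
      volume volume :=
  (volume_preserving_piFinSuccAbove (fun _ : Fin (d + 1) => ℝ) 0).comp
    (PiLp.volume_preserving_ofLp (Fin (d + 1)))

/-- The volume can be computed in the covering space over one unit cell, where the set lies in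
finitely many hyperplanes, each of measure zero. -/
theorem volume_eq_zero_of_subset_hyperplanes {S : Set (SpaceTime d)} (hS : MeasurableSet S)
    (H : Finset (EuclideanSpace ℝ (Fin (d + 1)) × ℝ)) (hH : ∀ h ∈ H, h.1 ≠ 0)
    (hsub : ∀ y : EuclideanSpace ℝ (Fin (d + 1)), cover y ∈ S →
      (∀ i : Fin d, y i.succ ∈ Icc (0 : ℝ) 1) → ∃ h ∈ H, inner ℝ h.1 y = h.2) :
    volume S = 0 := by
  have hprod : MeasurePreserving
      (Prod.map id (fun (x : Fin d → ℝ) (i : Fin d) => (x i : UnitAddCircle)))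
      ((volume : Measure ℝ).prod (volume.restrict (univ.pi fun _ : Fin d => Ioc (0 : ℝ) (0 + 1))))
      (volume.prod volume) :=
    (MeasurePreserving.id volume).prod (measurePreserving_torusMk 0)
  have hcube : MeasurableSet (univ.pi fun _ : Fin d => Ioc (0 : ℝ) (0 + 1)) :=
    MeasurableSet.univ_pi fun _ => measurableSet_Ioc
  rw [Measure.volume_eq_prod, ← hprod.measure_preimage hS.nullMeasurableSet]
  have hr : (volume : Measure ℝ).prod
      (volume.restrict (univ.pi fun _ : Fin d => Ioc (0 : ℝ) (0 + 1))) =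
      (volume : Measure (ℝ × (Fin d → ℝ))).restrict
        (univ ×ˢ (univ.pi fun _ : Fin d => Ioc (0 : ℝ) (0 + 1))) := by
    rw [Measure.volume_eq_prod, ← Measure.prod_restrict, Measure.restrict_univ]
  rw [hr, Measure.restrict_apply (hprod.measurable hS),
    ← measurePreserving_split.measure_preimage
      ((hprod.measurable hS).inter (MeasurableSet.univ.prod hcube)).nullMeasurableSet]
  refine measure_mono_null (t := ⋃ h ∈ H, {y | inner ℝ h.1 y = h.2}) ?_ ?_
  · rintro y ⟨hy1, hy2⟩
    obtain ⟨h, hh, he⟩ := hsub y hy1 fun i => by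
      have := hy2.2 i (mem_univ i)
      simp only [zero_add] at this
      exact ⟨this.1.le, this.2⟩
    exact mem_biUnion hh he
  · refine (measure_biUnion_null_iff (Finset.countable_toSet H)).2 fun h hh => ?_
    let P : AffineSubspace ℝ (EuclideanSpace ℝ (Fin (d + 1))) :=
      { carrier := {y | inner ℝ h.1 y = h.2}
        smul_vsub_vadd_mem' := by
          intro c p1 p2 p3 h1 h2 h3
          simp only [mem_ofPred_eq] at *
          simp [inner_add_right, inner_smul_right, inner_sub_right, h1, h2, h3] }
    -- If the hyperplane were the whole space, its equation at 0 and at the normal vector would make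
    -- the normal vanish.
    refine Measure.addHaar_affineSubspace volume P fun htop => hH h hh ?_
    have hmem : ∀ y, inner ℝ h.1 y = h.2 := fun y => by
      have : y ∈ P := htop ▸ AffineSubspace.mem_top ℝ _ y
      exact this
    have h0 := hmem 0
    have h1 := hmem h.1
    rw [inner_zero_right] at h0
    rw [← h0] at h1
    exact inner_self_eq_zero.1 h1

theorem IsPolyhedralIn.measurableSet {D Ω : Set (SpaceTime d)} (h : IsPolyhedralIn D Ω)
    (hD : IsOpen D) : MeasurableSet Ω := by
  obtain ⟨E, hE, rfl⟩ := h
  refine MeasurableSet.inter ?_ hD.measurableSet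
  exact hE.isOpen_or_isClosed.elim IsOpen.measurableSet IsClosed.measurableSet

theorem IsPolyhedralIn.volume_diff_interior {D Ω : Set (SpaceTime d)} (h : IsPolyhedralIn D Ω)
    (hD : IsOpen D) : volume (Ω \ interior Ω) = 0 := by
  obtain ⟨E, hE, rfl⟩ := h
  obtain ⟨H, hH, hsub⟩ := hE.hyperplanes
  refine measure_mono_null ?_
    (volume_eq_zero_of_subset_hyperplanes isClosed_frontier.measurableSet H hH hsub)
  rw [interior_inter, hD.interior_eq]
  rintro p ⟨⟨hp1, hp2⟩, hp3⟩
  exact ⟨subset_closure hp1, fun h => hp3 ⟨h, hp2⟩⟩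

/-- The support is the union of the superlevel sets {J ≥ 1/(n+1)}, so one of these has positive
measure; inner regularity provides a compact subset. -/
theorem exists_isCompact_forall_le {E : Type*} [NormedAddCommGroup E] [InnerProductSpace ℝ E]
    [FiniteDimensional ℝ E] [MeasurableSpace E] [BorelSpace E] {J : E → ℝ}
    (hJ0 : ∀ x, 0 ≤ J x) (hJi : Integrable J) (hJ : 0 < ∫ x, J x) :
    ∃ (A : Set E) (j : ℝ), IsCompact A ∧ 0 < j ∧ volume A ≠ 0 ∧ ∀ x ∈ A, j ≤ J x := by
  have hpos := (integral_pos_iff_support_of_nonneg hJ0 hJi).1 hJ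
  have hU : Function.support J = ⋃ n : ℕ, {x | 1 / ((n : ℝ) + 1) ≤ J x} := by
    ext x
    simp only [Function.mem_support, mem_iUnion, mem_ofPred_eq]
    constructor
    · intro hx
      obtain ⟨n, hn⟩ := exists_nat_one_div_lt ((hJ0 x).lt_of_ne' hx)
      exact ⟨n, hn.le⟩
    · rintro ⟨n, hn⟩ h0
      rw [h0] at hn
      exact absurd hn (not_le.2 (by positivity))
  obtain ⟨n, hn⟩ : ∃ n : ℕ, volume {x | 1 / ((n : ℝ) + 1) ≤ J x} ≠ 0 := by
    by_contra! hcon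
    rw [hU, measure_iUnion_null hcon] at hpos
    exact lt_irrefl _ hpos
  have hnull : NullMeasurableSet {x | 1 / ((n : ℝ) + 1) ≤ J x} :=
    nullMeasurableSet_le aemeasurable_const hJi.aestronglyMeasurable.aemeasurable
  obtain ⟨B, hBsub, hBm, hBe⟩ := hnull.exists_measurable_subset_ae_eq
  have hB : 0 < volume B := by
    rw [measure_congr hBe]; exact pos_iff_ne_zero.2 hn
  obtain ⟨K, hKB, hK, hKpos⟩ := hBm.exists_lt_isCompact hB
  exact ⟨K, 1 / ((n : ℝ) + 1), hK, by positivity, hKpos.ne', fun x hx => hBsub (hKB hx)⟩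

/-- A quantitative form of the Steinhaus theorem. -/
theorem exists_le_volume_inter_translate {E : Type*} [NormedAddCommGroup E] [InnerProductSpace ℝ E]
    [FiniteDimensional ℝ E] [MeasurableSpace E] [BorelSpace E] {A : Set E} (hA : IsCompact A)
    (hA0 : volume A ≠ 0) :
    ∃ r : ℝ, 0 < r ∧ ∀ y : E, ‖y‖ ≤ r →
      volume A / 2 ≤ volume (A ∩ (fun x => x - y) ⁻¹' A) := by
  have hfin : volume A ≠ ∞ := hA.measure_lt_top.ne
  -- An open V around A has volume below 3/2 that of A and contains every small translate B of A.
  -- Hence A ∪ B has at most 3/2 the volume of A, which leaves at least half of it for A ∩ B.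
  obtain ⟨V, hAV, hV, hlt⟩ := A.exists_isOpen_lt_add hfin (ε := volume A / 2)
    (by simpa using hA0)
  obtain ⟨δ, hδ, hsub⟩ := hA.exists_thickening_subset_open hV hAV
  refine ⟨δ / 2, by positivity, fun y hy => ?_⟩
  set B := (fun x => x - y) ⁻¹' A with hB
  have hBV : B ⊆ V := fun x hx => hsub <| Metric.mem_thickening_iff.2
    ⟨x - y, hx, by rw [dist_eq_norm]; simpa using hy.trans_lt (by linarith)⟩
  have hBm : MeasurableSet B := (measurable_id.sub_const y) hA.measurableSet
  have hBvol : volume B = volume A := by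
    simp only [hB, sub_eq_add_neg]; exact measure_preimage_add_right _ _ _
  have h1 := measure_union_add_inter (μ := volume) A hBm
  have h2 : volume (A ∪ B) ≤ volume A + volume A / 2 :=
    (measure_mono (union_subset hAV hBV)).trans hlt.le
  rw [hBvol] at h1
  have h3 : volume A + volume A / 2 + volume A / 2 ≤
      volume A + volume A / 2 + volume (A ∩ B) := by
    rw [add_assoc, ENNReal.add_halves, ← h1]; gcongr
  exact (ENNReal.add_le_add_iff_left
    (ENNReal.add_ne_top.2 ⟨hfin, (ENNReal.div_lt_top hfin (by norm_num)).ne⟩)).1 h3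

theorem setLIntegral_comp_smul {A : Set (EuclideanSpace ℝ (Fin d))} (hA : MeasurableSet A)
    {lam : ℝ} (hlam : 0 < lam) {g : EuclideanSpace ℝ (Fin d) → ℝ≥0∞} (hg : Measurable g) :
    ∫⁻ y in A, g (lam • y) =
      ENNReal.ofReal (lam ^ d)⁻¹ * ∫⁻ x in (fun x => lam⁻¹ • x) ⁻¹' A, g x := by
  have hm : MeasurableSet ((fun x : EuclideanSpace ℝ (Fin d) => lam⁻¹ • x) ⁻¹' A) :=
    (measurable_const_smul lam⁻¹) hA
  have h := lintegral_map (μ := (volume : Measure (EuclideanSpace ℝ (Fin d))))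
    (hg.indicator hm) (measurable_const_smul lam)
  rw [Measure.map_addHaar_smul _ hlam.ne', lintegral_smul_measure, lintegral_indicator hm] at h
  rw [← lintegral_indicator hA]
  simp only [finrank_euclideanSpace, Fintype.card_fin] at h
  rw [abs_of_pos (by positivity)] at h
  rw [← smul_eq_mul, h]
  refine lintegral_congr fun y => ?_
  by_cases hy : y ∈ A <;> simp [indicator, hy, inv_smul_smul₀ hlam.ne']

/-- Lower bound of the interaction with the periodized kernel by an integral over translations. -/
theorem lintegral_torusKernel_ge {J : EuclideanSpace ℝ (Fin d) → ℝ}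
    {A : Set (EuclideanSpace ℝ (Fin d))} {j lam : ℝ} (hA : IsCompact A)
    (hJ : ∀ x ∈ A, j ≤ J x) (hlam : 0 < lam) (hcube : ∀ y ∈ A, lam • y ∈ centeredCube d)
    {B : Set (UnitAddTorus (Fin d))} (hB : MeasurableSet B) {F : UnitAddTorus (Fin d) → ℝ≥0∞}
    (hF : Measurable F) (z : UnitAddTorus (Fin d)) :
    ENNReal.ofReal j * ∫⁻ y in A, B.indicator F (z - toTorus (lam • y)) ≤
      ∫⁻ w in B, torusKernel J lam (z - w) * F w := by
  set G := B.indicator F with hG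
  have hGm : Measurable G := hF.indicator hB
  set c := ENNReal.ofReal ((lam ^ d)⁻¹ * j) with hc
  have hsubl : ∫⁻ w in B, torusKernel J lam (z - w) * F w = ∫⁻ x, torusKernel J lam x * G (z - x) := by
    rw [← lintegral_indicator hB, ← lintegral_sub_left_eq_self _ z]
    refine lintegral_congr fun x => ?_
    by_cases hx : z - x ∈ B <;> simp [hG, indicator, hx]
  set A' : Set (EuclideanSpace ℝ (Fin d)) := (fun x => lam⁻¹ • x) ⁻¹' A with hA'
  have hA'img : A' = (fun y => lam • y) '' A := by
    ext x
    constructor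
    · intro hx; exact ⟨_, hx, smul_inv_smul₀ hlam.ne' x⟩
    · rintro ⟨y, hy, rfl⟩
      simpa [hA', inv_smul_smul₀ hlam.ne'] using hy
  have hA'c : IsCompact A' := hA'img ▸ hA.image (continuous_const_smul lam)
  have hA'cube : A' ⊆ centeredCube d := by
    rw [hA'img]; rintro _ ⟨y, hy, rfl⟩; exact hcube y hy
  set P := toTorus '' A' with hP
  have hPm : MeasurableSet P := (hA'c.image continuous_toTorus).measurableSet
  -- One representative, the one in the scaled set, already gives the bound; the other terms of the
  -- periodization are nonnegative.
  have hker : ∀ x ∈ P, c ≤ torusKernel J lam x := by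
    rintro _ ⟨y, hy, rfl⟩
    refine le_trans ?_ (ENNReal.le_tsum (⟨y, rfl⟩ : {y' // toTorus y' = toTorus y}))
    refine ENNReal.ofReal_le_ofReal ?_
    simp only [scaledKernel]
    exact mul_le_mul_of_nonneg_left (hJ _ hy) (by positivity)
  have hGz : Measurable fun x => G (z - x) := hGm.comp (measurable_const.sub measurable_id)
  calc ENNReal.ofReal j * ∫⁻ y in A, G (z - toTorus (lam • y))
      = c * ∫⁻ x in A', G (z - toTorus x) := by
        rw [setLIntegral_comp_smul hA.measurableSet hlam
          (g := fun x => G (z - toTorus x)) (hGz.comp continuous_toTorus.measurable), ← mul_assoc,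
          hc, mul_comm (lam ^ d)⁻¹ j, ENNReal.ofReal_mul' (by positivity)]
    -- The scaled set lies in one fundamental domain, so projecting it to the torus counts no point
    -- twice.
    _ ≤ ∫⁻ x in centeredCube d, P.indicator (fun x => c * G (z - x)) (toTorus x) := by
        have hGt : Measurable fun x => G (z - toTorus x) := hGz.comp continuous_toTorus.measurable
        rw [← lintegral_const_mul _ hGt]
        refine le_trans (setLIntegral_mono' hA'c.measurableSet fun x hx => ?_)
          (lintegral_mono_set hA'cube)
        rw [indicator_of_mem (mem_image_of_mem _ hx)]
    _ = ∫⁻ x, P.indicator (fun x => c * G (z - x)) x :=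
        (lintegral_torus ((hGz.const_mul c).indicator hPm)).symm
    _ ≤ ∫⁻ x, torusKernel J lam x * G (z - x) := by
        refine lintegral_mono fun x => ?_
        by_cases hx : x ∈ P
        · rw [indicator_of_mem hx]; gcongr; exact hker x hx
        · rw [indicator_of_notMem hx]; exact zero_le
    _ = _ := hsubl.symm

/-! ### Consequences of an energy bound -/

/-- The truncation of `s` to `[-r, r]`. -/
def clamp (r s : ℝ) : ℝ := max (-r) (min r s)

theorem clamp_mem {r : ℝ} (hr : 0 ≤ r) (s : ℝ) : clamp r s ∈ Icc (-r) r :=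
  ⟨le_max_left _ _, max_le (by linarith) (min_le_left _ _)⟩

theorem clamp_of_mem {r s : ℝ} (hs : s ∈ Icc (-r) r) : clamp r s = s := by
  rw [clamp, min_eq_right hs.2, max_eq_right hs.1]

theorem continuous_clamp (r : ℝ) : Continuous (clamp r) := by
  unfold clamp; fun_prop

theorem sq_le_of_mem_Icc {r s : ℝ} (hs : s ∈ Icc (-r) r) : s ^ 2 ≤ r ^ 2 :=
  sq_le_sq' hs.1 hs.2

theorem ae_slices {Ω : Set (SpaceTime d)} (hΩ : MeasurableSet Ω) {P : SpaceTime d → Prop}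
    (h : ∀ᵐ p ∂(volume.restrict Ω), P p) :
    ∀ᵐ τ : ℝ, ∀ᵐ z ∂(volume.restrict {z | (τ, z) ∈ Ω}), P (τ, z) := by
  rw [ae_restrict_iff' hΩ, Measure.volume_eq_prod] at h
  filter_upwards [Measure.ae_ae_of_ae_prod h] with τ hτ
  have hm : MeasurableSet {z | (τ, z) ∈ Ω} := measurable_prodMk_left hΩ
  rw [ae_restrict_iff' hm]
  exact hτ

/-- The energy is an iterated integral whose density is not assumed jointly measurable. Tonelli is
applied only to the measurable minorant `F`. -/
theorem setLIntegral_le_slices {Ω : Set (SpaceTime d)} (hΩ : MeasurableSet Ω)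
    {F : SpaceTime d → ℝ≥0∞} (hF : AEMeasurable F (volume.restrict Ω))
    {g : ℝ → UnitAddTorus (Fin d) → ℝ≥0∞}
    (h : ∀ᵐ τ : ℝ, ∀ᵐ z ∂(volume.restrict {z | (τ, z) ∈ Ω}), F (τ, z) ≤ g τ z) :
    ∫⁻ p in Ω, F p ≤ ∫⁻ τ, ∫⁻ z in {z | (τ, z) ∈ Ω}, g τ z := by
  rw [← lintegral_slices hΩ hF]
  refine lintegral_mono_ae ?_
  filter_upwards [h] with τ hτ
  exact lintegral_mono_ae hτ

/-- The translation of the torus component by `toTorus x`. -/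
def spaceShift (x : EuclideanSpace ℝ (Fin d)) : SpaceTime d := (0, toTorus x)

theorem continuous_spaceShift : Continuous (spaceShift (d := d)) :=
  continuous_const.prodMk continuous_toTorus

/-- The prefactor 1/λ makes the potential and the nonlocal term of order λ. In the first estimate
the velocity enters as λv, which absorbs this factor and leaves a bound of order one. The constant
does not depend on Ω, λ or s. -/
theorem exists_energy_bounds {J : EuclideanSpace ℝ (Fin d) → ℝ} {β : ℝ}
    (hJpos : 0 < ∫ x, J x) (hβ : 1 < β * ∫ x, J x)
    {A : Set (EuclideanSpace ℝ (Fin d))} {j : ℝ} (hA : IsCompact A) (hj : 0 < j)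
    (hJA : ∀ x ∈ A, j ≤ J x) (M : ℝ≥0) :
    ∃ C : ℝ≥0∞, C ≠ ∞ ∧ ∀ (Ω : Set (SpaceTime d)), MeasurableSet Ω →
      volume (Ω \ interior Ω) = 0 → ∀ lam : ℝ, 0 < lam →
      (∀ y ∈ A, lam • y ∈ centeredCube d) → ∀ s : SpaceTime d → ℝ, Measurable s →
      (∀ᵐ p ∂(volume.restrict Ω),
        s p ∈ Icc (-equilibrium β (∫ x, J x)) (equilibrium β (∫ x, J x))) →
      energy J β lam s Ω ≤ M →
      ∃ v : SpaceTime d → ℝ,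
        IsWeakTimeDeriv (interior Ω) (fun p => clamp (equilibrium β (∫ x, J x)) (s p)) v ∧
        ∫⁻ p in Ω, ENNReal.ofReal ((equilibrium β (∫ x, J x) ^ 2 -
          clamp (equilibrium β (∫ x, J x)) (s p) ^ 2) * |v p|) ≤ C ∧
        ∫⁻ p in Ω, ENNReal.ofReal ((equilibrium β (∫ x, J x) ^ 2 -
          clamp (equilibrium β (∫ x, J x)) (s p) ^ 2) ^ 2) ≤ C * ENNReal.ofReal lam ∧
        ∫⁻ y in A, ∫⁻ p in Ω, Ω.indicator (fun q =>
          ‖wellPrimitive (equilibrium β (∫ x, J x)) (clamp (equilibrium β (∫ x, J x)) (s p)) -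
            wellPrimitive (equilibrium β (∫ x, J x)) (clamp (equilibrium β (∫ x, J x)) (s q))‖ₑ)
          (p - spaceShift (lam • y)) ≤ C * ENNReal.ofReal lam := by
  set jh := ∫ x, J x with hjh
  set r := equilibrium β jh with hr
  have hβ0 : 0 < β := pos_of_mul_pos_left (by linarith) hJpos.le
  have hr0 : 0 < r := equilibrium_pos hβ
  have hr1 : r < 1 := equilibrium_lt_one hβ
  set c := min (jh / 8) (1 / (12 * β)) with hc
  have hc0 : 0 < c := by positivity
  set C1 : ℝ≥0∞ := (M + 1) / ENNReal.ofReal c with hC1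
  set C2 : ℝ≥0∞ := (M + 1) / ENNReal.ofReal (jh / 8) with hC2
  set C3 : ℝ≥0∞ := (M + 1) / ENNReal.ofReal (1 / 4 * j) with hC3
  have hM : (M + 1 : ℝ≥0∞) ≠ ∞ := by simp
  have hC1f : C1 ≠ ∞ := (ENNReal.div_lt_top hM (by simpa using hc0)).ne
  have hC2f : C2 ≠ ∞ := (ENNReal.div_lt_top hM (by simpa using hJpos)).ne
  have hC3f : C3 ≠ ∞ := (ENNReal.div_lt_top hM (by simpa using hj)).ne
  have hAf : volume A ≠ ∞ := hA.measure_lt_top.ne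
  refine ⟨C1 + C2 + (volume A * C2 + 2 * C3), by finiteness, ?_⟩
  intro Ω hΩ hnull lam hlam hcube s hs hrange henergy
  -- Passing from M to M + 1 makes the inequality strict, so the infimum over weak derivatives
  -- provides an actual v.
  have hlt : energy J β lam s Ω < M + 1 :=
    henergy.trans_lt (ENNReal.lt_add_right (by simp) (by simp))
  simp only [energy, iInf_lt_iff] at hlt
  obtain ⟨v, hv, hlt⟩ := hlt
  -- The range condition on s holds only almost everywhere in Ω. The truncation satisfies it
  -- everywhere and has the same weak derivative, since weak derivatives ignore null sets.
  set σ : SpaceTime d → ℝ := fun p => clamp r (s p) with hσ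
  have hσm : Measurable σ := (continuous_clamp r).measurable.comp hs
  have hσr : ∀ p, σ p ∈ Icc (-r) r := fun p => clamp_mem hr0.le _
  have hσs : ∀ᵐ p ∂(volume.restrict Ω), σ p = s p := by
    filter_upwards [hrange] with p hp using clamp_of_mem hp
  have hrestr : volume.restrict (interior Ω) = volume.restrict Ω :=
    Measure.restrict_congr_set (by
      rw [ae_eq_set]; exact ⟨by simp [sdiff_eq_empty.2 interior_subset], hnull⟩)
  have hvm : AEStronglyMeasurable v (volume.restrict Ω) :=
    hrestr ▸ hv.locallyIntegrableOn_deriv.aestronglyMeasurable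
  have hσs' : ∀ᵐ p ∂(volume.restrict (interior Ω)), σ p = s p := hrestr ▸ hσs
  have hσv : IsWeakTimeDeriv (interior Ω) σ v := by
    refine ⟨?_, hv.2, fun φ hφ => ?_⟩
    · refine LocallyIntegrable.locallyIntegrableOn ?_ _
      refine (locallyIntegrable_const r).mono hσm.aestronglyMeasurable (ae_of_all _ fun p => ?_)
      rw [Real.norm_eq_abs, Real.norm_eq_abs, abs_of_pos hr0]
      exact abs_le.2 (hσr p)
    · rw [← hv.3 φ hφ]
      refine integral_congr_ae ?_
      filter_upwards [hσs'] with p hp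
      rw [hp]
  -- the local and the nonlocal part of the energy density
  set e : SpaceTime d → ℝ := fun p => doubleWell β jh (s p) + 1 / (2 * β) * kinetic (s p) (lam * v p)
    with he
  set I : SpaceTime d → ℝ≥0∞ := fun p => ∫⁻ w in {w | (p.1, w) ∈ Ω},
    torusKernel J lam (p.2 - w) * ENNReal.ofReal ((s p - s (p.1, w)) ^ 2) with hI
  have hE : ENNReal.ofReal lam⁻¹ * ∫⁻ τ, ∫⁻ z in {z | (τ, z) ∈ Ω},
      (ENNReal.ofReal (e (τ, z)) + ENNReal.ofReal (1 / 4) * I (τ, z)) ≤ M + 1 := by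
    rw [← lintegral_const_mul' _ _ ENNReal.ofReal_ne_top]
    exact hlt.le
  have hbound : ∀ F : SpaceTime d → ℝ≥0∞, AEMeasurable F (volume.restrict Ω) →
      (∀ᵐ τ : ℝ, ∀ᵐ z ∂(volume.restrict {z | (τ, z) ∈ Ω}),
        F (τ, z) ≤ ENNReal.ofReal (e (τ, z)) + ENNReal.ofReal (1 / 4) * I (τ, z)) →
      ENNReal.ofReal lam⁻¹ * ∫⁻ p in Ω, F p ≤ M + 1 := fun F hF h =>
    le_trans (by gcongr; exact setLIntegral_le_slices hΩ hF h) hE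
  have hlam1 : ENNReal.ofReal lam⁻¹ * ENNReal.ofReal lam = 1 := by
    rw [← ENNReal.ofReal_mul (by positivity), inv_mul_cancel₀ hlam.ne', ENNReal.ofReal_one]
  have hlam2 : ∀ {k X : ℝ≥0∞}, k ≠ 0 → k ≠ ∞ → ENNReal.ofReal lam⁻¹ * (k * X) ≤ M + 1 →
      X ≤ (M + 1) / k * ENNReal.ofReal lam := by
    intro k X hk hk' h
    have h1 : X = k⁻¹ * ENNReal.ofReal lam * (ENNReal.ofReal lam⁻¹ * (k * X)) := by
      calc X = (k⁻¹ * k) * (ENNReal.ofReal lam⁻¹ * ENNReal.ofReal lam) * X := by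
            rw [ENNReal.inv_mul_cancel hk hk', hlam1, one_mul, one_mul]
        _ = _ := by ring
    rw [h1, div_eq_mul_inv]
    calc k⁻¹ * ENNReal.ofReal lam * (ENNReal.ofReal lam⁻¹ * (k * X))
        ≤ k⁻¹ * ENNReal.ofReal lam * (M + 1) := by gcongr
      _ = _ := by ring
  have hE2 : ∫⁻ p in Ω, ENNReal.ofReal ((r ^ 2 - σ p ^ 2) ^ 2) ≤ C2 * ENNReal.ofReal lam := by
    refine hlam2 (by simpa using hJpos) ENNReal.ofReal_ne_top ?_
    rw [← lintegral_const_mul' _ _ ENNReal.ofReal_ne_top]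
    refine hbound _ (by fun_prop) ?_
    filter_upwards [ae_slices hΩ hσs] with τ hτ
    filter_upwards [hτ] with z hz
    refine le_trans ?_ le_self_add
    rw [← ENNReal.ofReal_mul (by positivity)]
    refine ENNReal.ofReal_le_ofReal ?_
    have hz2 := sq_le_of_mem_Icc (hσr (τ, z))
    have h1 := doubleWell_lower_bound hβ0 hJpos hβ hz2
    have h2 := kinetic_nonneg (S := σ (τ, z)) (by nlinarith) (lam * v (τ, z))
    rw [he]; simp only
    rw [← hz]
    have h3 : 0 ≤ 1 / (2 * β) * kinetic (σ (τ, z)) (lam * v (τ, z)) := by positivity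
    linarith
  refine ⟨v, hσv, ?_, ?_, ?_⟩
  · have h1 : ∫⁻ p in Ω, ENNReal.ofReal ((r ^ 2 - σ p ^ 2) * |v p|) ≤ C1 := by
      have h2 : ∫⁻ p in Ω, ENNReal.ofReal lam * ENNReal.ofReal ((r ^ 2 - σ p ^ 2) * |v p|) ≤
          C1 * ENNReal.ofReal lam := by
        refine hlam2 (by simpa using hc0) ENNReal.ofReal_ne_top ?_
        rw [← lintegral_const_mul' _ _ ENNReal.ofReal_ne_top]
        refine hbound _ ?_ ?_
        · have := hvm.aemeasurable
          fun_prop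
        filter_upwards [ae_slices hΩ hσs] with τ hτ
        filter_upwards [hτ] with z hz
        refine le_trans ?_ le_self_add
        rw [← ENNReal.ofReal_mul hlam.le, ← ENNReal.ofReal_mul hc0.le]
        refine ENNReal.ofReal_le_ofReal ?_
        have h1 := mul_abs_le_density hβ0 hJpos hβ (sq_le_of_mem_Icc (hσr (τ, z))) (lam * v (τ, z))
        rw [he]; simp only
        rw [← hz]
        refine le_trans (le_of_eq ?_) h1
        rw [abs_mul, abs_of_pos hlam]; ring
      rw [lintegral_const_mul' _ _ ENNReal.ofReal_ne_top, mul_comm] at h2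
      exact (ENNReal.mul_le_mul_iff_left (by simpa using hlam) ENNReal.ofReal_ne_top).1 h2
    exact h1.trans (by rw [add_assoc]; exact le_self_add)
  · refine hE2.trans ?_
    gcongr
    rw [add_assoc, add_left_comm]; exact le_self_add
  · set D : SpaceTime d → EuclideanSpace ℝ (Fin d) → ℝ≥0∞ := fun p y =>
      Ω.indicator (fun q => ENNReal.ofReal ((σ p - σ q) ^ 2)) (p - spaceShift (lam • y)) with hD
    have hshift : Measurable fun x : SpaceTime d × EuclideanSpace ℝ (Fin d) =>
        x.1 - spaceShift (lam • x.2) := by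
      have : Continuous fun x : SpaceTime d × EuclideanSpace ℝ (Fin d) =>
          x.1 - spaceShift (lam • x.2) :=
        continuous_fst.sub (continuous_spaceShift.comp (continuous_snd.const_smul lam))
      exact this.measurable
    have hDm : Measurable (Function.uncurry D) := by
      have : Function.uncurry D = ((fun x : SpaceTime d × EuclideanSpace ℝ (Fin d) =>
          x.1 - spaceShift (lam • x.2)) ⁻¹' Ω).indicator (fun x =>
            ENNReal.ofReal ((σ x.1 - σ (x.1 - spaceShift (lam • x.2))) ^ 2)) := by
        ext ⟨p, y⟩; rfl
      rw [this]
      refine Measurable.indicator ?_ (hshift hΩ)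
      have h1 := hσm.comp hshift
      have h2 : Measurable fun x : SpaceTime d × EuclideanSpace ℝ (Fin d) => σ x.1 :=
        hσm.comp measurable_fst
      exact ((h2.sub h1).pow_const 2).ennreal_ofReal
    have hE3 : ∫⁻ p in Ω, ∫⁻ y in A, D p y ≤ C3 * ENNReal.ofReal lam := by
      refine hlam2 (by simpa using hj) ENNReal.ofReal_ne_top ?_
      rw [← lintegral_const_mul' _ _ ENNReal.ofReal_ne_top]
      refine hbound _ ((hDm.lintegral_prod_right').const_mul _).aemeasurable ?_
      filter_upwards [ae_slices hΩ hσs] with τ hτ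
      filter_upwards [hτ] with z hz
      refine le_trans ?_ le_add_self
      rw [ENNReal.ofReal_mul (by norm_num), mul_assoc]
      gcongr
      have hB : MeasurableSet {w | (τ, w) ∈ Ω} := measurable_prodMk_left hΩ
      have h1 := lintegral_torusKernel_ge hA hJA hlam hcube hB
        (F := fun w => ENNReal.ofReal ((σ (τ, z) - σ (τ, w)) ^ 2))
        (by have : Measurable fun w => σ (τ, w) := hσm.comp measurable_prodMk_left
            fun_prop) z
      have h2 : ∫⁻ w in {w | (τ, w) ∈ Ω}, torusKernel J lam (z - w) *
          ENNReal.ofReal ((σ (τ, z) - σ (τ, w)) ^ 2) = I (τ, z) := by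
        refine lintegral_congr_ae ?_
        filter_upwards [hτ] with w hw
        simp only [hz, hw]
      rw [h2] at h1
      refine le_trans (le_of_eq ?_) h1
      congr 1
      refine lintegral_congr fun y => ?_
      simp only [hD, spaceShift, Prod.mk_sub_mk, sub_zero]
      rfl
    have hpt : ∀ p q, ‖wellPrimitive r (σ p) - wellPrimitive r (σ q)‖ₑ ≤
        ENNReal.ofReal ((r ^ 2 - σ p ^ 2) ^ 2) + 2 * ENNReal.ofReal ((σ p - σ q) ^ 2) := by
      intro p q
      rw [← ofReal_norm, Real.norm_eq_abs, show (2 : ℝ≥0∞) = ENNReal.ofReal 2 by simp,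
        ← ENNReal.ofReal_mul (by norm_num), ← ENNReal.ofReal_add (by positivity) (by positivity)]
      exact ENNReal.ofReal_le_ofReal (abs_wellPrimitive_sub_le hr1.le (hσr p) (hσr _))
    calc _ ≤ ∫⁻ y in A, ∫⁻ p in Ω, (ENNReal.ofReal ((r ^ 2 - σ p ^ 2) ^ 2) + 2 * D p y) := by
          refine lintegral_mono fun y => lintegral_mono fun p => ?_
          simp only [hD]
          by_cases hq : p - spaceShift (lam • y) ∈ Ω
          · rw [indicator_of_mem hq, indicator_of_mem hq]; exact hpt p _
          · rw [indicator_of_notMem hq]; exact zero_le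
      _ = (∫⁻ y in A, ∫⁻ p in Ω, ENNReal.ofReal ((r ^ 2 - σ p ^ 2) ^ 2)) +
          2 * ∫⁻ y in A, ∫⁻ p in Ω, D p y := by
          rw [← lintegral_const_mul' _ _ (by norm_num), ← lintegral_add_left measurable_const]
          refine lintegral_congr fun y => ?_
          rw [lintegral_add_left (by fun_prop), lintegral_const_mul' _ _ (by norm_num)]
      _ ≤ volume A * (C2 * ENNReal.ofReal lam) + 2 * (C3 * ENNReal.ofReal lam) := by
          refine add_le_add ?_ ?_
          · rw [lintegral_const, Measure.restrict_apply_univ, mul_comm]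
            gcongr
          · rw [lintegral_lintegral_swap (by
              exact (hDm.comp measurable_swap).aemeasurable)]
            gcongr
      _ = (volume A * C2 + 2 * C3) * ENNReal.ofReal lam := by ring
      _ ≤ _ := mul_le_mul' le_add_self le_rfl

/-! ### Translation estimates -/

/-- The `L¹(K)` distance of `u` to its translate by `h`. -/
def translationError (K : Set (SpaceTime d)) (u : SpaceTime d → ℝ) (h : SpaceTime d) : ℝ≥0∞ :=
  ∫⁻ p in K, ‖u (p - h) - u p‖ₑ

theorem setLIntegral_sub_le {K K' : Set (SpaceTime d)} (hK : MeasurableSet K)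
    (hK' : MeasurableSet K') {b : SpaceTime d} (h : ∀ p ∈ K, p - b ∈ K')
    (f : SpaceTime d → ℝ≥0∞) : ∫⁻ p in K, f (p - b) ≤ ∫⁻ p in K', f p := by
  rw [← lintegral_indicator hK, ← lintegral_indicator hK',
    ← lintegral_sub_right_eq_self (K'.indicator f) b]
  refine lintegral_mono fun p => ?_
  by_cases hp : p ∈ K
  · rw [indicator_of_mem hp, indicator_of_mem (h p hp)]
  · rw [indicator_of_notMem hp]; exact zero_le

theorem translationError_zero (K : Set (SpaceTime d)) (u : SpaceTime d → ℝ) :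
    translationError K u 0 = 0 := by
  simp [translationError]

/-- The triangle inequality through p - b evaluates the error of a on the shifted set K - b; this is
why the larger set K' is needed. -/
theorem translationError_add_le {K K' : Set (SpaceTime d)} (hK : MeasurableSet K)
    (hK' : MeasurableSet K') {u : SpaceTime d → ℝ} (hu : Measurable u) {a b : SpaceTime d}
    (h : ∀ p ∈ K, p - b ∈ K') :
    translationError K u (a + b) ≤ translationError K' u a + translationError K u b := by
  have h1 := setLIntegral_sub_le hK hK' h fun p => ‖u (p - a) - u p‖ₑ
  calc translationError K u (a + b)
      ≤ ∫⁻ p in K, (‖u (p - b - a) - u (p - b)‖ₑ + ‖u (p - b) - u p‖ₑ) := by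
        refine lintegral_mono fun p => ?_
        have : u (p - (a + b)) - u p = (u (p - b - a) - u (p - b)) + (u (p - b) - u p) := by
          rw [show p - (a + b) = p - b - a by abel]; ring
        rw [this]
        exact enorm_add_le _ _
    _ = (∫⁻ p in K, ‖u (p - b - a) - u (p - b)‖ₑ) + translationError K u b := by
        refine lintegral_add_left ?_ _
        have h1 : Measurable fun p => u (p - b) := hu.comp (measurable_id.sub_const b)
        have h2 : Measurable fun p => u (p - b - a) :=
          hu.comp ((measurable_id.sub_const b).sub_const a)
        fun_prop
    _ ≤ _ := by gcongr; exact h1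

theorem translationError_nsmul_le {K K' : Set (SpaceTime d)} (hK : MeasurableSet K)
    (hK' : MeasurableSet K') {u : SpaceTime d → ℝ} (hu : Measurable u) {a : SpaceTime d} (k : ℕ)
    (h : ∀ i < k, ∀ p ∈ K, p - i • a ∈ K') :
    translationError K u (k • a) ≤ k * translationError K' u a := by
  induction k with
  | zero => simp [translationError_zero]
  | succ k ih =>
    rw [succ_nsmul', Nat.cast_succ, add_mul, one_mul, add_comm ((k : ℝ≥0∞) * _)]
    refine (translationError_add_le hK hK' hu (h k (Nat.lt_succ_self k))).trans ?_
    gcongr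
    exact ih fun i hi => h i (hi.trans (Nat.lt_succ_self k))

theorem AddCircle.norm_coe_le (x : ℝ) : ‖(x : UnitAddCircle)‖ ≤ |x| := by
  rw [AddCircle.norm_eq]
  simp only [inv_one, one_mul, mul_one]
  rcases le_or_gt |x| (1 / 2) with h | h
  · obtain ⟨h1, h2⟩ := abs_le.1 h
    simpa using round_le x 0
  · exact (abs_sub_round x).trans h.le

theorem norm_spaceShift_le (x : EuclideanSpace ℝ (Fin d)) : ‖spaceShift x‖ ≤ ‖x‖ := by
  rw [spaceShift, Prod.norm_def, norm_zero, max_eq_right (norm_nonneg _)]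
  refine (pi_norm_le_iff_of_nonneg (norm_nonneg _)).2 fun i => ?_
  exact (AddCircle.norm_coe_le _).trans (PiLp.norm_apply_le x i)

theorem spaceShift_add (x y : EuclideanSpace ℝ (Fin d)) :
    spaceShift (x + y) = spaceShift x + spaceShift y := by
  simp [spaceShift, toTorus_add]

theorem spaceShift_nsmul (k : ℕ) (x : EuclideanSpace ℝ (Fin d)) :
    spaceShift (k • x) = k • spaceShift x := by
  induction k with
  | zero => simp [spaceShift, toTorus_zero]
  | succ k ih => rw [succ_nsmul, succ_nsmul, spaceShift_add, ih]

/-- The difference of `u` and its translate, integrated where both are defined. -/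
def innerTranslationError (Ω : Set (SpaceTime d)) (u : SpaceTime d → ℝ) (h : SpaceTime d) : ℝ≥0∞ :=
  ∫⁻ p in Ω, Ω.indicator (fun q => ‖u p - u q‖ₑ) (p - h)

theorem measurable_innerTranslationError {Ω : Set (SpaceTime d)} (hΩ : MeasurableSet Ω)
    {u : SpaceTime d → ℝ} (hu : Measurable u) : Measurable (innerTranslationError Ω u) := by
  have hm : Measurable fun x : SpaceTime d × SpaceTime d => x.2 - x.1 := by fun_prop
  have hD : Measurable (Function.uncurry fun (h p : SpaceTime d) =>
      Ω.indicator (fun q => ‖u p - u q‖ₑ) (p - h)) := by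
    have : (Function.uncurry fun (h p : SpaceTime d) =>
        Ω.indicator (fun q => ‖u p - u q‖ₑ) (p - h)) =
        ((fun x : SpaceTime d × SpaceTime d => x.2 - x.1) ⁻¹' Ω).indicator
          (fun x => ‖u x.2 - u (x.2 - x.1)‖ₑ) := by
      ext ⟨h, p⟩; rfl
    rw [this]
    refine Measurable.indicator ?_ (hm hΩ)
    have h1 := hu.comp hm
    have h2 : Measurable fun x : SpaceTime d × SpaceTime d => u x.2 := hu.comp measurable_snd
    exact (h2.sub h1).enorm
  exact hD.lintegral_prod_right'

/-- The points p - (a - b) and p are compared through p - a, which differs from the first by b and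
from the second by a. Only errors between points of Ω are used. -/
theorem translationError_sub_le {K Ω : Set (SpaceTime d)} (hK : MeasurableSet K)
    (hΩ : MeasurableSet Ω) {u : SpaceTime d → ℝ} (hu : Measurable u) {a b : SpaceTime d}
    (hKΩ : K ⊆ Ω) (ha : ∀ p ∈ K, p - a ∈ Ω) (hb : ∀ p ∈ K, p - (a - b) ∈ Ω) :
    translationError K u (a - b) ≤ innerTranslationError Ω u b + innerTranslationError Ω u a := by
  have h1 := setLIntegral_sub_le hK hΩ hb
    fun q => Ω.indicator (fun q' => ‖u q - u q'‖ₑ) (q - b)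
  have hm : Measurable fun p => ‖u (p - a) - u p‖ₑ := by
    have : Measurable fun p => u (p - a) := hu.comp (measurable_id.sub_const a)
    fun_prop
  calc translationError K u (a - b)
      ≤ ∫⁻ p in K, (‖u (p - (a - b)) - u (p - a)‖ₑ + ‖u (p - a) - u p‖ₑ) := by
        refine lintegral_mono fun p => ?_
        rw [← sub_add_sub_cancel _ (u (p - a))]
        exact enorm_add_le _ _
    _ = (∫⁻ p in K, ‖u (p - (a - b)) - u (p - a)‖ₑ) + ∫⁻ p in K, ‖u (p - a) - u p‖ₑ :=
        lintegral_add_right _ hm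
    _ ≤ _ := by
        refine add_le_add (le_trans (le_of_eq ?_) h1) (le_trans ?_ (lintegral_mono_set hKΩ))
        · refine setLIntegral_congr_fun hK fun p hp => ?_
          have : p - (a - b) - b = p - a := by abel
          simp only [this]
          rw [indicator_of_mem (ha p hp)]
        · refine setLIntegral_mono' hK fun p hp => ?_
          rw [indicator_of_mem (ha p hp), ← enorm_neg, neg_sub]

/-- The hypothesis controls the shifts λy only on average over y ∈ A. Writing y₀ = y - (y - y₀) with
both terms in A, for a set of y of at least half the measure of A, turns the average into a bound
for each small y₀. Chaining these shifts reaches every x. -/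
theorem exists_space_translation_bound {A : Set (EuclideanSpace ℝ (Fin d))} (hA : IsCompact A)
    (hA0 : volume A ≠ 0) :
    ∃ C₀ : ℝ≥0∞, C₀ ≠ ∞ ∧ ∀ (Ω : Set (SpaceTime d)) (u : SpaceTime d → ℝ) (C : ℝ≥0∞) (lam : ℝ),
      MeasurableSet Ω → Measurable u → 0 < lam →
      ∫⁻ y in A, innerTranslationError Ω u (spaceShift (lam • y)) ≤ C * ENNReal.ofReal lam →
      ∀ (K : Set (SpaceTime d)) (δ : ℝ), 0 < δ → IsClosed K → Metric.cthickening (2 * δ) K ⊆ Ω →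
        (∀ y ∈ A, ‖lam • y‖ ≤ δ / 2) → ∀ x : EuclideanSpace ℝ (Fin d), ‖x‖ ≤ δ →
        translationError K u (spaceShift x) ≤ C₀ * C * ENNReal.ofReal (‖x‖ + lam) := by
  obtain ⟨r, hr, hvol⟩ := exists_le_volume_inter_translate hA hA0
  have hAf : volume A ≠ ∞ := hA.measure_lt_top.ne
  refine ⟨4 / volume A * ENNReal.ofReal (1 / r + 2),
    ENNReal.mul_ne_top (ENNReal.div_lt_top (by simp) hA0).ne ENNReal.ofReal_ne_top, ?_⟩
  intro Ω u C lam hΩ hu hlam hbound K δ hδ hK hKΩ hAδ x hx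
  set K' := Metric.cthickening δ K with hK'
  have hK'm : MeasurableSet K' := Metric.isClosed_cthickening.measurableSet
  have hK'Ω : ∀ p ∈ K', ∀ h : SpaceTime d, ‖h‖ ≤ δ → p - h ∈ Ω := by
    intro p hp h hh
    refine hKΩ ?_
    rw [two_mul]
    refine Metric.cthickening_cthickening_subset hδ.le hδ.le K ?_
    exact Metric.mem_cthickening_of_dist_le (p - h) p δ K' hp (by simpa [dist_eq_norm] using hh)
  have hstep : ∀ y₀ : EuclideanSpace ℝ (Fin d), ‖y₀‖ ≤ r →
      translationError K' u (spaceShift (lam • y₀)) ≤ 4 / volume A * C * ENNReal.ofReal lam := by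
    intro y₀ hy₀
    set B := A ∩ (fun x => x - y₀) ⁻¹' A with hB
    have hBm : MeasurableSet B :=
      hA.measurableSet.inter ((measurable_id.sub_const y₀) hA.measurableSet)
    set N : EuclideanSpace ℝ (Fin d) → ℝ≥0∞ := fun y =>
      innerTranslationError Ω u (spaceShift (lam • y)) with hN
    have hNm : Measurable N := (measurable_innerTranslationError hΩ hu).comp
      (continuous_spaceShift.comp (continuous_const_smul lam)).measurable
    have hpt : ∀ y ∈ B, translationError K' u (spaceShift (lam • y₀)) ≤ N (y - y₀) + N y := by
      rintro y ⟨hy1, hy2⟩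
      have hy2 : y - y₀ ∈ A := hy2
      have heq : spaceShift (lam • y₀) = spaceShift (lam • y) - spaceShift (lam • (y - y₀)) := by
        rw [eq_sub_iff_add_eq, ← spaceShift_add, ← smul_add]; simp
      have n1 := (norm_spaceShift_le _).trans (hAδ y hy1)
      have n2 := (norm_spaceShift_le _).trans (hAδ _ hy2)
      rw [heq]
      refine translationError_sub_le hK'm hΩ hu ?_ ?_ ?_
      · intro p hp; simpa using hK'Ω p hp 0 (by simpa using hδ.le)
      · intro p hp; exact hK'Ω p hp _ (by linarith)
      · intro p hp; exact hK'Ω p hp _ ((norm_sub_le _ _).trans (by linarith))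
    have h1 : volume A / 2 * translationError K' u (spaceShift (lam • y₀)) ≤
        2 * (C * ENNReal.ofReal lam) := by
      calc volume A / 2 * translationError K' u (spaceShift (lam • y₀))
          ≤ volume B * translationError K' u (spaceShift (lam • y₀)) := by
            gcongr; exact hvol y₀ hy₀
        _ = ∫⁻ y in B, translationError K' u (spaceShift (lam • y₀)) := by
            rw [lintegral_const, Measure.restrict_apply_univ, mul_comm]
        _ ≤ ∫⁻ y in B, (N (y - y₀) + N y) := setLIntegral_mono' hBm hpt
        _ = (∫⁻ y in B, N (y - y₀)) + ∫⁻ y in B, N y := lintegral_add_right _ hNm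
        _ ≤ (∫⁻ y in A, N y) + ∫⁻ y in A, N y := by
            refine add_le_add ?_ (lintegral_mono_set inter_subset_left)
            rw [← lintegral_indicator hBm, ← lintegral_indicator hA.measurableSet,
              ← lintegral_sub_right_eq_self (A.indicator N) y₀]
            refine lintegral_mono fun y => ?_
            by_cases hy : y ∈ B
            · have hy2 : y - y₀ ∈ A := hy.2
              rw [indicator_of_mem hy, indicator_of_mem hy2]
            · rw [indicator_of_notMem hy]; exact zero_le
        _ ≤ _ := by rw [← two_mul]; gcongr
    have h2 : 2 / volume A * (volume A / 2) = 1 := by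
      rw [ENNReal.div_eq_inv_mul, ENNReal.div_eq_inv_mul]
      calc _ = (volume A)⁻¹ * volume A * (2 * 2⁻¹) := by ring
        _ = 1 := by
          rw [ENNReal.inv_mul_cancel hA0 hAf, ENNReal.mul_inv_cancel (by simp) (by simp), one_mul]
    calc translationError K' u (spaceShift (lam • y₀))
        = 2 / volume A * (volume A / 2 * translationError K' u (spaceShift (lam • y₀))) := by
          rw [← mul_assoc, h2, one_mul]
      _ ≤ 2 / volume A * (2 * (C * ENNReal.ofReal lam)) := by gcongr
      _ = 4 / volume A * C * ENNReal.ofReal lam := by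
          simp only [div_eq_mul_inv]; ring
  -- The number of steps is chosen so that x/(kλ) lies in the Steinhaus ball; the extra step keeps k
  -- positive when x = 0. Then kλ ≤ ‖x‖/r + 2λ, the origin of the additive λ.
  set k : ℕ := ⌈‖x‖ / (r * lam)⌉₊ + 1 with hk
  have hk0 : (0 : ℝ) < k := by positivity
  have hk1 : ‖x‖ / (r * lam) ≤ k := (Nat.le_ceil _).trans (by simp [hk])
  have hk2 : (k : ℝ) ≤ ‖x‖ / (r * lam) + 2 := by
    have := (Nat.ceil_lt_add_one (show 0 ≤ ‖x‖ / (r * lam) by positivity)).le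
    simp only [hk, Nat.cast_add, Nat.cast_one]; linarith
  set y₀ : EuclideanSpace ℝ (Fin d) := (k * lam)⁻¹ • x with hy₀
  have hy₀r : ‖y₀‖ ≤ r := by
    rw [hy₀, norm_smul, norm_inv, Real.norm_of_nonneg (by positivity), inv_mul_le_iff₀ (by positivity)]
    rw [div_le_iff₀ (by positivity)] at hk1
    linarith
  have hkx : k • (lam • y₀) = x := by
    rw [hy₀, ← Nat.cast_smul_eq_nsmul ℝ, smul_smul, smul_smul]
    rw [show (k : ℝ) * lam * (k * lam)⁻¹ = 1 from mul_inv_cancel₀ (by positivity), one_smul]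
  have hnorm : ∀ i : ℕ, i < k → ‖i • spaceShift (lam • y₀)‖ ≤ δ := by
    intro i hi
    rw [← spaceShift_nsmul]
    refine (norm_spaceShift_le _).trans (le_trans ?_ hx)
    rw [← Nat.cast_smul_eq_nsmul ℝ, hy₀, smul_smul, smul_smul, norm_smul]
    refine mul_le_of_le_one_left (norm_nonneg _) ?_
    rw [Real.norm_of_nonneg (by positivity), ← div_eq_mul_inv, div_le_one (by positivity)]
    gcongr
  rw [← hkx, spaceShift_nsmul, hkx]
  refine (translationError_nsmul_le hK.measurableSet hK'm hu k ?_).trans ?_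
  · intro i hi p hp
    exact Metric.mem_cthickening_of_dist_le _ p δ K hp (by simpa [dist_eq_norm] using hnorm i hi)
  calc (k : ℝ≥0∞) * translationError K' u (spaceShift (lam • y₀))
      ≤ k * (4 / volume A * C * ENNReal.ofReal lam) := by gcongr; exact hstep y₀ hy₀r
    _ = 4 / volume A * C * ENNReal.ofReal (k * lam) := by
        rw [ENNReal.ofReal_mul (by positivity), ENNReal.ofReal_natCast]; ring
    _ ≤ 4 / volume A * C * ENNReal.ofReal ((1 / r + 2) * (‖x‖ + lam)) := by
        refine mul_le_mul' le_rfl (ENNReal.ofReal_le_ofReal ?_)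
        have h3 : (k : ℝ) * lam ≤ (‖x‖ / (r * lam) + 2) * lam := by gcongr
        have h4 : (‖x‖ / (r * lam) + 2) * lam = 1 / r * ‖x‖ + 2 * lam := by field_simp
        have h5 : 0 ≤ 1 / r * lam := by positivity
        nlinarith [norm_nonneg x]
    _ = _ := by rw [ENNReal.ofReal_mul (by positivity)]; ring

/-! ### Directional derivatives on `ℝ × 𝕋ᵈ` -/

/-- Because of this quotient property, continuity on space-time can be tested after lifting to the
Euclidean covering space, where differentiability is formulated. -/
theorem isOpenQuotientMap_cover : IsOpenQuotientMap (cover (d := d)) := by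
  have h1 : IsOpenQuotientMap (Prod.map (id : ℝ → ℝ)
      (fun (x : Fin d → ℝ) (i : Fin d) => (x i : UnitAddCircle))) :=
    IsOpenQuotientMap.id.prodMap
      (IsOpenQuotientMap.piMap fun _ => QuotientAddGroup.isOpenQuotientMap_mk)
  have h2 : IsOpenQuotientMap (fun y : EuclideanSpace ℝ (Fin (d + 1)) =>
      ((y 0, fun i : Fin d => y i.succ) : ℝ × (Fin d → ℝ))) := by
    let e : EuclideanSpace ℝ (Fin (d + 1)) ≃ₜ ℝ × (Fin d → ℝ) :=
      { toFun := fun y => (y 0, fun i => y i.succ)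
        invFun := fun x => WithLp.toLp 2 (Fin.cons x.1 x.2)
        left_inv := fun y => by
          ext i; refine Fin.cases ?_ (fun j => ?_) i <;> simp
        right_inv := fun x => by simp
        continuous_toFun := by fun_prop
        continuous_invFun := by
          refine (PiLp.continuous_toLp 2 _).comp (continuous_pi fun i => ?_)
          refine Fin.cases ?_ (fun j => ?_) i
          · simpa using continuous_fst
          · simpa [Function.comp_def] using (continuous_apply j).comp (continuous_snd (X := ℝ) (Y := Fin d → ℝ)) }
    exact e.isOpenQuotientMap
  exact h1.comp h2

theorem continuous_of_comp_cover {F : Type*} [TopologicalSpace F] {φ : SpaceTime d → F}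
    (h : Continuous fun y => φ (cover y)) : Continuous φ :=
  isOpenQuotientMap_cover.isQuotientMap.continuous_iff.2 h

theorem IsTestFunction.continuous {F : Type*} [NormedAddCommGroup F] [NormedSpace ℝ F]
    {U : Set (SpaceTime d)} {φ : SpaceTime d → F} (h : IsTestFunction U φ) : Continuous φ :=
  continuous_of_comp_cover h.contDiff.continuous

/-- The derivative of `φ` in the direction `e`. -/
def dirDeriv (e : EuclideanSpace ℝ (Fin (d + 1))) (φ : SpaceTime d → ℝ) (p : SpaceTime d) : ℝ :=
  deriv (fun t : ℝ => φ (p + cover (t • e))) 0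

theorem cover_smul_single_zero (t : ℝ) :
    cover (t • EuclideanSpace.single (0 : Fin (d + 1)) (1 : ℝ)) = ((t, 0) : SpaceTime d) := by
  ext i
  · simp [cover]
  · simp [cover]

theorem cover_smul_single_succ (i : Fin d) (t : ℝ) :
    cover (t • EuclideanSpace.single i.succ (1 : ℝ)) =
      ((0, Pi.single i (t : UnitAddCircle)) : SpaceTime d) := by
  ext j
  · simp [cover, Fin.succ_ne_zero]
  · by_cases h : j = i
    · subst h; simp [cover]
    · simp [cover, h]

theorem timeDeriv_eq_dirDeriv (φ : SpaceTime d → ℝ) (p : SpaceTime d) :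
    timeDeriv φ p = dirDeriv (EuclideanSpace.single 0 1) φ p := by
  simp only [timeDeriv, dirDeriv, cover_smul_single_zero]
  congr 1; ext t; congr 1; ext <;> simp

theorem spaceDeriv_eq_dirDeriv (i : Fin d) (φ : SpaceTime d → ℝ) (p : SpaceTime d) :
    spaceDeriv i φ p = dirDeriv (EuclideanSpace.single i.succ 1) φ p := by
  simp only [spaceDeriv, dirDeriv, cover_smul_single_succ]
  congr 1; ext t; congr 1; ext <;> simp

section

variable {φ : SpaceTime d → ℝ} (hφ : ContDiff ℝ 1 fun y => φ (cover y))
  (e : EuclideanSpace ℝ (Fin (d + 1)))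
include hφ

theorem hasDerivAt_comp_cover_add_smul (y : EuclideanSpace ℝ (Fin (d + 1))) (t : ℝ) :
    HasDerivAt (fun t : ℝ => φ (cover y + cover (t • e)))
      (fderiv ℝ (fun y => φ (cover y)) (y + t • e) e) t := by
  have h1 : HasDerivAt (fun t : ℝ => y + t • e) e t := by
    simpa using ((hasDerivAt_id t).smul_const e).const_add y
  have h2 := ((hφ.differentiable one_ne_zero) (y + t • e)).hasFDerivAt.comp_hasDerivAt t h1
  refine h2.congr_of_eventuallyEq (Eventually.of_forall fun t => ?_)
  simp [cover_add]

theorem dirDeriv_cover (y : EuclideanSpace ℝ (Fin (d + 1))) :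
    dirDeriv e φ (cover y) = fderiv ℝ (fun y => φ (cover y)) y e := by
  have := (hasDerivAt_comp_cover_add_smul hφ e y 0).deriv
  simpa [dirDeriv] using this

theorem hasDerivAt_comp_add_cover (p : SpaceTime d) (t : ℝ) :
    HasDerivAt (fun t : ℝ => φ (p + cover (t • e))) (dirDeriv e φ (p + cover (t • e))) t := by
  obtain ⟨y, rfl⟩ := cover_surjective p
  rw [← cover_add, dirDeriv_cover hφ]
  exact hasDerivAt_comp_cover_add_smul hφ e y t

theorem continuous_dirDeriv : Continuous (dirDeriv e φ) := by
  refine continuous_of_comp_cover ?_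
  simp only [dirDeriv_cover hφ]
  exact (hφ.continuous_fderiv one_ne_zero).clm_apply continuous_const

omit hφ in
theorem dirDeriv_eq_zero_of_notMem_tsupport {p : SpaceTime d} (hp : p ∉ tsupport φ) :
    dirDeriv e φ p = 0 := by
  have hc : Tendsto (fun t : ℝ => p + cover (t • e)) (𝓝 0) (𝓝 p) := by
    have : Continuous fun t : ℝ => p + cover (t • e) :=
      continuous_const.add (continuous_cover.comp (continuous_id.smul continuous_const))
    have h := this.tendsto 0
    have h0 : cover (0 : EuclideanSpace ℝ (Fin (d + 1))) = 0 := by ext <;> simp [cover]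
    simpa [h0] using h
  have h : (fun t : ℝ => φ (p + cover (t • e))) =ᶠ[𝓝 0] fun _ => 0 :=
    hc.eventually (notMem_tsupport_iff_eventuallyEq.1 hp)
  rw [dirDeriv, h.deriv_eq]; simp

theorem exists_abs_dirDeriv_le (hs : HasCompactSupport φ) :
    ∃ B : ℝ, 0 ≤ B ∧ ∀ p, |dirDeriv e φ p| ≤ B := by
  obtain ⟨B, hB⟩ := hs.exists_bound_of_continuousOn (continuous_dirDeriv hφ e).continuousOn
  refine ⟨max B 0, le_max_right _ _, fun p => ?_⟩
  by_cases hp : p ∈ tsupport φ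
  · exact (hB p hp).trans (le_max_left _ _)
  · rw [dirDeriv_eq_zero_of_notMem_tsupport e hp]; simp

theorem abs_comp_add_cover_sub_le {B : ℝ} (hB : ∀ p, |dirDeriv e φ p| ≤ B) (p : SpaceTime d)
    (t t' : ℝ) : |φ (p + cover (t • e)) - φ (p + cover (t' • e))| ≤ B * |t - t'| := by
  have := Convex.norm_image_sub_le_of_norm_hasDerivWithin_le (𝕜 := ℝ)
    (f := fun t : ℝ => φ (p + cover (t • e))) (s := univ) (x := t') (y := t) (C := B)
    (fun t _ => (hasDerivAt_comp_add_cover hφ e p t).hasDerivWithinAt)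
    (fun t _ => hB _) convex_univ (mem_univ _) (mem_univ _)
  exact this

end

/-! ### Mollification on `ℝ × 𝕋ᵈ` -/

/-- The cosine `cos (2π x)` on the circle. -/
def circleCos (x : UnitAddCircle) : ℝ := ((AddCircle.toCircle x : Circle) : ℂ).re

theorem circleCos_coe (x : ℝ) : circleCos (x : UnitAddCircle) = Real.cos (2 * Real.pi * x) := by
  rw [circleCos, AddCircle.toCircle_apply_mk, Circle.coe_exp, div_one]
  exact Complex.exp_ofReal_mul_I_re _

theorem continuous_circleCos : Continuous circleCos :=
  Complex.continuous_re.comp (continuous_subtype_val.comp AddCircle.continuous_toCircle)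

/-- A smooth function on `ℝ × 𝕋ᵈ` that dominates the square of the distance to the origin. -/
def smoothGauge (p : SpaceTime d) : ℝ := p.1 ^ 2 + ∑ i, (1 - circleCos (p.2 i))

theorem continuous_smoothGauge : Continuous (smoothGauge (d := d)) := by
  have := continuous_circleCos
  unfold smoothGauge; fun_prop

/-- For the representative w with |w| ≤ 1/2, the quadratic upper bound of the cosine on [-π, π]
gives 1 - cos (2πw) ≥ 8w². -/
theorem norm_sq_le_one_sub_circleCos (x : UnitAddCircle) : ‖x‖ ^ 2 ≤ 1 - circleCos x := by
  obtain ⟨y, rfl⟩ := QuotientAddGroup.mk_surjective x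
  have e : ((y : ℝ) : UnitAddCircle) = ((y - round y : ℝ) : UnitAddCircle) := by
    rw [AddCircle.coe_sub, eq_comm, sub_eq_self]
    exact (AddCircle.coe_eq_zero_iff (1 : ℝ)).2 ⟨round y, by simp⟩
  have hn : ‖((y : ℝ) : UnitAddCircle)‖ = |y - round y| := by
    rw [AddCircle.norm_eq]; simp
  have hc : circleCos ((y : ℝ) : UnitAddCircle) = Real.cos (2 * Real.pi * (y - round y)) := by
    rw [e, circleCos_coe]
  change ‖((y : ℝ) : UnitAddCircle)‖ ^ 2 ≤ 1 - circleCos ((y : ℝ) : UnitAddCircle)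
  rw [hn, hc, sq_abs]
  set w := y - round y with hw
  have hw2 : |w| ≤ 1 / 2 := abs_sub_round y
  have h := Real.cos_le_one_sub_mul_cos_sq (x := 2 * Real.pi * w) (by
    rw [abs_mul, abs_of_pos (by positivity)]
    nlinarith [Real.pi_pos])
  have h2 : 2 / Real.pi ^ 2 * (2 * Real.pi * w) ^ 2 = 8 * w ^ 2 := by
    field_simp; ring
  rw [h2] at h
  nlinarith [sq_nonneg w]

theorem smoothGauge_zero : smoothGauge (0 : SpaceTime d) = 0 := by
  have : circleCos 0 = 1 := by
    have := circleCos_coe 0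
    simpa using this
  simp [smoothGauge, this]

theorem norm_sq_le_smoothGauge (p : SpaceTime d) : ‖p‖ ^ 2 ≤ smoothGauge p := by
  have hnn : ∀ i, 0 ≤ 1 - circleCos (p.2 i) := fun i =>
    (sq_nonneg _).trans (norm_sq_le_one_sub_circleCos _)
  have h1 : ‖p‖ ≤ Real.sqrt (smoothGauge p) := by
    rw [Prod.norm_def]
    refine max_le ?_ ?_
    · refine Real.abs_le_sqrt ?_
      exact le_add_of_nonneg_right (Finset.sum_nonneg fun i _ => hnn i)
    · refine (pi_norm_le_iff_of_nonneg (Real.sqrt_nonneg _)).2 fun i => ?_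
      refine Real.le_sqrt_of_sq_le ((norm_sq_le_one_sub_circleCos _).trans ?_)
      refine le_trans (Finset.single_le_sum (f := fun i => 1 - circleCos (p.2 i))
        (fun i _ => hnn i) (Finset.mem_univ i)) ?_
      exact le_add_of_nonneg_left (sq_nonneg _)
  have h0 : 0 ≤ smoothGauge p := add_nonneg (sq_nonneg _) (Finset.sum_nonneg fun i _ => hnn i)
  calc ‖p‖ ^ 2 ≤ Real.sqrt (smoothGauge p) ^ 2 := by gcongr
    _ = _ := Real.sq_sqrt h0

/-- A smooth bump function on `ℝ × 𝕋ᵈ`, supported in the ball of radius `δ`. -/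
def bump (δ : ℝ) (p : SpaceTime d) : ℝ := Real.smoothTransition (δ ^ 2 - smoothGauge p)

theorem continuous_bump (δ : ℝ) : Continuous (bump (d := d) δ) :=
  Real.smoothTransition.continuous.comp (continuous_const.sub continuous_smoothGauge)

theorem bump_nonneg (δ : ℝ) (p : SpaceTime d) : 0 ≤ bump δ p := Real.smoothTransition.nonneg _

theorem bump_eq_zero {δ : ℝ} (hδ : 0 ≤ δ) {p : SpaceTime d} (hp : δ ≤ ‖p‖) : bump δ p = 0 := by
  refine Real.smoothTransition.zero_of_nonpos ?_
  have : δ ^ 2 ≤ ‖p‖ ^ 2 := by gcongr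
  linarith [norm_sq_le_smoothGauge p]

theorem hasCompactSupport_bump {δ : ℝ} (hδ : 0 ≤ δ) : HasCompactSupport (bump (d := d) δ) :=
  HasCompactSupport.of_support_subset_isCompact (isCompact_closedBall (0 : SpaceTime d) δ)
    fun p hp => by
      rw [mem_closedBall_zero_iff]
      by_contra h
      exact hp (bump_eq_zero hδ (not_le.1 h).le)

theorem integral_bump_pos {δ : ℝ} (hδ : 0 < δ) : 0 < ∫ p : SpaceTime d, bump δ p := by
  refine (continuous_bump δ).integral_pos_of_hasCompactSupport_nonneg_nonzero
    (hasCompactSupport_bump hδ.le) (bump_nonneg δ) (x := 0) ?_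
  refine (Real.smoothTransition.pos_of_pos ?_).ne'
  rw [smoothGauge_zero, sub_zero]; positivity

theorem contDiff_bump_cover (δ : ℝ) : ContDiff ℝ 1 fun y => bump (d := d) δ (cover y) := by
  have : (fun y => bump (d := d) δ (cover y)) = fun y => Real.smoothTransition
      (δ ^ 2 - (y 0 ^ 2 + ∑ i : Fin d, (1 - Real.cos (2 * Real.pi * y i.succ)))) := by
    ext y; simp only [bump, smoothGauge, cover, circleCos_coe]
  rw [this]
  refine Real.smoothTransition.contDiff.comp ?_
  fun_prop

/-- The normalized bump function. -/
def mollifier (δ : ℝ) (p : SpaceTime d) : ℝ := (∫ q : SpaceTime d, bump δ q)⁻¹ * bump δ p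

theorem continuous_mollifier (δ : ℝ) : Continuous (mollifier (d := d) δ) :=
  continuous_const.mul (continuous_bump δ)

theorem mollifier_nonneg (δ : ℝ) (p : SpaceTime d) : 0 ≤ mollifier δ p :=
  mul_nonneg (inv_nonneg.2 (integral_nonneg (bump_nonneg δ))) (bump_nonneg δ p)

theorem mollifier_eq_zero {δ : ℝ} (hδ : 0 ≤ δ) {p : SpaceTime d} (hp : δ ≤ ‖p‖) :
    mollifier δ p = 0 := by
  rw [mollifier, bump_eq_zero hδ hp, mul_zero]

theorem hasCompactSupport_mollifier {δ : ℝ} (hδ : 0 ≤ δ) :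
    HasCompactSupport (mollifier (d := d) δ) :=
  (hasCompactSupport_bump hδ).mul_left

theorem integrable_mollifier {δ : ℝ} (hδ : 0 ≤ δ) : Integrable (mollifier (d := d) δ) :=
  (continuous_mollifier δ).integrable_of_hasCompactSupport (hasCompactSupport_mollifier hδ)

theorem integral_mollifier {δ : ℝ} (hδ : 0 < δ) : ∫ p : SpaceTime d, mollifier δ p = 1 := by
  simp only [mollifier, integral_const_mul]
  exact inv_mul_cancel₀ (integral_bump_pos hδ).ne'

theorem lintegral_mollifier {δ : ℝ} (hδ : 0 < δ) :
    ∫⁻ p : SpaceTime d, ‖mollifier δ p‖ₑ = 1 := by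
  have h := ofReal_integral_norm_eq_lintegral_enorm (integrable_mollifier (d := d) hδ.le)
  simp only [Real.norm_of_nonneg (mollifier_nonneg δ _)] at h
  rw [← h, integral_mollifier hδ, ENNReal.ofReal_one]

theorem contDiff_mollifier_cover (δ : ℝ) :
    ContDiff ℝ 1 fun y => mollifier (d := d) δ (cover y) :=
  contDiff_const.mul (contDiff_bump_cover δ)

theorem exists_abs_mollifier_le {δ : ℝ} (hδ : 0 ≤ δ) :
    ∃ B : ℝ, ∀ p : SpaceTime d, ‖mollifier δ p‖ ≤ B :=
  (hasCompactSupport_mollifier hδ).exists_bound_of_continuous (continuous_mollifier δ)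

/-- The convolution with the mollifier. -/
def mollify (δ : ℝ) (f : SpaceTime d → ℝ) (p : SpaceTime d) : ℝ :=
  ∫ q, f q * mollifier δ (p - q)

section

variable {δ : ℝ} (hδ : 0 < δ) {f : SpaceTime d → ℝ} (hf : Integrable f)
include hδ hf

theorem integrable_mul_mollifier (p : SpaceTime d) :
    Integrable fun q => f q * mollifier δ (p - q) := by
  obtain ⟨B, hB⟩ := exists_abs_mollifier_le (d := d) hδ.le
  refine hf.mul_bdd (c := B) ?_ (ae_of_all _ fun q => hB _)
  exact ((continuous_mollifier δ).comp (by fun_prop)).aestronglyMeasurable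

theorem continuous_mollify : Continuous (mollify δ f) := by
  obtain ⟨B, hB⟩ := exists_abs_mollifier_le (d := d) hδ.le
  refine continuous_of_dominated (bound := fun q => ‖f q‖ * B)
    (fun p => (integrable_mul_mollifier hδ hf p).aestronglyMeasurable) ?_
    (hf.norm.mul_const B) ?_
  · refine fun p => ae_of_all _ fun q => ?_
    rw [norm_mul]; gcongr; exact hB _
  · refine ae_of_all _ fun q => continuous_const.mul ((continuous_mollifier δ).comp (by fun_prop))

theorem abs_mollify_le {r : ℝ} (hr : ∀ p, |f p| ≤ r) (p : SpaceTime d) : |mollify δ f p| ≤ r := by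
  calc |mollify δ f p| ≤ ∫ q, ‖f q * mollifier δ (p - q)‖ := by
        rw [← Real.norm_eq_abs]; exact norm_integral_le_integral_norm _
    _ ≤ ∫ q, r * mollifier δ (p - q) := by
        refine integral_mono (integrable_mul_mollifier hδ hf p).norm
          (((integrable_mollifier hδ.le).comp_sub_left p).const_mul r) fun q => ?_
        simp only
        rw [norm_mul, Real.norm_of_nonneg (mollifier_nonneg δ _)]
        exact mul_le_mul_of_nonneg_right (hr q) (mollifier_nonneg δ _)
    _ = r := by
        rw [integral_const_mul, integral_sub_left_eq_self (mollifier δ), integral_mollifier hδ,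
          mul_one]

theorem mollify_sub_eq (p : SpaceTime d) :
    mollify δ f p - f p = ∫ h, (f (p - h) - f p) * mollifier δ h := by
  have h1 : mollify δ f p = ∫ h, f (p - h) * mollifier δ h := by
    rw [mollify, ← integral_sub_left_eq_self _ volume p]
    simp
  have hi : Integrable fun h => f (p - h) * mollifier δ h := by
    have := (integrable_mul_mollifier hδ hf p).comp_sub_left p
    simpa using this
  have h2 : f p = ∫ h, f p * mollifier (d := d) δ h := by
    rw [integral_const_mul, integral_mollifier hδ, mul_one]
  calc mollify δ f p - f p
      = (∫ h, f (p - h) * mollifier δ h) - ∫ h, f p * mollifier (d := d) δ h := by rw [h1, ← h2]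
    _ = _ := by
      rw [← integral_sub hi ((integrable_mollifier hδ.le).const_mul _)]
      simp only [sub_mul]

omit hf in
-- The mollification error is an average of translation errors over shifts of size at most δ, by
-- Tonelli, and the weights have total mass one.
theorem lintegral_mollify_sub_le (hf : Integrable f) (hfm : Measurable f) {K : Set (SpaceTime d)}
    {η : ℝ≥0∞} (hη : ∀ h : SpaceTime d, ‖h‖ ≤ δ → translationError K f h ≤ η) :
    ∫⁻ p in K, ‖mollify δ f p - f p‖ₑ ≤ η := by
  have hm : Measurable fun x : SpaceTime d × SpaceTime d =>
      ‖(f (x.1 - x.2) - f x.1) * mollifier δ x.2‖ₑ := by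
    have h1 : Measurable fun x : SpaceTime d × SpaceTime d => f (x.1 - x.2) :=
      hfm.comp (measurable_fst.sub measurable_snd)
    have h2 : Measurable fun x : SpaceTime d × SpaceTime d => f x.1 := hfm.comp measurable_fst
    have h3 : Measurable fun x : SpaceTime d × SpaceTime d => mollifier δ x.2 :=
      (continuous_mollifier δ).measurable.comp measurable_snd
    exact ((h1.sub h2).mul h3).enorm
  calc ∫⁻ p in K, ‖mollify δ f p - f p‖ₑ
      ≤ ∫⁻ p in K, ∫⁻ h, ‖(f (p - h) - f p) * mollifier δ h‖ₑ := by
        refine lintegral_mono fun p => ?_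
        rw [mollify_sub_eq hδ hf]
        exact enorm_integral_le_lintegral_enorm _
    _ = ∫⁻ h, ∫⁻ p in K, ‖(f (p - h) - f p) * mollifier δ h‖ₑ :=
        lintegral_lintegral_swap hm.aemeasurable
    _ ≤ ∫⁻ h, η * ‖mollifier (d := d) δ h‖ₑ := by
        refine lintegral_mono fun h => ?_
        simp only [enorm_mul]
        rw [lintegral_mul_const' _ _ enorm_ne_top]
        by_cases hh : ‖h‖ ≤ δ
        · gcongr; exact hη h hh
        · rw [mollifier_eq_zero hδ.le (not_le.1 hh).le]; simp
    _ = η := by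
        rw [lintegral_const_mul _ (continuous_mollifier δ).measurable.enorm,
          lintegral_mollifier hδ, mul_one]

end

/-- Translations act continuously on L¹, because composition in Lp depends continuously on the
measure-preserving map. -/
theorem tendsto_translationError_univ {f : SpaceTime d → ℝ} (hf : Integrable f) :
    Tendsto (translationError univ f) (𝓝 0) (𝓝 0) := by
  have hf1 : MemLp f 1 volume := memLp_one_iff_integrable.2 hf
  have : Fact (1 ≤ (1 : ℝ≥0∞)) := ⟨le_rfl⟩
  set F : Lp ℝ 1 (volume : Measure (SpaceTime d)) := hf1.toLp f with hF
  let g : SpaceTime d → C(SpaceTime d, SpaceTime d) := fun h => ⟨fun p => p - h, by fun_prop⟩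
  have hg : Continuous g :=
    ContinuousMap.continuous_of_continuous_uncurry _
      (continuous_snd.sub continuous_fst)
  have hmp : ∀ h, MeasurePreserving (g h) volume volume := fun h =>
    measurePreserving_sub_right volume h
  have hcont : Continuous fun h => Lp.compMeasurePreserving (g h) (hmp h) F :=
    Continuous.compMeasurePreservingLp continuous_const hg hmp (by simp)
  have hlim := hcont.tendsto 0
  rw [tendsto_iff_edist_tendsto_0] at hlim
  refine hlim.congr fun h => ?_
  rw [hF, Lp.toLp_compMeasurePreserving, Lp.toLp_compMeasurePreserving, Lp.edist_toLp_toLp,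
    eLpNorm_one_eq_lintegral_enorm, translationError, setLIntegral_univ]
  refine lintegral_congr fun p => ?_
  simp [g]

/-! ### Time translations of functions with a weak time derivative -/

/-- The translation of time by `t`. -/
def timeShift (t : ℝ) : SpaceTime d := (t, 0)

theorem norm_timeShift (t : ℝ) : ‖(timeShift t : SpaceTime d)‖ = |t| := by
  simp [timeShift, Prod.norm_def]

theorem continuous_timeShift : Continuous (timeShift (d := d)) := by
  unfold timeShift; fun_prop

theorem timeShift_eq_cover (t : ℝ) :
    (timeShift t : SpaceTime d) = cover (t • EuclideanSpace.single 0 1) :=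
  (cover_smul_single_zero t).symm

theorem isTestFunction_mollifier_sub {U : Set (SpaceTime d)} {δ : ℝ} (hδ : 0 < δ)
    {p : SpaceTime d} (hU : Metric.closedBall p δ ⊆ U) :
    IsTestFunction U fun q => mollifier δ (p - q) := by
  have hsupp : tsupport (fun q => mollifier δ (p - q)) ⊆ Metric.closedBall p δ := by
    refine closure_minimal (fun q hq => ?_) Metric.isClosed_closedBall
    rw [Metric.mem_closedBall, dist_comm, dist_eq_norm]
    by_contra h
    exact hq (mollifier_eq_zero hδ.le (not_le.1 h).le)
  refine ⟨?_, ?_, hsupp.trans hU⟩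
  · obtain ⟨y, rfl⟩ := cover_surjective p
    have : (fun x => mollifier δ (cover y - cover x)) =
        (fun x => mollifier (d := d) δ (cover x)) ∘ fun x => y - x := by
      ext x
      have h : cover y = cover (y - x) + cover x := by rw [← cover_add, sub_add_cancel]
      simp only [Function.comp_apply]; rw [h, add_sub_cancel_right]
    rw [this]
    exact (contDiff_mollifier_cover δ).comp (by fun_prop)
  · exact HasCompactSupport.of_support_subset_isCompact (isCompact_closedBall p δ)
      (subset_closure.trans hsupp)

theorem timeDeriv_comp_sub {φ : SpaceTime d → ℝ} (hφ : ContDiff ℝ 1 fun y => φ (cover y))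
    (p q : SpaceTime d) :
    timeDeriv (fun q => φ (p - q)) q =
      -dirDeriv (EuclideanSpace.single 0 1) φ (p - q) := by
  have h := hasDerivAt_comp_add_cover hφ (EuclideanSpace.single 0 1) (p - q) 0
  have h0 : cover ((0 : ℝ) • EuclideanSpace.single (0 : Fin (d + 1)) (1 : ℝ)) = 0 := by
    rw [cover_smul_single_zero]; rfl
  rw [h0, add_zero] at h
  have h1 : HasDerivAt (fun t : ℝ => φ (p - q + cover (t •
      EuclideanSpace.single (0 : Fin (d + 1)) (1 : ℝ))))
      (dirDeriv (EuclideanSpace.single 0 1) φ (p - q)) (-0) := by rwa [neg_zero]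
  have h2 := h1.comp 0 (hasDerivAt_neg 0)
  rw [mul_neg_one] at h2
  rw [timeDeriv, ← h2.deriv]
  congr 1; ext t
  simp only [Function.comp_apply]
  rw [cover_smul_single_zero]
  congr 1
  ext
  · simp; ring
  · simp

/-- Differentiation under the integral falls on the kernel, and the weak formulation, tested with
the reflected kernel, moves it onto v. The kernel is supported in W, so cutting off outside W is
invisible. -/
theorem hasDerivAt_mollify {U W : Set (SpaceTime d)}
    (hU : MeasurableSet U) (hWU : W ⊆ U) {s v : SpaceTime d → ℝ} (hs : Integrable (W.indicator s))
    (hsv : IsWeakTimeDeriv U s v) {δ : ℝ} (hδ : 0 < δ) {p : SpaceTime d} {t : ℝ}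
    (hp : Metric.closedBall (p + timeShift t) δ ⊆ W) :
    HasDerivAt (fun t => mollify δ (W.indicator s) (p + timeShift t))
      (mollify δ (W.indicator v) (p + timeShift t)) t := by
  set e : EuclideanSpace ℝ (Fin (d + 1)) := EuclideanSpace.single 0 1 with he
  have hφ := contDiff_mollifier_cover (d := d) δ
  obtain ⟨B, hB0, hB⟩ := exists_abs_dirDeriv_le hφ e (hasCompactSupport_mollifier hδ.le)
  have hshift : ∀ (t : ℝ) (q : SpaceTime d), p + timeShift t - q = p - q + cover (t • e) := by
    intro t q; rw [timeShift_eq_cover]; abel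
  have key := hasDerivAt_integral_of_dominated_loc_of_lip (μ := (volume : Measure (SpaceTime d)))
    (F := fun (t : ℝ) q => W.indicator s q * mollifier δ (p + timeShift t - q))
    (F' := fun q => W.indicator s q * dirDeriv e (mollifier δ) (p + timeShift t - q))
    (x₀ := t) (s := univ) (bound := fun q => ‖W.indicator s q‖ * B) univ_mem
    (Eventually.of_forall fun t => (integrable_mul_mollifier hδ hs _).aestronglyMeasurable)
    (integrable_mul_mollifier hδ hs _)
    (hs.aestronglyMeasurable.mul
      ((continuous_dirDeriv hφ e).comp (by fun_prop)).aestronglyMeasurable)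
    (ae_of_all _ fun q => by
      refine LipschitzOnWith.of_dist_le_mul fun a _ b _ => ?_
      simp only [hshift]
      rw [Real.dist_eq, Real.dist_eq, ← mul_sub, abs_mul, Real.coe_nnabs,
        abs_of_nonneg (by positivity : 0 ≤ ‖W.indicator s q‖ * B), mul_assoc]
      exact mul_le_mul_of_nonneg_left (abs_comp_add_cover_sub_le hφ e hB _ _ _) (abs_nonneg _))
    (hs.norm.mul_const B)
    (ae_of_all _ fun q => by
      simp only [hshift]
      exact (hasDerivAt_comp_add_cover hφ e (p - q) t).const_mul _)
  refine key.2.congr_deriv ?_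
  have htest := isTestFunction_mollifier_sub hδ (hp.trans hWU)
  have hI : ∀ (g : SpaceTime d → ℝ) (k : SpaceTime d → ℝ), (∀ q ∉ W, k q = 0) →
      ∫ q, W.indicator g q * k q = ∫ q in U, g q * k q := by
    intro g k hk
    rw [← integral_indicator hU]
    refine integral_congr_ae (ae_of_all _ fun q => ?_)
    by_cases hq : q ∈ W
    · simp [hq, hWU hq]
    · simp [indicator, hk q hq]
  have hz : ∀ q ∉ W, p + timeShift t - q ∉ Metric.ball 0 δ := by
    intro q hq hb
    refine hq (hp ?_)
    rw [Metric.mem_closedBall, dist_comm, dist_eq_norm]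
    exact (mem_ball_zero_iff.1 hb).le
  have hz1 : ∀ q ∉ W, mollifier δ (p + timeShift t - q) = 0 := fun q hq =>
    mollifier_eq_zero hδ.le (by simpa using hz q hq)
  have hsupp : tsupport (fun q => mollifier δ (p + timeShift t - q)) ⊆ W := by
    refine Subset.trans (closure_minimal (fun q hq => ?_) Metric.isClosed_closedBall) hp
    rw [Metric.mem_closedBall, dist_comm, dist_eq_norm]
    by_contra h
    exact hq (mollifier_eq_zero hδ.le (not_le.1 h).le)
  have hz2 : ∀ q ∉ W, timeDeriv (fun q => mollifier δ (p + timeShift t - q)) q = 0 := by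
    intro q hq
    rw [timeDeriv_eq_dirDeriv]
    exact dirDeriv_eq_zero_of_notMem_tsupport _ fun h => hq (hsupp h)
  have h1 := hsv.integral_eq _ htest
  rw [mollify, hI v _ hz1]
  rw [← neg_eq_iff_eq_neg] at h1
  rw [← h1, ← hI s _ hz2, ← integral_neg]
  refine integral_congr_ae (ae_of_all _ fun q => ?_)
  simp only
  rw [timeDeriv_comp_sub hφ]
  ring

/-- Along time lines the mollified field is differentiable and φ(S) has derivative (r² - S²)V. The
fundamental theorem of calculus and Tonelli reduce the error to integrals over shifts of K, all
inside K'. -/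
theorem translationError_mollify_le {U W K K' : Set (SpaceTime d)}
    (hU : MeasurableSet U) (hWU : W ⊆ U) (hK : MeasurableSet K) (hK' : MeasurableSet K')
    {s v : SpaceTime d → ℝ} (hs : Integrable (W.indicator s)) (hv : Integrable (W.indicator v))
    (hsv : IsWeakTimeDeriv U s v) {δ : ℝ} (hδ : 0 < δ) {h : ℝ}
    (hKK' : ∀ t, |t| ≤ |h| → ∀ p ∈ K, p - timeShift t ∈ K')
    (hK'W : ∀ p ∈ K', Metric.closedBall p δ ⊆ W) (r : ℝ) :
    translationError K (fun p => wellPrimitive r (mollify δ (W.indicator s) p)) (timeShift h) ≤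
      ENNReal.ofReal |h| * ∫⁻ p in K',
        ‖(r ^ 2 - mollify δ (W.indicator s) p ^ 2) * mollify δ (W.indicator v) p‖ₑ := by
  set S := mollify δ (W.indicator s) with hS
  set V := mollify δ (W.indicator v) with hV
  have hSc : Continuous S := continuous_mollify hδ hs
  have hVc : Continuous V := continuous_mollify hδ hv
  set g : SpaceTime d → ℝ := fun p => (r ^ 2 - S p ^ 2) * V p with hg
  have hgc : Continuous g := by fun_prop
  have hneg : ∀ t : ℝ, (timeShift (-t) : SpaceTime d) = -timeShift t := by
    intro t; simp [timeShift]
  have hpt : ∀ p ∈ K, ‖wellPrimitive r (S (p - timeShift h)) - wellPrimitive r (S p)‖ₑ ≤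
      ∫⁻ t in uIoc 0 h, ‖g (p - timeShift t)‖ₑ := by
    intro p hp
    have hder : ∀ t ∈ uIcc 0 h, HasDerivAt (fun t => wellPrimitive r (S (p - timeShift t)))
        (-g (p - timeShift t)) t := by
      intro t ht
      have ht' : |t| ≤ |h| := by
        simpa using abs_sub_left_of_mem_uIcc ht
      have h1 : HasDerivAt (fun t => S (p + timeShift t)) (V (p + timeShift (-t))) (-t) := by
        refine hasDerivAt_mollify hU hWU hs hsv hδ ?_
        rw [hneg, ← sub_eq_add_neg]
        exact hK'W _ (hKK' t ht' p hp)
      have h2 := h1.comp t (hasDerivAt_neg t)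
      have h3 := (hasDerivAt_wellPrimitive r (S (p + timeShift (-t)))).comp t h2
      simp only [Function.comp_def, hneg, ← sub_eq_add_neg] at h3
      refine h3.congr_deriv ?_
      simp only [hg]; ring
    have hcont : Continuous fun t => g (p - timeShift t) :=
      hgc.comp (continuous_const.sub continuous_timeShift)
    have hFTC := intervalIntegral.integral_eq_sub_of_hasDerivAt hder
      (hcont.neg.intervalIntegrable _ _)
    have h0 : (timeShift 0 : SpaceTime d) = 0 := rfl
    rw [h0, sub_zero] at hFTC
    rw [← hFTC, ← ofReal_norm, intervalIntegral.norm_intervalIntegral_eq, ofReal_norm]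
    refine (enorm_integral_le_lintegral_enorm _).trans (le_of_eq ?_)
    simp
  have hm : Measurable fun x : SpaceTime d × ℝ => ‖g (x.1 - timeShift x.2)‖ₑ :=
    (hgc.comp (continuous_fst.sub (continuous_timeShift.comp continuous_snd))).measurable.enorm
  calc translationError K (fun p => wellPrimitive r (S p)) (timeShift h)
      ≤ ∫⁻ p in K, ∫⁻ t in uIoc 0 h, ‖g (p - timeShift t)‖ₑ := setLIntegral_mono' hK hpt
    _ = ∫⁻ t in uIoc 0 h, ∫⁻ p in K, ‖g (p - timeShift t)‖ₑ :=
        lintegral_lintegral_swap hm.aemeasurable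
    _ ≤ ∫⁻ t in uIoc 0 h, ∫⁻ p in K', ‖g p‖ₑ := by
        refine setLIntegral_mono' measurableSet_uIoc fun t ht => ?_
        refine setLIntegral_sub_le hK hK' (fun p hp => hKK' t ?_ p hp) fun p => ‖g p‖ₑ
        simpa using abs_sub_left_of_mem_uIcc (uIoc_subset_uIcc ht)
    _ = _ := by
        rw [lintegral_const, Measure.restrict_apply_univ, mul_comm, Real.volume_uIoc, sub_zero]

theorem tendsto_lintegral_mollify_sub {f : SpaceTime d → ℝ} (hf : Integrable f)
    (hfm : Measurable f) {δ : ℕ → ℝ} (hδ : ∀ n, 0 < δ n) (hδ0 : Tendsto δ atTop (𝓝 0)) :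
    Tendsto (fun n => ∫⁻ p, ‖mollify (δ n) f p - f p‖ₑ) atTop (𝓝 0) := by
  rw [ENNReal.tendsto_nhds_zero]
  intro η hη
  have h := ENNReal.tendsto_nhds_zero.1 (tendsto_translationError_univ hf) η hη
  obtain ⟨ε, hε, hball⟩ := Metric.eventually_nhds_iff.1 h
  filter_upwards [hδ0.eventually (gt_mem_nhds hε)] with n hn
  have := lintegral_mollify_sub_le (hδ n) hf hfm (K := univ) (η := η) fun h hh =>
    hball (by simpa using hh.trans_lt hn)
  rwa [setLIntegral_univ] at this

theorem mollify_congr_ae {f g : SpaceTime d → ℝ} (h : f =ᵐ[volume] g) (δ : ℝ) :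
    mollify δ f = mollify δ g := by
  ext p
  refine integral_congr_ae ?_
  filter_upwards [h] with q hq
  rw [hq]

/-- The chain rule is available only for mollified fields, so the radius is sent to zero. On the
right the velocities converge in L¹ and the bounded weights almost everywhere along a subsequence;
on the left Fatou's lemma suffices. -/
theorem time_translation_bound {U K : Set (SpaceTime d)} (hU : MeasurableSet U) {r : ℝ}
    (hr1 : r ≤ 1) {s v : SpaceTime d → ℝ} (hsm : Measurable s)
    (hs : ∀ p, s p ∈ Icc (-r) r) (hsv : IsWeakTimeDeriv U s v) {C : ℝ≥0∞}
    (hC : ∫⁻ p in U, ENNReal.ofReal ((r ^ 2 - s p ^ 2) * |v p|) ≤ C) {δ : ℝ} (hδ : 0 < δ)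
    (hK : IsCompact K) (hKU : Metric.cthickening (2 * δ) K ⊆ U) {h : ℝ} (hh : |h| ≤ δ) :
    translationError K (fun p => wellPrimitive r (s p)) (timeShift h) ≤ C * ENNReal.ofReal |h| := by
  set W := Metric.cthickening (2 * δ) K with hWdef
  set K' := Metric.cthickening δ K with hK'def
  have hWc : IsCompact W := hK.cthickening
  have hW : MeasurableSet W := hWc.measurableSet
  have hK'm : MeasurableSet K' := Metric.isClosed_cthickening.measurableSet
  have hsb : ∀ p, |s p| ≤ r := fun p => abs_le.2 (hs p)
  have hr0 : 0 ≤ r := (abs_nonneg _).trans (hsb 0)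
  have hK'ball : ∀ p ∈ K', ∀ ε ≤ δ, Metric.closedBall p ε ⊆ W := by
    intro p hp ε hε q hq
    have : q ∈ Metric.cthickening δ K' :=
      Metric.mem_cthickening_of_dist_le q p δ K' hp ((Metric.mem_closedBall.1 hq).trans hε)
    rw [hWdef, two_mul]
    exact Metric.cthickening_cthickening_subset hδ.le hδ.le K this
  have hK'W : K' ⊆ W := fun p hp => hK'ball p hp δ le_rfl (Metric.mem_closedBall_self hδ.le)
  have hKK' : ∀ t, |t| ≤ δ → ∀ p ∈ K, p - timeShift t ∈ K' := by
    intro t ht p hp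
    refine Metric.mem_cthickening_of_dist_le _ p δ K hp ?_
    rw [dist_eq_norm, sub_sub_cancel_left, norm_neg, norm_timeShift]; exact ht
  set f := W.indicator s with hf
  have hfm : Measurable f := hsm.indicator hW
  have hfi : Integrable f := by
    refine (integrable_indicator_iff hW).2 ?_
    refine Measure.integrableOn_of_bounded (M := r) hWc.measure_lt_top.ne hsm.aestronglyMeasurable ?_
    exact ae_of_all _ fun p => hsb p
  have hfb : ∀ p, |f p| ≤ r := by
    intro p
    by_cases hp : p ∈ W
    · simpa [hf, hp] using hsb p
    · simpa [hf, hp] using hr0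
  have hgi : Integrable (W.indicator v) := (integrable_indicator_iff hW).2
    (hsv.locallyIntegrableOn_deriv.integrableOn_compact_subset hKU hWc)
  set g := hgi.aestronglyMeasurable.mk (W.indicator v) with hg
  have hgm : Measurable g := hgi.aestronglyMeasurable.stronglyMeasurable_mk.measurable
  have hvg : W.indicator v =ᵐ[volume] g := hgi.aestronglyMeasurable.ae_eq_mk
  have hgi' : Integrable g := hgi.congr hvg
  -- a sequence of radii along which the mollified functions converge almost everywhere
  set ε : ℕ → ℝ := fun n => δ / (n + 1) with hεdef
  have hε : ∀ n, 0 < ε n := fun n => by positivity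
  have hεδ : ∀ n, ε n ≤ δ := fun n => div_le_self hδ.le (by simp)
  have hε0 : Tendsto ε atTop (𝓝 0) := tendsto_const_div_atTop_nhds_zero_nat δ |>.comp
    (tendsto_add_atTop_nat 1) |>.congr fun n => by simp [hεdef]
  have hlim := tendsto_lintegral_mollify_sub hfi hfm hε hε0
  have hmeas : TendstoInMeasure volume (fun n => mollify (ε n) f) atTop f := by
    refine tendstoInMeasure_of_tendsto_eLpNorm one_ne_zero
      (fun n => (continuous_mollify (hε n) hfi).aestronglyMeasurable) hfm.aestronglyMeasurable ?_
    simpa only [eLpNorm_one_eq_lintegral_enorm, Pi.sub_apply] using hlim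
  obtain ⟨ns, hns, hae⟩ := hmeas.exists_seq_tendsto_ae
  set S : ℕ → SpaceTime d → ℝ := fun n => mollify (ε (ns n)) f with hS
  set V : ℕ → SpaceTime d → ℝ := fun n => mollify (ε (ns n)) g with hV
  have hSc : ∀ n, Continuous (S n) := fun n => continuous_mollify (hε _) hfi
  have hVc : ∀ n, Continuous (V n) := fun n => continuous_mollify (hε _) hgi'
  have hSb : ∀ n p, |S n p| ≤ r := fun n p => abs_mollify_le (hε _) hfi hfb p
  have hVlim : Tendsto (fun n => ∫⁻ p, ‖V n p - g p‖ₑ) atTop (𝓝 0) :=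
    (tendsto_lintegral_mollify_sub hgi' hgm hε hε0).comp hns.tendsto_atTop
  have hb1 : ∀ x : ℝ, |x| ≤ r → |r ^ 2 - x ^ 2| ≤ 1 := by
    intro x hx
    have h1 : x ^ 2 ≤ r ^ 2 := by rw [← sq_abs]; gcongr
    rw [abs_of_nonneg (by linarith)]
    nlinarith [sq_nonneg x]
  have hbe : ∀ x : ℝ, |x| ≤ r → ‖r ^ 2 - x ^ 2‖ₑ ≤ 1 := by
    intro x hx
    rw [← ofReal_norm, ← ENNReal.ofReal_one]
    exact ENNReal.ofReal_le_ofReal (hb1 x hx)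
  -- The weight is at most 1, so replacing the mollified velocity by `g` costs only its L¹ error.
  have hstep : ∀ n, translationError K (fun p => wellPrimitive r (S n p)) (timeShift h) ≤
      ENNReal.ofReal |h| * ((∫⁻ p, ‖V n p - g p‖ₑ) +
        ∫⁻ p in K', ‖(r ^ 2 - S n p ^ 2) * g p‖ₑ) := by
    intro n
    refine (translationError_mollify_le hU hKU hK.measurableSet hK'm hfi hgi hsv (hε (ns n))
      (fun t ht => hKK' t (ht.trans hh)) (fun p hp => hK'ball p hp _ (hεδ _)) r).trans ?_
    rw [mollify_congr_ae hvg]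
    refine mul_le_mul' le_rfl ?_
    calc ∫⁻ p in K', ‖(r ^ 2 - S n p ^ 2) * V n p‖ₑ
        ≤ ∫⁻ p in K', (‖V n p - g p‖ₑ + ‖(r ^ 2 - S n p ^ 2) * g p‖ₑ) := by
          refine lintegral_mono fun p => ?_
          have : (r ^ 2 - S n p ^ 2) * V n p =
            (r ^ 2 - S n p ^ 2) * (V n p - g p) + (r ^ 2 - S n p ^ 2) * g p := by ring
          rw [this]
          refine (enorm_add_le _ _).trans (add_le_add ?_ le_rfl)
          rw [enorm_mul]
          exact mul_le_of_le_one_left' (hbe _ (hSb n p))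
      _ = (∫⁻ p in K', ‖V n p - g p‖ₑ) + ∫⁻ p in K', ‖(r ^ 2 - S n p ^ 2) * g p‖ₑ :=
          lintegral_add_left ((hVc n).measurable.sub hgm).enorm _
      _ ≤ _ := by gcongr; exact Measure.restrict_le_self
  have hZ : Tendsto (fun n => ∫⁻ p in K', ‖(r ^ 2 - S n p ^ 2) * g p‖ₑ) atTop
      (𝓝 (∫⁻ p in K', ‖(r ^ 2 - f p ^ 2) * g p‖ₑ)) := by
    refine tendsto_lintegral_of_dominated_convergence (fun p => ‖g p‖ₑ) (fun n => ?_) (fun n => ?_)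
      ?_ ?_
    · have := (hSc n).measurable
      fun_prop
    · refine ae_of_all _ fun p => ?_
      simp only [enorm_mul]
      exact mul_le_of_le_one_left' (hbe _ (hSb n p))
    · exact (hgi'.restrict.hasFiniteIntegral).ne
    · refine ae_restrict_of_ae ?_
      filter_upwards [hae] with p hp
      exact (((continuous_const.sub (continuous_id.pow 2)).mul continuous_const).tendsto
        (f p)).comp hp |>.enorm
  have hZle : ∫⁻ p in K', ‖(r ^ 2 - f p ^ 2) * g p‖ₑ ≤ C := by
    refine le_trans ?_ hC
    refine le_trans ?_ (lintegral_mono_set (hK'W.trans hKU))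
    refine lintegral_mono_ae ?_
    filter_upwards [ae_restrict_of_ae hvg, ae_restrict_mem hK'm] with p hp hpK
    rw [← hp, hf, indicator_of_mem (hK'W hpK), indicator_of_mem (hK'W hpK), ← ofReal_norm,
      norm_mul, Real.norm_of_nonneg (sub_nonneg.2 (sq_le_of_mem_Icc (hs p)))]
    exact le_rfl
  have hfatou : translationError K (fun p => wellPrimitive r (s p)) (timeShift h) ≤
      liminf (fun n => translationError K (fun p => wellPrimitive r (S n p)) (timeShift h))
        atTop := by
    have hae2 : ∀ᵐ p ∂(volume : Measure (SpaceTime d)),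
        Tendsto (fun n => S n (p - timeShift h)) atTop (𝓝 (f (p - timeShift h))) :=
      (measurePreserving_sub_right volume (timeShift h)).quasiMeasurePreserving.ae hae
    refine le_trans (le_of_eq ?_) (lintegral_liminf_le (fun n => ?_))
    · refine lintegral_congr_ae ?_
      filter_upwards [ae_restrict_of_ae hae, ae_restrict_of_ae hae2,
        ae_restrict_mem hK.measurableSet] with p h1 h2 hpK
      have hpW : p ∈ W := hK'W (Metric.self_subset_cthickening K hpK)
      have hpW' : p - timeShift h ∈ W := hK'W (hKK' h hh p hpK)
      have e1 : f p = s p := indicator_of_mem hpW s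
      have e2 : f (p - timeShift h) = s (p - timeShift h) := indicator_of_mem hpW' s
      rw [e1] at h1; rw [e2] at h2
      have hc := continuous_wellPrimitive r
      exact (((hc.tendsto _).comp h2).sub ((hc.tendsto _).comp h1)).enorm.liminf_eq.symm
    · have hc := continuous_wellPrimitive r
      have h1 : Continuous fun p => wellPrimitive r (S n p) := hc.comp (hSc n)
      have h2 : Continuous fun p => wellPrimitive r (S n (p - timeShift h)) :=
        h1.comp (by fun_prop)
      exact (h2.sub h1).measurable.enorm
  have hT : Tendsto (fun n => ENNReal.ofReal |h| * ((∫⁻ p, ‖V n p - g p‖ₑ) +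
        ∫⁻ p in K', ‖(r ^ 2 - S n p ^ 2) * g p‖ₑ)) atTop
      (𝓝 (ENNReal.ofReal |h| * (0 + ∫⁻ p in K', ‖(r ^ 2 - f p ^ 2) * g p‖ₑ))) :=
    ENNReal.Tendsto.const_mul (hVlim.add hZ) (Or.inr ENNReal.ofReal_ne_top)
  calc _ ≤ _ := hfatou
    _ ≤ liminf (fun n => ENNReal.ofReal |h| * ((∫⁻ p, ‖V n p - g p‖ₑ) +
        ∫⁻ p in K', ‖(r ^ 2 - S n p ^ 2) * g p‖ₑ)) atTop :=
        liminf_le_liminf (Eventually.of_forall hstep)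
    _ = ENNReal.ofReal |h| * (0 + ∫⁻ p in K', ‖(r ^ 2 - f p ^ 2) * g p‖ₑ) := hT.liminf_eq
    _ ≤ C * ENNReal.ofReal |h| := by rw [zero_add, mul_comm]; gcongr

/-! ### Translation estimates from energy bounds -/

theorem exists_toTorus_eq (z : UnitAddTorus (Fin d)) :
    ∃ x : EuclideanSpace ℝ (Fin d), toTorus x = z ∧ ‖x‖ ≤ (d + 1) * ‖z‖ := by
  have h : ∀ i, ∃ x : ℝ, (x : UnitAddCircle) = z i ∧ |x| ≤ ‖z‖ := by
    intro i
    obtain ⟨y, hy⟩ := QuotientAddGroup.mk_surjective (z i)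
    refine ⟨y - round y, ?_, ?_⟩
    · rw [← hy, AddCircle.coe_sub]
      exact sub_eq_self.2 ((AddCircle.coe_eq_zero_iff (1 : ℝ)).2 ⟨round y, by simp⟩)
    · refine le_trans (le_of_eq ?_) (norm_le_pi_norm z i)
      rw [← hy]
      change _ = ‖((y : ℝ) : UnitAddCircle)‖
      rw [AddCircle.norm_eq]; simp
  choose x hx hxn using h
  refine ⟨WithLp.toLp 2 x, funext hx, ?_⟩
  rw [EuclideanSpace.norm_eq]
  refine Real.sqrt_le_iff.2 ⟨by positivity, ?_⟩
  have h1 : ∑ i, ‖x i‖ ^ 2 ≤ ∑ _i : Fin d, ‖z‖ ^ 2 :=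
    Finset.sum_le_sum fun i _ => by
      rw [Real.norm_eq_abs]; exact pow_le_pow_left₀ (abs_nonneg _) (hxn i) 2
  refine h1.trans ?_
  simp only [Finset.sum_const, Finset.card_univ, Fintype.card_fin, nsmul_eq_mul, mul_pow]
  gcongr
  nlinarith [(Nat.cast_nonneg d : (0 : ℝ) ≤ d)]

theorem mem_centeredCube {x : EuclideanSpace ℝ (Fin d)} (hx : ‖x‖ < 1 / 2) :
    x ∈ centeredCube d := fun i => by
  have h := abs_lt.1 (((PiLp.norm_apply_le x i).trans_lt hx : |x i| < 1 / 2))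
  exact ⟨h.1, h.2.le⟩

theorem eventually_norm_smul_le {A : Set (EuclideanSpace ℝ (Fin d))} (hA : IsCompact A)
    {lam : ℕ → ℝ} (hlam : Tendsto lam atTop (𝓝 0)) {η : ℝ} (hη : 0 < η) :
    ∀ᶠ n in atTop, ∀ y ∈ A, ‖lam n • y‖ ≤ η := by
  obtain ⟨R, hR0, hR⟩ := hA.isBounded.exists_pos_norm_le
  have : Tendsto (fun n => |lam n| * R) atTop (𝓝 0) := by
    simpa using (hlam.abs.mul_const R)
  filter_upwards [this.eventually (gt_mem_nhds hη)] with n hn y hy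
  rw [norm_smul, Real.norm_eq_abs]
  exact (mul_le_mul_of_nonneg_left (hR y hy) (abs_nonneg _)).trans hn.le

/-- A general shift splits into a time shift and a spatial shift by a short representative x of the
torus component. The space and time estimates add up on slightly enlarged sets. -/
theorem exists_translation_bound {J : EuclideanSpace ℝ (Fin d) → ℝ}
    (hJ_nonneg : ∀ x, 0 ≤ J x) (hJ_int : Integrable J) {β : ℝ} (hβ : 1 < β * ∫ x, J x)
    {Ω : Set (SpaceTime d)} (hΩ : MeasurableSet Ω) (hnull : volume (Ω \ interior Ω) = 0)
    {lam : ℕ → ℝ} (hlam_pos : ∀ n, 0 < lam n) (hlam : Tendsto lam atTop (𝓝 0))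
    {s : ℕ → SpaceTime d → ℝ} (hsm : ∀ n, Measurable (s n))
    (hs : ∀ n, ∀ᵐ p ∂(volume.restrict Ω),
      s n p ∈ Icc (-equilibrium β (∫ x, J x)) (equilibrium β (∫ x, J x)))
    {M : ℝ≥0} (hG : ∀ n, energy J β (lam n) (s n) Ω ≤ M) :
    ∃ C : ℝ≥0∞, C ≠ ∞ ∧
      (∀ᶠ n in atTop, ∫⁻ p in Ω, ENNReal.ofReal ((equilibrium β (∫ x, J x) ^ 2 -
          clamp (equilibrium β (∫ x, J x)) (s n p) ^ 2) ^ 2) ≤ C * ENNReal.ofReal (lam n)) ∧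
      ∀ K : Set (SpaceTime d), IsCompact K → K ⊆ interior Ω → ∃ δ > 0, ∀ᶠ n in atTop,
        ∀ h : SpaceTime d, ‖h‖ ≤ δ → translationError K
          (fun p => wellPrimitive (equilibrium β (∫ x, J x))
            (clamp (equilibrium β (∫ x, J x)) (s n p))) h ≤ C * ENNReal.ofReal (‖h‖ + lam n) := by
  have hJpos : 0 < ∫ x, J x := by
    refine (integral_nonneg hJ_nonneg).lt_of_ne' fun h => ?_
    rw [h, mul_zero] at hβ; linarith
  obtain ⟨A, j, hA, hj, hA0, hJA⟩ := exists_isCompact_forall_le hJ_nonneg hJ_int hJpos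
  obtain ⟨C, hC, hbounds⟩ := exists_energy_bounds hJpos hβ hA hj hJA M
  obtain ⟨C₀, hC₀, hspace⟩ := exists_space_translation_bound hA hA0
  set r := equilibrium β (∫ x, J x) with hr
  have hr0 : 0 < r := equilibrium_pos hβ
  have hr1 : r < 1 := equilibrium_lt_one hβ
  have hcube : ∀ᶠ n in atTop, ∀ y ∈ A, lam n • y ∈ centeredCube d := by
    filter_upwards [eventually_norm_smul_le hA hlam (show (0 : ℝ) < 1 / 3 by norm_num)]
      with n hn y hy
    exact mem_centeredCube ((hn y hy).trans_lt (by norm_num))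
  have hσm : ∀ n, Measurable fun p => clamp r (s n p) := fun n =>
    (continuous_clamp r).measurable.comp (hsm n)
  have hum : ∀ n, Measurable fun p => wellPrimitive r (clamp r (s n p)) := fun n =>
    (continuous_wellPrimitive r).measurable.comp (hσm n)
  have hrestr : volume.restrict (interior Ω) ≤ volume.restrict Ω :=
    Measure.restrict_mono interior_subset le_rfl
  refine ⟨C + C₀ * C * ENNReal.ofReal (d + 1), by finiteness, ?_, fun K hK hKU => ?_⟩
  · filter_upwards [hcube] with n hn
    obtain ⟨v, -, -, h2, -⟩ := hbounds Ω hΩ hnull (lam n) (hlam_pos n) hn (s n) (hsm n) (hs n) (hG n)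
    exact h2.trans (mul_le_mul' le_self_add le_rfl)
  obtain ⟨δ₀, hδ₀, hsub⟩ := hK.exists_cthickening_subset_open isOpen_interior hKU
  -- One δ is spent on the spatial shift and two more on the thickening that the time estimate
  -- requires. The later division by d + 1 compensates for the Euclidean norm of x.
  set δ := δ₀ / 3 with hδ
  have hδ0 : 0 < δ := by positivity
  refine ⟨δ / (d + 1), by positivity, ?_⟩
  filter_upwards [hcube, eventually_norm_smul_le hA hlam (half_pos hδ0)] with n hn hn2 h hh
  obtain ⟨v, hv, h1, -, h3⟩ := hbounds Ω hΩ hnull (lam n) (hlam_pos n) hn (s n) (hsm n) (hs n) (hG n)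
  obtain ⟨x, hx, hxn⟩ := exists_toTorus_eq h.2
  have hh1 : |h.1| ≤ ‖h‖ := norm_fst_le h
  have hh2 : ‖h.2‖ ≤ ‖h‖ := norm_snd_le h
  have hd : (1 : ℝ) ≤ d + 1 := by simp
  have hhδ : (d + 1) * ‖h‖ ≤ δ := by
    rw [le_div_iff₀ (by positivity)] at hh; linarith
  have hxh : ‖x‖ ≤ (d + 1) * ‖h‖ := hxn.trans (by gcongr)
  have hhle : ‖h‖ ≤ (d + 1) * ‖h‖ := le_mul_of_one_le_left (norm_nonneg _) hd
  have heq : h = timeShift h.1 + spaceShift x := by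
    ext1
    · simp [timeShift, spaceShift]
    · simp [timeShift, spaceShift, hx]
  set K' := Metric.cthickening δ K with hK'
  have hK'm : MeasurableSet K' := Metric.isClosed_cthickening.measurableSet
  have hK'U : Metric.cthickening (2 * δ) K' ⊆ interior Ω := by
    refine (Metric.cthickening_cthickening_subset (by positivity) hδ0.le K).trans ?_
    rw [show 2 * δ + δ = δ₀ by rw [hδ]; ring]
    exact hsub
  have hKΩ : Metric.cthickening (2 * δ) K ⊆ Ω :=
    (Metric.cthickening_mono (by rw [hδ]; linarith) K).trans (hsub.trans interior_subset)
  have htime := time_translation_bound (K := K') isOpen_interior.measurableSet hr1.le (hσm n)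
    (fun p => clamp_mem hr0.le _) hv (le_trans (lintegral_mono' hrestr le_rfl) h1) hδ0
    hK.cthickening hK'U (h := h.1) (by linarith)
  have hsp := hspace Ω (fun p => wellPrimitive r (clamp r (s n p))) C (lam n) hΩ (hum n)
    (hlam_pos n) h3 K δ hδ0 hK.isClosed hKΩ hn2 x (by linarith)
  have hadd := translationError_add_le hK.measurableSet hK'm (hum n) (a := timeShift h.1)
    (b := spaceShift x) fun p hp => Metric.mem_cthickening_of_dist_le _ p δ K hp (by
      rw [dist_eq_norm, sub_sub_cancel_left, norm_neg]
      exact (norm_spaceShift_le x).trans (by linarith))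
  rw [← heq] at hadd
  refine hadd.trans ?_
  rw [add_mul]
  refine add_le_add (htime.trans ?_) (hsp.trans ?_)
  · refine mul_le_mul' le_rfl (ENNReal.ofReal_le_ofReal ?_)
    linarith [hlam_pos n]
  · rw [mul_assoc (C₀ * C), ← ENNReal.ofReal_mul (by positivity)]
    refine mul_le_mul' le_rfl (ENNReal.ofReal_le_ofReal ?_)
    nlinarith [hlam_pos n]

/-! ### Bounded variation from translation estimates -/

/-- The directional derivative is a limit of difference quotients. A change of variables moves the
difference from φ to f, where it is a translation error of order |t|; dominated convergence
concludes. -/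
theorem abs_integral_mul_dirDeriv_le {U : Set (SpaceTime d)} (hU : IsOpen U)
    {f : SpaceTime d → ℝ} (hf : IntegrableOn f U) {C : ℝ≥0}
    (hC : ∀ K : Set (SpaceTime d), IsCompact K → K ⊆ U → ∃ δ > 0, ∀ h : SpaceTime d, ‖h‖ ≤ δ →
      translationError K f h ≤ C * ENNReal.ofReal ‖h‖)
    {φ : SpaceTime d → ℝ} (hφ : IsTestFunction U φ) (hφ1 : ∀ p, |φ p| ≤ 1)
    {e : EuclideanSpace ℝ (Fin (d + 1))} (he : ∀ t : ℝ, ‖(cover (t • e) : SpaceTime d)‖ ≤ |t|) :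
    |∫ p in U, f p * dirDeriv e φ p| ≤ C := by
  set K := tsupport φ with hK
  have hKc : IsCompact K := hφ.hasCompactSupport
  obtain ⟨δ, hδ, hT⟩ := hC K hKc hφ.tsupport_subset
  obtain ⟨δ', hδ', hsub⟩ := hKc.exists_cthickening_subset_open hU hφ.tsupport_subset
  obtain ⟨B, hB0, hB⟩ := exists_abs_dirDeriv_le hφ.contDiff e hφ.hasCompactSupport
  set F := U.indicator f with hF
  have hFi : Integrable F := (integrable_indicator_iff hU.measurableSet).2 hf
  have hφc : Continuous φ := hφ.continuous
  have hφi : ∀ {g : SpaceTime d → ℝ}, Integrable g → ∀ h : SpaceTime d,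
      Integrable fun p => g p * φ (p + h) := fun hg h =>
    hg.mul_bdd (c := 1) (hφc.comp (by fun_prop)).aestronglyMeasurable (ae_of_all _ fun p => hφ1 _)
  have hcov0 : ∀ p : SpaceTime d, p + cover ((0 : ℝ) • e) = p := by
    intro p
    have : ‖(cover ((0 : ℝ) • e) : SpaceTime d)‖ ≤ 0 := by simpa using he 0
    rw [norm_le_zero_iff.1 this, add_zero]
  have hquot : ∀ t : ℝ, t ≠ 0 → |t| ≤ min δ δ' →
      |∫ p, F p * (t⁻¹ * (φ (p + cover (t • e)) - φ p))| ≤ C := by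
    intro t ht htδ
    set h : SpaceTime d := cover (t • e) with hh
    have hhn : ‖h‖ ≤ |t| := he t
    have hi0 : Integrable fun p => F p * φ p := by simpa using hφi hFi 0
    have hi2 : Integrable fun p => F (p - h) * φ p := by
      simpa using hφi (hFi.comp_sub_right h) 0
    have e1 : ∫ p, F p * (t⁻¹ * (φ (p + h) - φ p)) =
        t⁻¹ * ∫ p, (F (p - h) - F p) * φ p := by
      have e2 : ∫ p, F p * φ (p + h) = ∫ p, F (p - h) * φ p := by
        rw [← integral_sub_right_eq_self _ h]; simp
      have e3 : ∫ p, (F (p - h) - F p) * φ p =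
          (∫ p, F p * φ (p + h)) - ∫ p, F p * φ p := by
        rw [e2, ← integral_sub hi2 hi0]; simp only [sub_mul]
      rw [e3, ← integral_sub (hφi hFi h) hi0, ← integral_const_mul]
      congr 1; ext p; ring
    rw [e1, abs_mul, abs_inv, inv_mul_le_iff₀ (abs_pos.2 ht)]
    have hint : ‖∫ p, (F (p - h) - F p) * φ p‖ₑ ≤ ENNReal.ofReal (|t| * C) := by
      calc ‖∫ p, (F (p - h) - F p) * φ p‖ₑ
          ≤ ∫⁻ p, ‖(F (p - h) - F p) * φ p‖ₑ := enorm_integral_le_lintegral_enorm _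
        _ ≤ ∫⁻ p, K.indicator (fun p => ‖f (p - h) - f p‖ₑ) p := by
            refine lintegral_mono fun p => ?_
            by_cases hp : p ∈ K
            · have hp1 : p ∈ U := hφ.tsupport_subset hp
              have hp2 : p - h ∈ U := hsub (Metric.mem_cthickening_of_dist_le _ p δ' K hp (by
                rw [dist_eq_norm, sub_sub_cancel_left, norm_neg]
                exact (hhn.trans htδ).trans (min_le_right _ _)))
              rw [indicator_of_mem hp, hF, indicator_of_mem hp1, indicator_of_mem hp2, enorm_mul]
              refine mul_le_of_le_one_right' ?_
              rw [← ofReal_norm, ← ENNReal.ofReal_one]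
              exact ENNReal.ofReal_le_ofReal (hφ1 p)
            · rw [image_eq_zero_of_notMem_tsupport hp]; simp
        _ = translationError K f h := lintegral_indicator hKc.measurableSet _
        _ ≤ C * ENNReal.ofReal ‖h‖ := hT h ((hhn.trans htδ).trans (min_le_left _ _))
        _ ≤ C * ENNReal.ofReal |t| := by gcongr
        _ = ENNReal.ofReal (|t| * C) := by
            rw [ENNReal.ofReal_mul (abs_nonneg _), ENNReal.ofReal_coe_nnreal, mul_comm]
    rw [← ofReal_norm, Real.norm_eq_abs, ENNReal.ofReal_le_ofReal_iff (by positivity)] at hint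
    exact hint
  have hlim : Tendsto (fun t : ℝ => ∫ p, F p * (t⁻¹ * (φ (p + cover (t • e)) - φ p))) (𝓝[≠] 0)
      (𝓝 (∫ p, F p * dirDeriv e φ p)) := by
    refine tendsto_integral_filter_of_dominated_convergence (fun p => ‖F p‖ * B) ?_ ?_
      (hFi.norm.mul_const B) ?_
    · refine Eventually.of_forall fun t => hFi.aestronglyMeasurable.mul ?_
      exact (continuous_const.mul ((hφc.comp (by fun_prop)).sub hφc)).aestronglyMeasurable
    · refine eventually_nhdsWithin_of_forall fun t ht => ae_of_all _ fun p => ?_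
      rw [norm_mul]
      refine mul_le_mul_of_nonneg_left ?_ (norm_nonneg _)
      have h1 := abs_comp_add_cover_sub_le hφ.contDiff e hB p t 0
      rw [hcov0, sub_zero] at h1
      rw [norm_mul, norm_inv, Real.norm_eq_abs, Real.norm_eq_abs,
        inv_mul_le_iff₀ (abs_pos.2 ht)]
      linarith
    · refine ae_of_all _ fun p => Tendsto.const_mul _ ?_
      have h1 := (hasDerivAt_comp_add_cover hφ.contDiff e p 0).tendsto_slope_zero
      simp only [zero_add, smul_eq_mul, hcov0] at h1
      exact h1
  have hev : ∀ᶠ t : ℝ in 𝓝[≠] 0, |∫ p, F p * (t⁻¹ * (φ (p + cover (t • e)) - φ p))| ≤ C := by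
    have hsmall : ∀ᶠ t : ℝ in 𝓝[≠] 0, |t| < min δ δ' :=
      nhdsWithin_le_nhds ((continuous_abs.tendsto' (0 : ℝ) 0 abs_zero).eventually
        (gt_mem_nhds (lt_min hδ hδ')))
    filter_upwards [hsmall, self_mem_nhdsWithin] with t h1 h2 using hquot t h2 h1.le
  have hfin := le_of_tendsto hlim.abs hev
  rw [← integral_indicator hU.measurableSet]
  refine le_trans (le_of_eq ?_) hfin
  congr 2
  ext p
  by_cases hp : p ∈ U <;> simp [hF, hp]

theorem MemBV.of_translationError_le {U : Set (SpaceTime d)} (hU : IsOpen U)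
    {f : SpaceTime d → ℝ} (hf : IntegrableOn f U) {C : ℝ≥0}
    (hC : ∀ K : Set (SpaceTime d), IsCompact K → K ⊆ U → ∃ δ > 0, ∀ h : SpaceTime d, ‖h‖ ≤ δ →
      translationError K f h ≤ C * ENNReal.ofReal ‖h‖) : MemBV U f := by
  refine ⟨hf, (d + 1) * C, fun X hX hX1 => ?_⟩
  have htest : ∀ j, IsTestFunction U fun q => X q j := by
    intro j
    have hsupp : Function.support (fun q => X q j) ⊆ Function.support X := by
      intro q hq hq0
      exact hq (by simp [hq0])
    refine ⟨?_, hX.hasCompactSupport.mono hsupp, (closure_mono hsupp).trans hX.tsupport_subset⟩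
    exact (EuclideanSpace.proj (𝕜 := ℝ) j).contDiff.comp hX.contDiff
  have hb : ∀ j p, |X p j| ≤ 1 := fun j p => (PiLp.norm_apply_le (X p) j).trans (hX1 p)
  have hdir : ∀ j : Fin (d + 1), ∀ t : ℝ,
      ‖(cover (t • EuclideanSpace.single j (1 : ℝ)) : SpaceTime d)‖ ≤ |t| := by
    intro j
    refine Fin.cases (fun t => ?_) (fun i t => ?_) j
    · rw [cover_smul_single_zero]; simp [Prod.norm_def]
    · rw [cover_smul_single_succ, Prod.norm_def, norm_zero, max_eq_right (norm_nonneg _),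
        Pi.norm_single]
      exact AddCircle.norm_coe_le t
  have hj : ∀ j, |∫ p in U, f p * dirDeriv (EuclideanSpace.single j 1) (fun q => X q j) p| ≤ C :=
    fun j => abs_integral_mul_dirDeriv_le hU hf hC (htest j) (hb j) (hdir j)
  have hint : ∀ j, IntegrableOn
      (fun p => f p * dirDeriv (EuclideanSpace.single j 1) (fun q => X q j) p) U := by
    intro j
    obtain ⟨B, -, hB⟩ := exists_abs_dirDeriv_le (htest j).contDiff (EuclideanSpace.single j 1)
      (htest j).hasCompactSupport
    exact Integrable.mul_bdd (c := B) hf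
      (continuous_dirDeriv (htest j).contDiff _).aestronglyMeasurable (ae_of_all _ hB)
  have hdiv : ∀ p, f p * divergence X p =
      ∑ j, f p * dirDeriv (EuclideanSpace.single j 1) (fun q => X q j) p := by
    intro p
    rw [Fin.sum_univ_succ, divergence, timeDeriv_eq_dirDeriv, mul_add, Finset.mul_sum]
    simp only [spaceDeriv_eq_dirDeriv]
  simp only [hdiv]
  rw [integral_finsetSum _ fun j _ => hint j]
  calc _ ≤ ∑ _j : Fin (d + 1), (C : ℝ) :=
        Finset.sum_le_sum fun j _ => (le_abs_self _).trans (hj j)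
    _ = _ := by simp

/-! ### Compactness from translation estimates -/

theorem abs_mollify_sub_le {δ : ℝ} (hδ : 0 < δ) {f : SpaceTime d → ℝ} (hf : Integrable f)
    {p p' : SpaceTime d} {η : ℝ} (hη : ∀ q, |mollifier δ (p - q) - mollifier δ (p' - q)| ≤ η) :
    |mollify δ f p - mollify δ f p'| ≤ η * ∫ q, ‖f q‖ := by
  rw [mollify, mollify, ← integral_sub (integrable_mul_mollifier hδ hf p)
    (integrable_mul_mollifier hδ hf p'), ← integral_const_mul, ← Real.norm_eq_abs]
  refine norm_integral_le_of_norm_le (hf.norm.const_mul η) (ae_of_all _ fun q => ?_)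
  rw [← mul_sub, norm_mul, mul_comm]
  exact mul_le_mul_of_nonneg_right (hη q) (norm_nonneg _)

/-- The mollifications of a bounded sequence are totally bounded in the uniform norm. -/
theorem exists_finite_net_mollify {δ : ℝ} (hδ : 0 < δ) {f : ℕ → SpaceTime d → ℝ}
    (hf : ∀ n, Integrable (f n)) {r I : ℝ} (hr : ∀ n p, |f n p| ≤ r) (hI : ∀ n, ∫ q, ‖f n q‖ ≤ I)
    {K : Set (SpaceTime d)} (hK : IsCompact K) (N : ℕ) {η : ℝ} (hη : 0 < η) :
    ∃ F : Finset ℕ, (∀ m ∈ F, N ≤ m) ∧ ∀ n ≥ N, ∃ m ∈ F, ∀ p ∈ K,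
      |mollify δ (f n) p - mollify δ (f m) p| ≤ η := by
  have : CompactSpace K := isCompact_iff_compactSpace.1 hK
  let g : ℕ → BoundedContinuousFunction K ℝ := fun n => BoundedContinuousFunction.mkOfCompact
    ⟨fun p => mollify δ (f n) p, (continuous_mollify hδ (hf n)).comp continuous_subtype_val⟩
  have hI0 : 0 ≤ I := (integral_nonneg fun _ => norm_nonneg _).trans (hI 0)
  have huc : UniformContinuous (mollifier (d := d) δ) :=
    (hasCompactSupport_mollifier hδ.le).uniformContinuous_of_continuous (continuous_mollifier δ)
  -- The modulus of continuity comes from the fixed mollifier and the common L¹ bound alone, so it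
  -- is independent of n.
  have heq : Equicontinuous ((↑) : g '' Ici N → K → ℝ) := by
    intro x
    rw [Metric.equicontinuousAt_iff]
    intro ε hε
    obtain ⟨ω, hω, h⟩ := Metric.uniformContinuous_iff.1 huc (ε / (I + 1)) (by positivity)
    refine ⟨ω, hω, ?_⟩
    rintro y hy ⟨_, n, -, rfl⟩
    rw [Real.dist_eq]
    have h1 := abs_mollify_sub_le hδ (hf n) (p := (x : SpaceTime d)) (p' := y)
      (η := ε / (I + 1)) fun q => by
        rw [← Real.dist_eq]
        refine (h ?_).le
        rw [dist_sub_right, dist_comm]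
        exact hy
    refine lt_of_le_of_lt h1 ?_
    calc ε / (I + 1) * ∫ q, ‖f n q‖ ≤ ε / (I + 1) * I := by gcongr; exact hI n
      _ < ε / (I + 1) * (I + 1) := by gcongr; linarith
      _ = ε := by field_simp
  have hcomp := BoundedContinuousFunction.arzela_ascoli (Icc (-r) r) isCompact_Icc (g '' Ici N)
    (by
      rintro _ x ⟨n, -, rfl⟩
      exact abs_le.1 (abs_mollify_le hδ (hf n) (hr n) x)) heq
  have htb : TotallyBounded (g '' Ici N) := hcomp.totallyBounded.subset subset_closure
  -- The centres are taken inside the family itself, so that their indices are at least N and the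
  -- estimates valid for large n apply to them too.
  obtain ⟨t, htsub, htfin, ht⟩ := totallyBounded_iff_subset.1 htb _ (Metric.dist_mem_uniformity hη)
  obtain ⟨F, hFN, hFfin, rfl⟩ : ∃ F ⊆ Ici N, F.Finite ∧ g '' F = t := by
    choose! i hi hgi using fun y (hy : y ∈ t) => htsub hy
    exact ⟨i '' t, image_subset_iff.2 hi, htfin.image i, by
      rw [image_image, image_congr hgi, image_id']⟩
  refine ⟨hFfin.toFinset, fun m hm => hFN (hFfin.mem_toFinset.1 hm), fun n hn => ?_⟩
  obtain ⟨m, hm, hdist⟩ : ∃ m ∈ F, dist (g n) (g m) < η := by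
    have h := ht (mem_image_of_mem g hn)
    simp only [mem_iUnion, exists_prop, exists_mem_image] at h
    exact h
  refine ⟨m, hFfin.mem_toFinset.2 hm, fun p hp => ?_⟩
  have h1 := BoundedContinuousFunction.dist_coe_le_dist (f := g n) (g := g m) ⟨p, hp⟩
  rw [Real.dist_eq] at h1
  exact h1.trans (le_of_lt hdist)

/-- A Fréchet–Kolmogorov argument with defect λₙ: at a fixed scale δ the functions with λₙ ≤ δ lie
within 2Cδ of their mollifications, which have a finite uniform net. The finitely many remaining
indices are added to the net. -/
theorem exists_finite_net_of_translationError_le {Ω K : Set (SpaceTime d)}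
    (hΩ : MeasurableSet Ω) (hΩfin : volume Ω ≠ ∞) (hK : IsCompact K) (hKΩ : K ⊆ interior Ω)
    {u : ℕ → SpaceTime d → ℝ} (hum : ∀ n, Measurable (u n)) (hu : ∀ n p, |u n p| ≤ 1)
    {lam : ℕ → ℝ} (hlam : Tendsto lam atTop (𝓝 0)) {C : ℝ≥0∞} (hC : C ≠ ∞)
    {δ₀ : ℝ} (hδ₀ : 0 < δ₀) (hT : ∀ᶠ n in atTop, ∀ h : SpaceTime d, ‖h‖ ≤ δ₀ →
      translationError K (u n) h ≤ C * ENNReal.ofReal (‖h‖ + lam n))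
    {η : ℝ≥0∞} (hη : η ≠ 0) :
    ∃ F : Finset ℕ, ∀ n, ∃ m ∈ F, ∫⁻ p in K, ‖u n p - u m p‖ₑ ≤ η := by
  obtain ⟨δ₁, hδ₁, hsub⟩ := hK.exists_cthickening_subset_open isOpen_interior hKΩ
  have hη3 : η / 3 ≠ 0 := by simpa using hη
  obtain ⟨δ, hδ, hδle, hCδ⟩ : ∃ δ : ℝ, 0 < δ ∧ δ ≤ min δ₀ δ₁ ∧
      C * ENNReal.ofReal (2 * δ) ≤ η / 3 := by
    have h1 : Tendsto (fun δ : ℝ => C * ENNReal.ofReal (2 * δ)) (𝓝[>] 0) (𝓝 (C * 0)) := by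
      refine ENNReal.Tendsto.const_mul ?_ (Or.inr hC)
      have : Tendsto (fun δ : ℝ => ENNReal.ofReal (2 * δ)) (𝓝 0) (𝓝 (ENNReal.ofReal (2 * 0))) :=
        (ENNReal.continuous_ofReal.comp (by fun_prop)).tendsto 0
      simp only [mul_zero, ENNReal.ofReal_zero] at this
      exact this.mono_left nhdsWithin_le_nhds
    rw [mul_zero] at h1
    have h2 := ENNReal.tendsto_nhds_zero.1 h1 (η / 3) (pos_iff_ne_zero.2 hη3)
    have h3 : ∀ᶠ δ : ℝ in 𝓝[>] 0, δ ∈ Ioo 0 (min δ₀ δ₁) := Ioo_mem_nhdsGT (lt_min hδ₀ hδ₁)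
    obtain ⟨δ, h4, h5⟩ := (h2.and h3).exists
    exact ⟨δ, h5.1, h5.2.le, h4⟩
  obtain ⟨N, hN⟩ := eventually_atTop.1 (hT.and (hlam.eventually (ge_mem_nhds hδ)))
  set f : ℕ → SpaceTime d → ℝ := fun n => Ω.indicator (u n) with hf
  have hfm : ∀ n, Measurable (f n) := fun n => (hum n).indicator hΩ
  have hfi : ∀ n, Integrable (f n) := fun n => (integrable_indicator_iff hΩ).2
    (Measure.integrableOn_of_bounded (M := 1) hΩfin (hum n).aestronglyMeasurable
      (ae_of_all _ (hu n)))
  have hf1 : ∀ n p, |f n p| ≤ 1 := by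
    intro n p
    by_cases hp : p ∈ Ω
    · simpa [hf, hp] using hu n p
    · simp [hf, hp]
  have hfI : ∀ n, ∫ q, ‖f n q‖ ≤ volume.real Ω := by
    intro n
    have h1 : ∀ q, ‖f n q‖ ≤ Ω.indicator (fun _ => (1 : ℝ)) q := by
      intro q
      by_cases hq : q ∈ Ω
      · simpa [hf, hq] using hu n q
      · simp [hf, hq]
    calc ∫ q, ‖f n q‖ ≤ ∫ q, Ω.indicator (fun _ => (1 : ℝ)) q :=
          integral_mono (hfi n).norm
            ((integrable_indicator_iff hΩ).2 (integrableOn_const hΩfin)) h1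
      _ = volume.real Ω := by rw [integral_indicator hΩ]; simp
  have hfT : ∀ n, ∀ h : SpaceTime d, ‖h‖ ≤ δ → translationError K (f n) h =
      translationError K (u n) h := by
    intro n h hh
    refine setLIntegral_congr_fun hK.measurableSet fun p hp => ?_
    have h1 : p ∈ Ω := interior_subset (hKΩ hp)
    have h2 : p - h ∈ Ω := interior_subset (hsub
      (Metric.mem_cthickening_of_dist_le _ p δ₁ K hp (by
        rw [dist_eq_norm, sub_sub_cancel_left, norm_neg]
        exact hh.trans (hδle.trans (min_le_right _ _)))))
    simp only [hf, indicator_of_mem h1, indicator_of_mem h2]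
  have hmoll : ∀ n ≥ N, ∫⁻ p in K, ‖mollify δ (f n) p - f n p‖ₑ ≤ η / 3 := by
    intro n hn
    refine lintegral_mollify_sub_le hδ (hfi n) (hfm n) fun h hh => ?_
    rw [hfT n h hh]
    refine ((hN n hn).1 h (hh.trans (hδle.trans (min_le_left _ _)))).trans (le_trans ?_ hCδ)
    gcongr
    linarith [(hN n hn).2]
  have hKfin : volume K ≠ ∞ := hK.measure_lt_top.ne
  obtain ⟨κ, hκ, hκη⟩ : ∃ κ : ℝ, 0 < κ ∧ ENNReal.ofReal κ * volume K ≤ η / 3 := by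
    obtain ⟨κ, hκ0, hκ⟩ := ENNReal.exists_nnreal_pos_mul_lt hKfin hη3
    exact ⟨κ, hκ0, by rw [ENNReal.ofReal_coe_nnreal]; exact hκ.le⟩
  obtain ⟨F, hFN, hF⟩ := exists_finite_net_mollify hδ hfi hf1 hfI hK N hκ
  refine ⟨F ∪ Finset.range N, fun n => ?_⟩
  rcases lt_or_ge n N with hn | hn
  · exact ⟨n, by simp [hn], by simp⟩
  obtain ⟨m, hm, hmn⟩ := hF n hn
  refine ⟨m, by simp [hm], ?_⟩
  have hSm : ∀ n, Measurable (mollify δ (f n)) := fun n => (continuous_mollify hδ (hfi n)).measurable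
  calc ∫⁻ p in K, ‖u n p - u m p‖ₑ
      ≤ ∫⁻ p in K, ((‖mollify δ (f n) p - f n p‖ₑ + ‖mollify δ (f m) p - f m p‖ₑ)
          + ENNReal.ofReal κ) := by
        refine setLIntegral_mono' hK.measurableSet fun p hp => ?_
        have h1 : p ∈ Ω := interior_subset (hKΩ hp)
        have e : ∀ n, f n p = u n p := fun n => indicator_of_mem h1 _
        have h2 : u n p - u m p = -(mollify δ (f n) p - f n p) + (mollify δ (f m) p - f m p) +
            (mollify δ (f n) p - mollify δ (f m) p) := by rw [e, e]; ring
        rw [h2]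
        refine (enorm_add_le _ _).trans (add_le_add ((enorm_add_le _ _).trans ?_) ?_)
        · rw [enorm_neg]
        · rw [← ofReal_norm]; exact ENNReal.ofReal_le_ofReal (hmn p hp)
    _ = (∫⁻ p in K, ‖mollify δ (f n) p - f n p‖ₑ) + (∫⁻ p in K, ‖mollify δ (f m) p - f m p‖ₑ) +
          ENNReal.ofReal κ * volume K := by
        rw [lintegral_add_right _ measurable_const, lintegral_add_left, lintegral_const,
          Measure.restrict_apply_univ]
        exact ((hSm n).sub (hfm n)).enorm
    _ ≤ η / 3 + η / 3 + η / 3 := by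
        gcongr
        · exact hmoll n hn
        · exact hmoll m (hFN m hm)
    _ = η := ENNReal.add_thirds η

/-- Outside a compact K the bounded fields contribute little by smallness of measure. On K the
inverse estimate for φ converts a net for φ(s) into one for s. -/
theorem isCompact_closure_range_of_translationError_le {Ω : Set (SpaceTime d)}
    (hΩ : MeasurableSet Ω) (hΩfin : volume Ω ≠ ∞) (hnull : volume (Ω \ interior Ω) = 0)
    {r : ℝ} (hr0 : 0 < r) (hr1 : r ≤ 1) {lam : ℕ → ℝ} (hlam : Tendsto lam atTop (𝓝 0))
    {s : ℕ → Lp ℝ 1 (volume.restrict Ω)}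
    (hs : ∀ n, ∀ᵐ p ∂(volume.restrict Ω), s n p ∈ Icc (-r) r) {C : ℝ≥0∞} (hC : C ≠ ∞)
    (hT : ∀ K : Set (SpaceTime d), IsCompact K → K ⊆ interior Ω → ∃ δ > 0, ∀ᶠ n in atTop,
        ∀ h : SpaceTime d, ‖h‖ ≤ δ → translationError K
          (fun p => wellPrimitive r (clamp r (s n p))) h ≤ C * ENNReal.ofReal (‖h‖ + lam n)) :
    IsCompact (closure (range s)) := by
  have : Fact (1 ≤ (1 : ℝ≥0∞)) := ⟨le_rfl⟩
  refine TotallyBounded.isCompact_of_isClosed (TotallyBounded.closure ?_) isClosed_closure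
  rw [Metric.totallyBounded_iff]
  intro ε' hε'
  obtain ⟨ε, hεdef⟩ : ∃ ε, ε = ENNReal.ofReal ε' := ⟨_, rfl⟩
  have hε : 0 < ε := by simpa [hεdef] using hε'
  have hεtop : ε ≠ ∞ := by simp [hεdef]
  set σ : ℕ → SpaceTime d → ℝ := fun n p => clamp r (s n p) with hσ
  have hσm : ∀ n, Measurable (σ n) := fun n =>
    (continuous_clamp r).measurable.comp (Lp.stronglyMeasurable (s n)).measurable
  have hσr : ∀ n p, σ n p ∈ Icc (-r) r := fun n p => clamp_mem hr0.le _
  have hum : ∀ n, Measurable fun p => wellPrimitive r (σ n p) := fun n =>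
    (continuous_wellPrimitive r).measurable.comp (hσm n)
  have hu1 : ∀ n p, |wellPrimitive r (σ n p)| ≤ 1 := by
    intro n p
    have h := abs_wellPrimitive_sub_le_abs_sub hr1 (hσr n p) (t := 0) ⟨by linarith, hr0.le⟩
    have h0 : wellPrimitive r 0 = 0 := by simp [wellPrimitive]
    rw [h0, sub_zero, sub_zero] at h
    exact h.trans ((abs_le.2 (hσr n p)).trans hr1)
  have hε4 : ε / 4 ≠ 0 := by simpa using hε.ne'
  have hε4' : 0 < ε / 4 := pos_iff_ne_zero.2 hε4
  have hUfin : volume (interior Ω) ≠ ∞ :=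
    ((measure_mono interior_subset).trans_lt hΩfin.lt_top).ne
  obtain ⟨K, hKU, hK, hKvol⟩ := isOpen_interior.measurableSet.exists_isCompact_sdiff_lt hUfin
    (show ε / 4 / 2 ≠ 0 by simpa using hε.ne')
  have hKΩ : K ⊆ Ω := hKU.trans interior_subset
  have hdiff : volume (Ω \ K) ≤ ε / 4 / 2 := by
    refine le_trans ?_ hKvol.le
    calc volume (Ω \ K) ≤ volume ((Ω \ interior Ω) ∪ (interior Ω \ K)) := by
          refine measure_mono fun p hp => ?_
          by_cases h : p ∈ interior Ω
          · exact Or.inr ⟨h, hp.2⟩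
          · exact Or.inl ⟨hp.1, h⟩
      _ ≤ volume (Ω \ interior Ω) + volume (interior Ω \ K) := measure_union_le _ _
      _ = _ := by rw [hnull, zero_add]
  have hKfin : volume K ≠ ∞ := hK.measure_lt_top.ne
  -- The additive error κ of the inverse estimate uses one quarter of ε on K. It is fixed first,
  -- because the required fineness of the net depends on the resulting factor 3/(rκ).
  obtain ⟨κ, hκ0, hκ⟩ := ENNReal.exists_nnreal_pos_mul_lt hKfin hε4
  have hκ0' : (0 : ℝ) < κ := hκ0
  set D : ℝ := 3 / (r * κ) with hD
  have hD0 : 0 < D := by positivity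
  obtain ⟨δ₀, hδ₀, hTK⟩ := hT K hK hKU
  obtain ⟨F, hF⟩ := exists_finite_net_of_translationError_le hΩ hΩfin hK hKU hum hu1 hlam hC hδ₀
    hTK (η := ε / 4 / ENNReal.ofReal D)
    (ENNReal.div_ne_zero.2 ⟨hε4, ENNReal.ofReal_ne_top⟩)
  refine ⟨s '' F, F.finite_toSet.image s, ?_⟩
  rintro _ ⟨n, rfl⟩
  obtain ⟨m, hm, hnm⟩ := hF n
  refine mem_iUnion₂.2 ⟨s m, mem_image_of_mem s hm, ?_⟩
  rw [Metric.mem_ball, ← edist_lt_ofReal, ← hεdef, Lp.edist_def, eLpNorm_one_eq_lintegral_enorm]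
  have hae : ∀ n, ∀ᵐ p ∂(volume.restrict Ω), s n p = σ n p := fun n => by
    filter_upwards [hs n] with p hp using (clamp_of_mem hp).symm
  have h1 : ∫⁻ p in Ω, ‖(s n - s m : SpaceTime d → ℝ) p‖ₑ = ∫⁻ p in Ω, ‖σ n p - σ m p‖ₑ := by
    refine lintegral_congr_ae ?_
    filter_upwards [hae n, hae m] with p hp1 hp2
    simp only [Pi.sub_apply, hp1, hp2]
  have h2 : ∫⁻ p in Ω \ K, ‖σ n p - σ m p‖ₑ ≤ ε / 4 := by
    calc ∫⁻ p in Ω \ K, ‖σ n p - σ m p‖ₑ ≤ ∫⁻ p in Ω \ K, 2 := by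
          refine lintegral_mono fun p => ?_
          rw [← ofReal_norm, show (2 : ℝ≥0∞) = ENNReal.ofReal 2 by simp]
          refine ENNReal.ofReal_le_ofReal (abs_le.2 ⟨?_, ?_⟩) <;>
            linarith [(hσr n p).1, (hσr n p).2, (hσr m p).1, (hσr m p).2]
      _ = 2 * volume (Ω \ K) := by rw [lintegral_const, Measure.restrict_apply_univ]
      _ ≤ 2 * (ε / 4 / 2) := by gcongr
      _ = ε / 4 := ENNReal.mul_div_cancel (by simp) (by simp)
  have h3 : ∫⁻ p in K, ‖σ n p - σ m p‖ₑ ≤ ε / 4 + ε / 4 := by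
    calc ∫⁻ p in K, ‖σ n p - σ m p‖ₑ ≤ ∫⁻ p in K, ((κ : ℝ≥0∞) + ENNReal.ofReal D *
          ‖wellPrimitive r (σ n p) - wellPrimitive r (σ m p)‖ₑ) := by
          refine lintegral_mono fun p => ?_
          rw [← ofReal_norm, ← ofReal_norm, ← ENNReal.ofReal_mul hD0.le,
            ← ENNReal.ofReal_coe_nnreal, ← ENNReal.ofReal_add hκ0'.le (by positivity)]
          exact ENNReal.ofReal_le_ofReal
            (abs_sub_le_add_wellPrimitive hr0 hκ0' (hσr n p) (hσr m p))
      _ = κ * volume K + ENNReal.ofReal D *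
          ∫⁻ p in K, ‖wellPrimitive r (σ n p) - wellPrimitive r (σ m p)‖ₑ := by
          rw [lintegral_add_left measurable_const, lintegral_const, Measure.restrict_apply_univ,
            lintegral_const_mul' _ _ ENNReal.ofReal_ne_top]
      _ ≤ ε / 4 + ENNReal.ofReal D * (ε / 4 / ENNReal.ofReal D) := by gcongr
      _ = ε / 4 + ε / 4 := by
          rw [ENNReal.mul_div_cancel (by simpa using hD0) ENNReal.ofReal_ne_top]
  rw [h1, ← lintegral_inter_add_sdiff _ Ω hK.measurableSet, inter_eq_self_of_subset_right hKΩ]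
  calc _ ≤ (ε / 4 + ε / 4) + ε / 4 := add_le_add h3 h2
    _ < (ε / 4 + ε / 4) + (ε / 4 + ε / 4) := by
        have h4 : ε / 4 ≠ ∞ := ENNReal.div_ne_top hεtop (by simp)
        rw [← add_assoc]
        exact ENNReal.lt_add_right (by simp [h4]) hε4
    _ = ε := by
        rw [← two_mul, ← two_mul, ← mul_assoc, show (2 : ℝ≥0∞) * 2 = 4 by norm_num]
        exact ENNReal.mul_div_cancel (by simp) (by simp)

/-! ### Cluster points -/

theorem MapClusterPt.exists_seq_tendsto_ae {α : Type*} [MeasurableSpace α] {μ : Measure α}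
    {s : ℕ → Lp ℝ 1 μ} {f : Lp ℝ 1 μ} (hf : MapClusterPt f atTop s) :
    ∃ ns : ℕ → ℕ, Tendsto ns atTop atTop ∧
      ∀ᵐ p ∂μ, Tendsto (fun i => s (ns i) p) atTop (𝓝 (f p)) := by
  obtain ⟨ψ, hψ, hlim⟩ := hf.tendsto_subseq
  rw [tendsto_iff_edist_tendsto_0] at hlim
  simp only [Function.comp_apply, Lp.edist_def] at hlim
  obtain ⟨ns, hns, hae⟩ := (tendstoInMeasure_of_tendsto_eLpNorm one_ne_zero
    (fun n => (Lp.stronglyMeasurable (s (ψ n))).aestronglyMeasurable)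
    (Lp.stronglyMeasurable f).aestronglyMeasurable hlim).exists_seq_tendsto_ae
  exact ⟨ψ ∘ ns, hψ.tendsto_atTop.comp hns.tendsto_atTop, hae⟩

/-- By Fatou's lemma the limit has vanishing potential integral, so r² = f² almost everywhere. -/
theorem ae_eq_or_eq_neg_of_lintegral_le {α : Type*} [MeasurableSpace α] {μ : Measure α}
    {σ : ℕ → α → ℝ} (hσ : ∀ n, Measurable (σ n)) {f : α → ℝ} (hf : Measurable f) {r : ℝ}
    (hae : ∀ᵐ p ∂μ, Tendsto (fun n => σ n p) atTop (𝓝 (f p))) {c : ℕ → ℝ≥0∞}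
    (hc : Tendsto c atTop (𝓝 0))
    (hw : ∀ᶠ n in atTop, ∫⁻ p, ENNReal.ofReal ((r ^ 2 - σ n p ^ 2) ^ 2) ∂μ ≤ c n) :
    ∀ᵐ p ∂μ, f p = r ∨ f p = -r := by
  have h0 : ∫⁻ p, ENNReal.ofReal ((r ^ 2 - f p ^ 2) ^ 2) ∂μ = 0 := by
    refine le_antisymm ?_ zero_le
    calc ∫⁻ p, ENNReal.ofReal ((r ^ 2 - f p ^ 2) ^ 2) ∂μ
        = ∫⁻ p, liminf (fun n => ENNReal.ofReal ((r ^ 2 - σ n p ^ 2) ^ 2)) atTop ∂μ := by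
          refine lintegral_congr_ae ?_
          filter_upwards [hae] with p hp
          exact (ENNReal.tendsto_ofReal (((hp.pow 2).const_sub (r ^ 2)).pow 2)).liminf_eq.symm
      _ ≤ liminf (fun n => ∫⁻ p, ENNReal.ofReal ((r ^ 2 - σ n p ^ 2) ^ 2) ∂μ) atTop :=
          lintegral_liminf_le fun n => by have := hσ n; fun_prop
      _ ≤ liminf c atTop := liminf_le_liminf hw
      _ = 0 := hc.liminf_eq
  rw [lintegral_eq_zero_iff (by fun_prop)] at h0
  filter_upwards [h0] with p hp
  have h1 : (r ^ 2 - f p ^ 2) ^ 2 ≤ 0 := ENNReal.ofReal_eq_zero.1 hp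
  have h2 : r ^ 2 - f p ^ 2 = 0 := pow_eq_zero_iff two_ne_zero |>.1 (le_antisymm h1 (sq_nonneg _))
  exact sq_eq_sq_iff_eq_or_eq_neg.1 (by linarith)

theorem translationError_le_of_tendsto {Ω K : Set (SpaceTime d)} (hΩ : MeasurableSet Ω)
    (hK : MeasurableSet K) (hKΩ : K ⊆ Ω) {h : SpaceTime d} (hKh : ∀ p ∈ K, p - h ∈ Ω)
    {u : ℕ → SpaceTime d → ℝ} (hu : ∀ n, Measurable (u n)) {f : SpaceTime d → ℝ}
    (hae : ∀ᵐ p ∂(volume.restrict Ω), Tendsto (fun n => u n p) atTop (𝓝 (f p)))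
    {c : ℕ → ℝ≥0∞} {c₀ : ℝ≥0∞} (hc : Tendsto c atTop (𝓝 c₀))
    (hT : ∀ᶠ n in atTop, translationError K (u n) h ≤ c n) :
    translationError K f h ≤ c₀ := by
  rw [ae_restrict_iff' hΩ] at hae
  have hae' := (measurePreserving_sub_right volume h).quasiMeasurePreserving.ae hae
  calc translationError K f h
      = ∫⁻ p in K, liminf (fun n => ‖u n (p - h) - u n p‖ₑ) atTop := by
        refine setLIntegral_congr_fun_ae hK ?_
        filter_upwards [hae, hae'] with p h1 h2 hp
        exact ((h2 (hKh p hp)).sub (h1 (hKΩ hp))).enorm.liminf_eq.symm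
    _ ≤ liminf (fun n => translationError K (u n) h) atTop :=
        lintegral_liminf_le fun n =>
          (((hu n).comp (measurable_id.sub_const h)).sub (hu n)).enorm
    _ ≤ liminf c atTop := liminf_le_liminf hT
    _ = c₀ := hc.liminf_eq

/-- For each fixed h the defect λₙ disappears in the limit, leaving C‖h‖ for φ(f). Since f takes
only the values ±r, this is a bound for f itself. -/
theorem memBV_of_tendsto_ae {Ω : Set (SpaceTime d)} (hΩ : MeasurableSet Ω)
    {r : ℝ} (hr0 : 0 < r) {σ : ℕ → SpaceTime d → ℝ} (hσ : ∀ n, Measurable (σ n))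
    {f : SpaceTime d → ℝ} (hfi : IntegrableOn f Ω)
    (hae : ∀ᵐ p ∂(volume.restrict Ω), Tendsto (fun n => σ n p) atTop (𝓝 (f p)))
    (hfr : ∀ᵐ p ∂(volume.restrict Ω), f p = r ∨ f p = -r)
    {lam : ℕ → ℝ} (hlam : Tendsto lam atTop (𝓝 0)) {C : ℝ≥0∞} (hC : C ≠ ∞)
    (hT : ∀ K : Set (SpaceTime d), IsCompact K → K ⊆ interior Ω → ∃ δ > 0, ∀ᶠ n in atTop,
      ∀ h : SpaceTime d, ‖h‖ ≤ δ → translationError K (fun p => wellPrimitive r (σ n p)) h ≤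
        C * ENNReal.ofReal (‖h‖ + lam n)) :
    MemBV (interior Ω) f := by
  -- Since φ(±r) = ±2r³/3, multiplication by 3/(2r²) recovers ±r.
  set D : ℝ := 3 / (2 * r ^ 2) with hD
  have hD0 : 0 < D := by positivity
  refine MemBV.of_translationError_le isOpen_interior (hfi.mono_set interior_subset)
    (C := (ENNReal.ofReal D * C).toNNReal) fun K hK hKU => ?_
  rw [ENNReal.coe_toNNReal (ENNReal.mul_ne_top ENNReal.ofReal_ne_top hC)]
  obtain ⟨δ₁, hδ₁, hsub⟩ := hK.exists_cthickening_subset_open isOpen_interior hKU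
  obtain ⟨δ, hδ, hδT⟩ := hT K hK hKU
  refine ⟨min δ δ₁, lt_min hδ hδ₁, fun h hh => ?_⟩
  have hKΩ : K ⊆ Ω := hKU.trans interior_subset
  have hKh : ∀ p ∈ K, p - h ∈ Ω := fun p hp => interior_subset (hsub
    (Metric.mem_cthickening_of_dist_le _ p δ₁ K hp (by
      rw [dist_eq_norm, sub_sub_cancel_left, norm_neg]
      exact hh.trans (min_le_right _ _))))
  have hc : Tendsto (fun n => C * ENNReal.ofReal (‖h‖ + lam n)) atTop
      (𝓝 (C * ENNReal.ofReal ‖h‖)) := by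
    refine ENNReal.Tendsto.const_mul (ENNReal.tendsto_ofReal ?_) (Or.inr hC)
    simpa using hlam.const_add ‖h‖
  have key : translationError K (fun p => wellPrimitive r (f p)) h ≤ C * ENNReal.ofReal ‖h‖ :=
    translationError_le_of_tendsto hΩ hK.measurableSet hKΩ hKh
      (fun n => (continuous_wellPrimitive r).measurable.comp (hσ n))
      (by filter_upwards [hae] with p hp using
        ((continuous_wellPrimitive r).tendsto _).comp hp) hc
      (hδT.mono fun n hn => hn h (hh.trans (min_le_left _ _)))
  have hval : ∀ x : ℝ, x = r ∨ x = -r → x = D * wellPrimitive r x := by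
    rintro x (rfl | rfl) <;> rw [hD, wellPrimitive] <;> field_simp <;> ring
  rw [ae_restrict_iff' hΩ] at hfr
  have hfr' := (measurePreserving_sub_right volume h).quasiMeasurePreserving.ae hfr
  calc translationError K f h
      = ENNReal.ofReal D * translationError K (fun p => wellPrimitive r (f p)) h := by
        rw [translationError, translationError, ← lintegral_const_mul' _ _ ENNReal.ofReal_ne_top]
        refine setLIntegral_congr_fun_ae hK.measurableSet ?_
        filter_upwards [hfr, hfr'] with p h1 h2 hp
        rw [hval _ (h1 (hKΩ hp)), hval _ (h2 (hKh p hp)), ← mul_sub, enorm_mul,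
          Real.enorm_of_nonneg hD0.le, ← hval _ (h1 (hKΩ hp)), ← hval _ (h2 (hKh p hp))]
    _ ≤ ENNReal.ofReal D * (C * ENNReal.ofReal ‖h‖) := by gcongr
    _ = ENNReal.ofReal D * C * ENNReal.ofReal ‖h‖ := (mul_assoc _ _ _).symm

end IsingGame

end

/-! ### Compactness of bounded-energy sequences and structure of the limits -/

theorem proposition4p2 (d : ℕ) (J : EuclideanSpace ℝ (Fin d) → ℝ)
    (hJ_nonneg : ∀ x, 0 ≤ J x) (hJ_int : Integrable J)
    (hJ_moment : Integrable (fun h => ‖h‖ * J h))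
    (β : ℝ) (hβ : 1 < β * ∫ x, J x)
    (T : ℝ) (hT : 0 < T) (Ω : Set (IsingGame.SpaceTime d))
    (hΩ : IsingGame.IsPolyhedralIn (Ioo 0 T ×ˢ univ) Ω)
    (lam : ℕ → ℝ) (hlam_pos : ∀ n, 0 < lam n) (hlam : Tendsto lam atTop (𝓝 0))
    (s : ℕ → Lp ℝ 1 (volume.restrict Ω))
    (hs : ∀ n, ∀ᵐ p ∂(volume.restrict Ω), s n p ∈
      Icc (-IsingGame.equilibrium β (∫ x, J x)) (IsingGame.equilibrium β (∫ x, J x)))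
    (hG : ∃ M : ℝ≥0, ∀ n, IsingGame.energy J β (lam n) (s n) Ω ≤ M) :
    IsCompact (closure (range s)) ∧
      ∀ f : Lp ℝ 1 (volume.restrict Ω), MapClusterPt f atTop s →
        IsingGame.MemBV (interior Ω) f ∧
          ∀ᵐ p ∂(volume.restrict Ω), f p = IsingGame.equilibrium β (∫ x, J x) ∨
            f p = -IsingGame.equilibrium β (∫ x, J x) := by
  obtain ⟨M, hM⟩ := hG
  have hD : IsOpen (Ioo 0 T ×ˢ univ : Set (IsingGame.SpaceTime d)) := isOpen_Ioo.prod isOpen_univ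
  have hΩm : MeasurableSet Ω := hΩ.measurableSet hD
  have hnull : volume (Ω \ interior Ω) = 0 := hΩ.volume_diff_interior hD
  have hΩfin : volume Ω ≠ ∞ := by
    obtain ⟨E, -, rfl⟩ := hΩ
    have hc : IsCompact (Icc 0 T ×ˢ univ : Set (IsingGame.SpaceTime d)) :=
      isCompact_Icc.prod isCompact_univ
    exact ((measure_mono (inter_subset_right.trans
      (prod_mono Ioo_subset_Icc_self subset_rfl))).trans_lt hc.measure_lt_top).ne
  have hr0 := IsingGame.equilibrium_pos hβ
  have hr1 := (IsingGame.equilibrium_lt_one hβ).le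
  have hsm : ∀ n, Measurable (s n) := fun n => (Lp.stronglyMeasurable (s n)).measurable
  obtain ⟨C, hC, hwell, htrans⟩ := IsingGame.exists_translation_bound hJ_nonneg hJ_int hβ hΩm hnull
    hlam_pos hlam hsm hs hM
  refine ⟨IsingGame.isCompact_closure_range_of_translationError_le hΩm hΩfin hnull hr0 hr1 hlam hs
    hC htrans, fun f hf => ?_⟩
  obtain ⟨ns, hns, hae⟩ := IsingGame.MapClusterPt.exists_seq_tendsto_ae hf
  set r := IsingGame.equilibrium β (∫ x, J x)
  have hσm : ∀ n, Measurable fun p => IsingGame.clamp r (s (ns n) p) := fun n =>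
    (IsingGame.continuous_clamp r).measurable.comp (hsm _)
  -- Countably many null sets are discarded at once, after which truncation changes no term of the
  -- sequence.
  have hσ : ∀ᵐ p ∂(volume.restrict Ω),
      Tendsto (fun n => IsingGame.clamp r (s (ns n) p)) atTop (𝓝 (f p)) := by
    filter_upwards [hae, ae_all_iff.2 hs] with p hp hps
    refine hp.congr fun n => (IsingGame.clamp_of_mem (hps (ns n))).symm
  have hc : Tendsto (fun n => C * ENNReal.ofReal (lam (ns n))) atTop (𝓝 0) := by
    simpa using ENNReal.Tendsto.const_mul (ENNReal.tendsto_ofReal (hlam.comp hns)) (Or.inr hC)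
  have hfr := IsingGame.ae_eq_or_eq_neg_of_lintegral_le hσm (Lp.stronglyMeasurable f).measurable
    hσ hc (hns.eventually hwell)
  refine ⟨IsingGame.memBV_of_tendsto_ae hΩm hr0 hσm (L1.integrable_coeFn f) hσ hfr
    (hlam.comp hns) hC fun K hK hKU => ?_, hfr⟩
  obtain ⟨δ, hδ, h⟩ := htrans K hK hKU
  exact ⟨δ, hδ, hns.eventually h⟩
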